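/- Let $(d_1,\dots,d_m)$ be, in some order, one of $(2,2,2,2)$, $(3,3,3)$, $(2,4,4)$, $(2,3,6)$ (the leg lengths, node included, of the affine Dynkin diagrams $\widetilde D_4,\widetilde E_6,\widetilde E_7,\widetilde E_8$), ordered so that $\ell:=d_m$ is the largest. Let $n\ge 1$, and let $T$ be the $n\times n$ matrix with $T_{ij}=1-\delta_{ij}$. Write $X\sim Y$ if $X$ and $Y$ are conjugate matrices. (Multiplicative case.) For $u=(u_{kj})_{1\le k\le m,\,1\le j\le d_k}$ and $t$ in $\mathbb C^{*}$, let $\widetilde{\mathbb M}_{n,u,t}$ be the variety of $m$-tuples $(X_1,\dots,X_m)\in GL_{n\ell}(\mathbb C)^m$ with $$X_1X_2\cdots X_m=1,\qquad X_k\sim \mathrm{diag}(u_{k1},\dots,u_{kd_k})\otimes \mathrm{Id}_{n\ell/d_k}\ (1\le k\le m-1),$$ $$X_m\sim u_{m\ell}\,t^{2T}\oplus \mathrm{diag}(u_{m1},\dots,u_{m,\ell-1})\otimes \mathrm{Id}_n,$$ and let $\mathbb M_{n,u,t}$ be its categorical quotient by simultaneous conjugation by $PGL_{n\ell}(\mathbb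 C)$, i.e. the spectrum of the algebra of invariant regular functions. Then for generic parameters $(u,t)$ with $q:=\prod_{k,j}u_{kj}^{-\ell/d_k}=1$, $\mathbb M_{n,u,t}$ is a smooth variety over $\mathbb C$ of dimension $2n$. (Additive case.) For complex $\gamma=(\gamma_{kj})$ and $\nu$, let $\widetilde{\mathcal M}_{n,\gamma,\nu}$ be the variety of $m$-tuples $(x_1,\dots,x_m)\in \mathfrak{gl}_{n\ell}(\mathbb C)^m$ with $$x_1+\cdots+x_m=0,\qquad x_k\sim \mathrm{diag}(\gamma_{k1},\dots,\gamma_{kd_k})\otimes \mathrm{Id}_{n\ell/d_k}\ (1\le k\le m-1),$$ $$x_m\sim (\gamma_{m\ell}\mathrm{Id}_n-\nu T)\oplus \mathrm{diag}(\gamma_{m1},\dots,\gamma_{m,\ell-1})\otimes \mathrm{Id}_n,$$ and let $\mathcal M_{n,\gamma,\nu}$ be its categorical quotient by $PGL_{n\ell}(\mathbb C)$. Then for generic parameters $(\gamma,\nu)$ with $\hbar:=\ell\sum_{k,j}\gamma_{kj}/d_k=0$, $\mathcal M_{n,\gamma,\nu}$ is a smooth variety over $\mathbb C$ of dimension $2n$.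 Here "generic" means: for all parameters in a Zariski open, Zariski dense subset (which may depend on $n$ and $(d_k)$) of the parameter variety $\{q=1\}$, respectively $\{\hbar=0\}$. "Smooth of dimension $2n$" means smooth over $\mathbb C$ of relative dimension $2n$ at every point; non-emptiness is not part of the claim. -/

import Mathlib

open scoped Kronecker

noncomputable section

namespace DeligneSimpson

/-- A star-shaped tree with `r + 1` legs is recorded by `a : Fin (r + 1) → ℕ`, where `a k` is the
number of vertices of the `k`-th leg different from the node. `legLength a k` is the number
`d_k` of vertices of the `k`-th leg, the node included. -/
abbrev legLength {r : ℕ} (a : Fin (r + 1) → ℕ) (k : Fin (r + 1)) : ℕ := a k + 1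

/-- The length `ℓ` of the last leg. -/
abbrev ell {r : ℕ} (a : Fin (r + 1) → ℕ) : ℕ := legLength a (Fin.last r)

/-- The star is an affine Dynkin diagram of type `D̃₄`, `Ẽ₆`, `Ẽ₇` or `Ẽ₈`, with its legs
ordered in any way for which the last one is a longest one. -/
def IsAffineStar {r : ℕ} (a : Fin (r + 1) → ℕ) : Prop :=
  (Finset.univ.val.map (legLength a) = ({2, 2, 2, 2} : Multiset ℕ) ∨
    Finset.univ.val.map (legLength a) = ({3, 3, 3} : Multiset ℕ) ∨
    Finset.univ.val.map (legLength a) = ({2, 4, 4} : Multiset ℕ) ∨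
    Finset.univ.val.map (legLength a) = ({2, 3, 6} : Multiset ℕ)) ∧
  ∀ k, legLength a k ≤ ell a

/-- `X ∼ Y`: the two matrices are conjugate. The index set of `Y` is not literally `Fin N`, so it
is identified with `Fin N` by some bijection; the choice of the bijection does not matter. -/
def Similar {N : ℕ} {ι : Type} (X : Matrix (Fin N) (Fin N) ℂ) (Y : Matrix ι ι ℂ) : Prop :=
  ∃ e : ι ≃ Fin N, IsConj X (Matrix.reindex e e Y)

/-- The `n × n` matrix `T` with `T i j = 1 - δ i j`. -/
def matT (n : ℕ) : Matrix (Fin n) (Fin n) ℂ := Matrix.of fun i j => if i = j then 0 else 1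

/-- The matrix `t ^ (2 T)`, that is `exp (2 (log t) T)`, for `t ≠ 0`. As `T` is diagonalizable
with integer eigenvalues, the choice of the logarithm does not matter. -/
def tPowTwoT (n : ℕ) (t : ℂ) : Matrix (Fin n) (Fin n) ℂ :=
  NormedSpace.exp ((2 * Complex.log t) • matT n)

/-- The matrix `diag (c k 1, …, c k d_k) ⊗ Id_{n ℓ / d_k}`. -/
def legMatrix {r : ℕ} (a : Fin (r + 1) → ℕ) (n : ℕ) (c : ∀ k, Fin (legLength a k) → ℂ)
    (k : Fin (r + 1)) :
    Matrix (Fin (legLength a k) × Fin (n * ell a / legLength a k))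
      (Fin (legLength a k) × Fin (n * ell a / legLength a k)) ℂ :=
  Matrix.diagonal (c k) ⊗ₖ 1

/-- The matrix `B ⊕ diag (c m 1, …, c m (ℓ - 1)) ⊗ Id_n`, where `m` is the last leg. -/
def lastLegMatrix {r : ℕ} (a : Fin (r + 1) → ℕ) (n : ℕ) (c : ∀ k, Fin (legLength a k) → ℂ)
    (B : Matrix (Fin n) (Fin n) ℂ) :
    Matrix (Fin n ⊕ Fin (a (Fin.last r)) × Fin n) (Fin n ⊕ Fin (a (Fin.last r)) × Fin n) ℂ :=
  Matrix.fromBlocks B 0 0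
    (Matrix.diagonal (fun j : Fin (a (Fin.last r)) => c (Fin.last r) j.castSucc) ⊗ₖ 1)

/-- Solutions `(X_1, …, X_m)` in `GL_{nℓ}(ℂ)^m` of the multiplicative Deligne–Simpson problem. -/
def mulSolutions {r : ℕ} (a : Fin (r + 1) → ℕ) (n : ℕ) (u : ∀ k, Fin (legLength a k) → ℂ)
    (t : ℂ) : Set (Fin (r + 1) → Matrix (Fin (n * ell a)) (Fin (n * ell a)) ℂ) :=
  {X | (∀ k, IsUnit (X k)) ∧
    (List.ofFn X).prod = 1 ∧
    (∀ k : Fin r, Similar (X k.castSucc) (legMatrix a n u k.castSucc)) ∧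
    Similar (X (Fin.last r))
      (lastLegMatrix a n u (u (Fin.last r) (Fin.last _) • tPowTwoT n t))}

/-- Solutions `(x_1, …, x_m)` in `gl_{nℓ}(ℂ)^m` of the additive Deligne–Simpson problem. -/
def addSolutions {r : ℕ} (a : Fin (r + 1) → ℕ) (n : ℕ) (γ : ∀ k, Fin (legLength a k) → ℂ)
    (ν : ℂ) : Set (Fin (r + 1) → Matrix (Fin (n * ell a)) (Fin (n * ell a)) ℂ) :=
  {x | ∑ k, x k = 0 ∧
    (∀ k : Fin r, Similar (x k.castSucc) (legMatrix a n γ k.castSucc)) ∧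
    Similar (x (Fin.last r))
      (lastLegMatrix a n γ (γ (Fin.last r) (Fin.last _) • (1 : Matrix (Fin n) (Fin n) ℂ)
        - ν • matT n))}

/-- The algebra of those functions on a set `S` of `m`-tuples of `N × N` matrices that are
polynomials in the matrix entries. For `S` Zariski closed this is the coordinate ring of the
variety `S`. (For solutions of the multiplicative problem the functions `(det X_k)⁻¹` need not be
adjoined, because `det X_k` is a nonzero constant on the conjugacy class of `X_k`.) -/
def coordinateRing {m N : ℕ} (S : Set (Fin m → Matrix (Fin N) (Fin N) ℂ)) :
    Subalgebra ℂ (S → ℂ) :=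
  (MvPolynomial.aeval (R := ℂ)
    (fun (i : Fin m × Fin N × Fin N) (X : S) => X.1 i.1 i.2.1 i.2.2)).range

/-- The functions on `S` that are invariant under simultaneous conjugation, that is under the
action of `GL_N(ℂ)`, which factors through `PGL_N(ℂ)`. -/
def conjInvariant {m N : ℕ} (S : Set (Fin m → Matrix (Fin N) (Fin N) ℂ)) :
    Subalgebra ℂ (S → ℂ) where
  carrier := {f | ∀ (g : GL (Fin N) ℂ) (X Y : S),
    (∀ k, Y.1 k = (g : Matrix (Fin N) (Fin N) ℂ) * X.1 k * (g⁻¹ : GL (Fin N) ℂ)) → f Y = f X}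
  mul_mem' hf hf' g X Y h := by simp [hf g X Y h, hf' g X Y h]
  add_mem' hf hf' g X Y h := by simp [hf g X Y h, hf' g X Y h]
  algebraMap_mem' _ _ _ _ _ := rfl

/-- The categorical quotient of the affine variety `S` by simultaneous conjugation: the spectrum
of the algebra of invariant regular functions. -/
def quotientByConj {m N : ℕ} (S : Set (Fin m → Matrix (Fin N) (Fin N) ℂ)) :
    AlgebraicGeometry.Scheme.{0} :=
  AlgebraicGeometry.Spec (CommRingCat.of ↥(coordinateRing S ⊓ conjInvariant S))

/-- The structure morphism of the categorical quotient over `Spec ℂ`. -/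
def quotientByConjToSpec {m N : ℕ} (S : Set (Fin m → Matrix (Fin N) (Fin N) ℂ)) :
    quotientByConj S ⟶ AlgebraicGeometry.Spec (CommRingCat.of ℂ) :=
  AlgebraicGeometry.Spec.map
    (CommRingCat.ofHom (algebraMap ℂ ↥(coordinateRing S ⊓ conjInvariant S)))

/-- The index set of the parameters: `some ⟨k, j⟩` stands for `u k j` (or `γ k j`) and `none` for
`t` (or `ν`). -/
abbrev ParamIndex {r : ℕ} (a : Fin (r + 1) → ℕ) : Type :=
  Option ((k : Fin (r + 1)) × Fin (legLength a k))

/-- The parameters `u k j` (or `γ k j`) of a parameter point. -/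
def legParam {r : ℕ} {a : Fin (r + 1) → ℕ} (z : ParamIndex a → ℂ) (k : Fin (r + 1))
    (j : Fin (legLength a k)) : ℂ := z (some ⟨k, j⟩)

/-- The parameter `t` (or `ν`) of a parameter point. -/
def extraParam {r : ℕ} {a : Fin (r + 1) → ℕ} (z : ParamIndex a → ℂ) : ℂ := z none

/-- `q = ∏ u k j ^ (-ℓ / d_k)`; here `d_k` divides `ℓ`. -/
def qParam {r : ℕ} (a : Fin (r + 1) → ℕ) (u : ∀ k, Fin (legLength a k) → ℂ) : ℂ :=
  ∏ k, ∏ j, u k j ^ (-((ell a / legLength a k : ℕ) : ℤ))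

/-- `ħ = ℓ ∑ γ k j / d_k`. -/
def hbarParam {r : ℕ} (a : Fin (r + 1) → ℕ) (γ : ∀ k, Fin (legLength a k) → ℂ) : ℂ :=
  (ell a : ℂ) * ∑ k, ∑ j, γ k j / (legLength a k : ℂ)

/-- The parameters `(u, t)`, all of them nonzero, with `q = 1`. -/
def mulParams {r : ℕ} (a : Fin (r + 1) → ℕ) : Set (ParamIndex a → ℂ) :=
  {z | (∀ i, z i ≠ 0) ∧ qParam a (legParam z) = 1}

/-- The parameters `(γ, ν)` with `ħ = 0`. -/
def addParams {r : ℕ} (a : Fin (r + 1) → ℕ) : Set (ParamIndex a → ℂ) :=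
  {z | hbarParam a (legParam z) = 0}

/-- `P` holds for generic points of `Z`: it holds on a Zariski open subset `{f ≠ 0}` of `Z` which
is Zariski dense in `Z`. -/
def HoldsGenerically {σ : Type} (Z : Set (σ → ℂ)) (P : (σ → ℂ) → Prop) : Prop :=
  ∃ f : MvPolynomial σ ℂ,
    (∀ g : MvPolynomial σ ℂ,
      (∀ z ∈ Z, MvPolynomial.eval z f ≠ 0 → MvPolynomial.eval z g = 0) →
        ∀ z ∈ Z, MvPolynomial.eval z g = 0) ∧
    ∀ z ∈ Z, MvPolynomial.eval z f ≠ 0 → P z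

end DeligneSimpson

end

/-! Write `N = nℓ`. Since `T` is all-ones minus identity, it has the eigenvalue `n - 1` exactly
once, so for generic parameters the last matrix has a simple eigenvalue. Everything rests on the
rank-one projection `p` to its eigenline, which is a polynomial in that matrix.

The functional `z ↦ tr (p z)` on noncommutative polynomials takes values in the ring `A` of
invariant functions. At any field-valued point of `A` the form `(a, b) ↦ tr (p a b)` has rank at
most `N`. If the rank were `r < N`, the form would define an `r`-dimensional representation whose
matrices are diagonalizable with eigenvalues among the given ones, contain the simple one exactly
once, and satisfy the relation. Its trace or determinant would be a numerical relation excluded by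
genericity (`exists_det_gram_ne_zero`). So some `N × N` Gram determinant is nonzero at every point
of the quotient.

This has two consequences. First, solutions have only scalar centralizers (`trivialCentralizer`). By
duality for the trace form the linearized relation is then surjective up to scalars, and the scalar
obstruction is killed by the trace or the determinant. Hence the scheme of solutions framed by
eigenbases, with ring `O`, is smooth (`smooth_frameRing`) and in particular reduced. Second, where a
Gram determinant is invertible, matrices over a localization of `A` represent all solutions up to
conjugation (`exists_isSlice`). Choosing eigenvectors for them gives local sections `O → A_a` of the
pullback `A → O` (`exists_section`), so `A_a` is a retract of a localization of a smooth algebra,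
hence smooth (`smooth_away_of_factor`).

The section also makes the tangent space of the quotient the tangent space of `O`, of dimension `mN²
+ 1 - N²`, modulo the directions of simultaneous conjugation and changes of eigenbases, of dimension
`N² + ∑ dim Z(X_k) - 1`. For affine diagrams `∑ 1/d_k = m - 2`, and the splitting of one eigenspace
of size `n` into `1 + (n - 1)` leaves `2n`.

Genericity is a finite list of inequalities. The parameter variety is irreducible, because any two
of its points lie on an entire curve inside it. An inequality could fail identically only if its
exponent vector were constant along each leg and did not involve the extra parameter; counting
labels on the last leg then forces a part of full size `N` (`exists_condForm_ne_zero`). -/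

open scoped Kronecker TensorProduct

noncomputable section

namespace DeligneSimpson

/-! ### Smooth algebras over a field are reduced. -/

section Reduced

/-- An étale algebra over a domain is reduced. -/
theorem isReduced_of_etale_of_isDomain (P B : Type) [CommRing P] [IsDomain P] [CommRing B]
    [Algebra P B] [Algebra.Etale P B] : IsReduced B := by
  let K := FractionRing P
  have : IsReduced (K ⊗[P] B) := Algebra.FormallyUnramified.isReduced_of_field K (K ⊗[P] B)
  have hflat : Module.Flat P B := inferInstance
  have hinj : Function.Injective (Algebra.TensorProduct.includeRight : B →ₐ[P] K ⊗[P] B) :=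
    Algebra.TensorProduct.includeRight_injective (IsFractionRing.injective P K)
  exact isReduced_of_injective (Algebra.TensorProduct.includeRight : B →ₐ[P] K ⊗[P] B) hinj

/-- A smooth algebra over a field is reduced. -/
theorem isReduced_of_smooth (k B : Type) [Field k] [CommRing B] [Algebra k B]
    [Algebra.Smooth k B] : IsReduced B := by
  constructor
  intro x hx
  by_contra hne
  -- A nonzero `x` has a proper annihilator; at a maximal ideal above it, `x` stays nonzero in every
  -- neighbourhood. Some neighbourhood is étale over affine space, hence reduced.
  obtain ⟨m, hm, hle⟩ := Ideal.exists_le_maximal (Ideal.span {x}).annihilator (by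
    intro h
    have : (1 : B) ∈ (Ideal.span {x}).annihilator := h ▸ Submodule.mem_top
    rw [Submodule.mem_annihilator_span_singleton] at this
    exact hne (by simpa using this))
  have : m.IsPrime := hm.isPrime
  have : Algebra.IsSmoothAt k m := inferInstanceAs (Algebra.FormallySmooth k (Localization.AtPrime m))
  obtain ⟨f, hf, n, _, _, _⟩ := Algebra.IsSmoothAt.exists_isStandardEtale_mvPolynomial
    (R := k) (p := m)
  have : IsReduced (Localization.Away f) := isReduced_of_etale_of_isDomain (MvPolynomial (Fin n) k) _
  have h0 : algebraMap B (Localization.Away f) x = 0 := (hx.map (algebraMap B _)).eq_zero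
  obtain ⟨⟨_, N, rfl⟩, hN⟩ := (IsLocalization.map_eq_zero_iff (Submonoid.powers f) _ x).mp h0
  have : f ^ N ∈ m := hle (by
    rw [Submodule.mem_annihilator_span_singleton]; simpa using hN)
  exact hf (hm.isPrime.mem_of_pow_mem _ this)

end Reduced

/-! ### Tangent vectors at complex points. -/

section PointDerivation

variable {A : Type} [CommRing A] [Algebra ℂ A]

/-- The point derivations of a complex algebra at a complex point `χ`. -/
def pointDerivation (χ : A →ₐ[ℂ] ℂ) : Submodule ℂ (A →ₗ[ℂ] ℂ) where
  carrier := {D | ∀ a b, D (a * b) = χ a * D b + χ b * D a}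
  add_mem' hD hE a b := by simp [hD a b, hE a b]; ring
  zero_mem' a b := by simp
  smul_mem' c D hD a b := by simp [hD a b]; ring

theorem mem_pointDerivation {χ : A →ₐ[ℂ] ℂ} {D : A →ₗ[ℂ] ℂ} :
    D ∈ pointDerivation χ ↔ ∀ a b, D (a * b) = χ a * D b + χ b * D a := Iff.rfl

theorem pointDerivation_one {χ : A →ₐ[ℂ] ℂ} {D : A →ₗ[ℂ] ℂ} (hD : D ∈ pointDerivation χ) :
    D 1 = 0 := by
  have := hD 1 1
  simpa using this

/-- The homomorphism to the dual numbers attached to a point derivation. -/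
def toDualNumber {χ : A →ₐ[ℂ] ℂ} {D : A →ₗ[ℂ] ℂ} (hD : D ∈ pointDerivation χ) :
    A →ₐ[ℂ] DualNumber ℂ :=
  AlgHom.ofLinearMap
    { toFun := fun a => TrivSqZeroExt.inl (χ a) + TrivSqZeroExt.inr (D a)
      map_add' := fun a b => by ext <;> simp
      map_smul' := fun c a => by ext <;> simp }
    (by ext <;> simp [pointDerivation_one hD])
    (fun a b => by
      ext
      · simp
      · simp [hD a b, mul_comm])

@[simp] theorem fst_toDualNumber {χ : A →ₐ[ℂ] ℂ} {D : A →ₗ[ℂ] ℂ} (hD : D ∈ pointDerivation χ)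
    (a : A) : (toDualNumber hD a).fst = χ a := by simp [toDualNumber]

@[simp] theorem snd_toDualNumber {χ : A →ₐ[ℂ] ℂ} {D : A →ₗ[ℂ] ℂ} (hD : D ∈ pointDerivation χ)
    (a : A) : (toDualNumber hD a).snd = D a := by simp [toDualNumber]

/-- The infinitesimal part of a homomorphism to the dual numbers. -/
def sndPart (Φ : A →ₐ[ℂ] DualNumber ℂ) : A →ₗ[ℂ] ℂ where
  toFun a := (Φ a).snd
  map_add' a b := by simp
  map_smul' c a := by simp

theorem sndPart_mem {χ : A →ₐ[ℂ] ℂ} {Φ : A →ₐ[ℂ] DualNumber ℂ} (h : ∀ a, (Φ a).fst = χ a) :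
    sndPart Φ ∈ pointDerivation χ := by
  intro a b
  simp [sndPart, h, mul_comm]

/-- Pulling back point derivations along an algebra homomorphism. -/
def pointDerivationComap {B : Type} [CommRing B] [Algebra ℂ B] (φ : A →ₐ[ℂ] B) (χ : B →ₐ[ℂ] ℂ) :
    pointDerivation χ →ₗ[ℂ] pointDerivation (χ.comp φ) where
  toFun D := ⟨D.1 ∘ₗ φ.toLinearMap, fun a b => by simpa using D.2 (φ a) (φ b)⟩
  map_add' _ _ := rfl
  map_smul' _ _ := rfl

/-- A point derivation is a homomorphism to the dual numbers. It extends to the localization because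
an element of `ℂ[ε]` with invertible constant term is a unit; uniqueness is the Leibniz rule. -/
theorem pointDerivationComap_bijective (a : A) {B : Type} [CommRing B] [Algebra ℂ B]
    [Algebra A B] [IsScalarTower ℂ A B] [IsLocalization.Away a B] (χ : B →ₐ[ℂ] ℂ) :
    Function.Bijective (pointDerivationComap (IsScalarTower.toAlgHom ℂ A B) χ) := by
  constructor
  · rw [← LinearMap.ker_eq_bot, LinearMap.ker_eq_bot']
    rintro ⟨D, hD⟩ h0
    have h0' : ∀ x, D (algebraMap A B x) = 0 := fun x => LinearMap.congr_fun (Subtype.ext_iff.mp h0) x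
    ext x
    obtain ⟨n, y, hy⟩ := IsLocalization.Away.surj a x
    have h1 := hD x (algebraMap A B a ^ n)
    rw [hy, h0', ← map_pow, h0', mul_zero, zero_add] at h1
    have hu : IsUnit (χ (algebraMap A B (a ^ n))) := by
      rw [map_pow]
      exact ((IsLocalization.Away.algebraMap_isUnit (S := B) a).pow n).map χ
    simpa using (mul_eq_zero.mp h1.symm).resolve_left hu.ne_zero
  · rintro ⟨D, hD⟩
    have hu : ∀ y : Submonoid.powers a, IsUnit (toDualNumber hD y) := by
      rintro ⟨_, n, rfl⟩
      rw [map_pow]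
      refine IsUnit.pow n ?_
      rw [TrivSqZeroExt.isUnit_iff_isUnit_fst, fst_toDualNumber]
      exact (IsLocalization.Away.algebraMap_isUnit (S := B) a).map χ
    let Φ : B →ₐ[ℂ] DualNumber ℂ := IsLocalization.liftAlgHom (M := Submonoid.powers a) (S := B) hu
    have hΦ : ∀ x, Φ (algebraMap A B x) = toDualNumber hD x := fun x => by
      simp [Φ]
    have hfst : ∀ b, (Φ b).fst = χ b := by
      have : (TrivSqZeroExt.fstHom ℂ ℂ ℂ).comp Φ = χ := by
        refine IsLocalization.algHom_ext (Submonoid.powers a) ?_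
        ext x
        change (Φ (algebraMap A B x)).fst = χ (algebraMap A B x)
        rw [hΦ, fst_toDualNumber]
        rfl
      intro b
      exact DFunLike.congr_fun this b
    refine ⟨⟨sndPart Φ, sndPart_mem hfst⟩, ?_⟩
    ext x
    simp [pointDerivationComap, sndPart, hΦ]

theorem exists_algHom_away_comp_eq {R : Type} [CommRing R] [Algebra ℂ R] (a : A) (χ : A →ₐ[ℂ] R)
    (hχ : IsUnit (χ a)) (B : Type) [CommRing B] [Algebra ℂ B]
    [Algebra A B] [IsScalarTower ℂ A B] [IsLocalization.Away a B] :
    ∃ χ' : B →ₐ[ℂ] R, χ'.comp (IsScalarTower.toAlgHom ℂ A B) = χ := by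
  have hu : ∀ y : Submonoid.powers a, IsUnit (χ y) := by
    rintro ⟨_, n, rfl⟩
    rw [map_pow]
    exact hχ.pow n
  refine ⟨IsLocalization.liftAlgHom (M := Submonoid.powers a) (S := B) hu, ?_⟩
  ext x
  change IsLocalization.liftAlgHom (M := Submonoid.powers a) (S := B) hu (algebraMap A B x) = _
  simp

/-- If the module of differentials has a basis, the dimension of the space of point derivations is
the size of the basis. -/
theorem finrank_pointDerivation (χ : A →ₐ[ℂ] ℂ) {ι : Type} [Finite ι]
    (b : Module.Basis ι A (Ω[A⁄ℂ])) :
    Module.finrank ℂ (pointDerivation χ) = Nat.card ι := by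
  let : Algebra A ℂ := χ.toRingHom.toAlgebra
  have hsm : ∀ (a : A) (z : ℂ), a • z = χ a * z := fun a z => rfl
  have : IsScalarTower ℂ A ℂ := ⟨fun r a z => by simp [hsm, mul_assoc]⟩
  have : SMulCommClass A ℂ ℂ := ⟨fun a r z => by simp [hsm]; ring⟩
  have := Fintype.ofFinite ι
  let e1 : (ι → ℂ) ≃ₗ[ℂ] (Ω[A⁄ℂ] →ₗ[A] ℂ) := b.constr ℂ
  let e3 : pointDerivation χ ≃ (Ω[A⁄ℂ] →ₗ[A] ℂ) :=
    Equiv.trans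
      { toFun := fun D => Derivation.mk' D.1 (fun a b => D.2 a b)
        invFun := fun D => ⟨D.toLinearMap, fun a b => D.leibniz a b⟩
        left_inv := fun D => rfl
        right_inv := fun D => rfl }
      (KaehlerDifferential.linearMapEquivDerivation ℂ A).toEquiv.symm
  let e4 : pointDerivation χ →ₗ[ℂ] (ι → ℂ) :=
    { toFun := fun D i => e3 D (b i)
      map_add' := fun D E => by
        ext i
        have : e3 (D + E) = e3 D + e3 E := by
          apply (KaehlerDifferential.linearMapEquivDerivation ℂ A).injective
          ext x
          simp [e3]
          rfl
        simp [this]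
      map_smul' := fun r D => by
        ext i
        have : e3 (r • D) = r • e3 D := by
          apply (KaehlerDifferential.linearMapEquivDerivation ℂ A).injective
          ext x
          simp [e3]
          rfl
        simp [this] }
  have hbij : Function.Bijective e4 := by
    constructor
    · intro D E h
      apply e3.injective
      apply b.ext
      intro i
      exact congrFun h i
    · intro v
      refine ⟨e3.symm (e1 v), ?_⟩
      ext i
      change e3 (e3.symm (e1 v)) (b i) = v i
      rw [Equiv.apply_symm_apply]
      exact b.constr_basis ℂ v i
  rw [(LinearEquiv.ofBijective e4 hbij).finrank_eq]
  simp [Nat.card_eq_fintype_card]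

/-- For a standard smooth algebra the differentials are free and their rank is the relative
dimension, so the tangent space at a single complex point determines it. -/
theorem isStandardSmoothOfRelativeDimension_of_finrank [Algebra.IsStandardSmooth ℂ A]
    (χ : A →ₐ[ℂ] ℂ) {d : ℕ} (hd : Module.finrank ℂ (pointDerivation χ) = d) :
    Algebra.IsStandardSmoothOfRelativeDimension d ℂ A := by
  have : Nontrivial A := χ.toRingHom.domain_nontrivial
  rw [Algebra.IsStandardSmoothOfRelativeDimension.iff_of_isStandardSmooth]
  obtain ⟨ι, σ, _, _, ⟨P⟩⟩ := Algebra.IsStandardSmooth.out (R := ℂ) (S := A)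
  rw [← hd, finrank_pointDerivation χ P.basisKaehler]
  have := Module.Finite.finite_basis P.basisKaehler
  rw [← Module.finrank_eq_nat_card_basis P.basisKaehler, Module.finrank_eq_rank]

end PointDerivation

/-! ### A pointwise criterion for smoothness of a given relative dimension. -/

section Criterion

open AlgebraicGeometry in
/-- A criterion for smoothness of relative dimension `d` over `ℂ` at the maximal ideals. -/
theorem smoothOfRelativeDimension_of_forall_maximal {A : Type} [CommRing A] [Algebra ℂ A] (d : ℕ)
    (H : ∀ m : Ideal A, m.IsMaximal → ∃ a ∉ m, Algebra.Smooth ℂ (Localization.Away a) ∧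
      ∃ χ : A →ₐ[ℂ] ℂ, (∀ x ∈ m, χ x = 0) ∧ Module.finrank ℂ (pointDerivation χ) = d) :
    SmoothOfRelativeDimension d
      (Spec.map (CommRingCat.ofHom (algebraMap ℂ A))) := by
  rw [HasRingHomProperty.Spec_iff (P := @SmoothOfRelativeDimension d)]
  rw [RingHom.locally_iff_span_eq_top]
  by_contra hne
  obtain ⟨m, hm, hle⟩ := Ideal.exists_le_maximal _ hne
  obtain ⟨a, ham, hsm, χ, hχ, hd⟩ := H m hm
  have hker : ∀ x, χ x = 0 → x ∈ m := by
    have : m = RingHom.ker χ := hm.eq_of_le (RingHom.ker_ne_top _) hχ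
    intro x hx
    rw [this]
    exact hx
  let B := Localization.Away a
  have : (m.map (algebraMap A B)).IsPrime :=
    IsLocalization.isPrime_of_isPrime_disjoint (.powers a) _ _ hm.isPrime
      ((Ideal.disjoint_powers_iff_notMem_of_isPrime _).mpr ham)
  obtain ⟨g', hg', hstd⟩ := Algebra.IsSmoothAt.exists_notMem_isStandardSmooth ℂ
    (m.map (algebraMap A B))
  -- The standard smooth neighbourhood found inside `Spec A_a` is a principal open subset `D(t)` of
  -- `Spec A` itself.
  have hloc : IsLocalization.Away (a * (IsLocalization.Away.sec a g').1) (Localization.Away g') :=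
    .mul_of_associated _ _ g' <| IsLocalization.Away.associated_sec_fst a g'
  let t := a * (IsLocalization.Away.sec a g').1
  let e : Localization.Away g' ≃ₐ[A] Localization.Away t :=
    IsLocalization.algEquiv (Submonoid.powers t) _ _
  have ht : t ∉ m := by
    refine hm.isPrime.mul_notMem ham fun hmem ↦ hg' ?_
    rw [Ideal.mem_iff_of_associated (IsLocalization.Away.associated_sec_fst a g').symm]
    exact Ideal.mem_map_of_mem (algebraMap A _) hmem
  have hstd' : Algebra.IsStandardSmooth ℂ (Localization.Away t) := .of_algEquiv (e.restrictScalars ℂ)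
  refine ht (hle (Ideal.subset_span ?_))
  change RingHom.IsStandardSmoothOfRelativeDimension d
    ((algebraMap A (Localization.Away t)).comp (algebraMap ℂ A))
  rw [← IsScalarTower.algebraMap_eq, RingHom.isStandardSmoothOfRelativeDimension_algebraMap]
  have hχt : χ t ≠ 0 := fun h => ht (hker _ h)
  obtain ⟨χ', hcomp⟩ := exists_algHom_away_comp_eq t χ (isUnit_iff_ne_zero.mpr hχt)
    (Localization.Away t)
  refine isStandardSmoothOfRelativeDimension_of_finrank χ' ?_
  rw [(LinearEquiv.ofBijective _ (pointDerivationComap_bijective t χ')).finrank_eq, hcomp, hd]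

end Criterion

end DeligneSimpson
end

open scoped Kronecker TensorProduct

noncomputable section

namespace DeligneSimpson

/-! ### Smoothness of retracts. -/

section Retract

/-- If the localization map `A → A_a` factors through a smooth algebra, then `A_a` is smooth. -/
theorem smooth_away_of_factor {A O : Type} [CommRing A] [Algebra ℂ A] [CommRing O] [Algebra ℂ O]
    [Algebra.Smooth ℂ O] (a : A) (φ : A →ₐ[ℂ] O) (ψ : O →ₐ[ℂ] Localization.Away a)
    (h : ∀ x, ψ (φ x) = algebraMap A _ x) : Algebra.Smooth ℂ (Localization.Away a) := by
  let B := Localization.Away a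
  let O' := Localization.Away (φ a)
  obtain ⟨ψ', hψ'⟩ := exists_algHom_away_comp_eq (φ a) ψ
    (by rw [h]; exact IsLocalization.Away.algebraMap_isUnit a) O'
  obtain ⟨φ', hφ'⟩ := exists_algHom_away_comp_eq a ((IsScalarTower.toAlgHom ℂ O O').comp φ)
    (IsLocalization.Away.algebraMap_isUnit (S := O') (φ a)) B
  have hid : ψ'.comp φ' = AlgHom.id ℂ B := by
    refine IsLocalization.algHom_ext (Submonoid.powers a) (AlgHom.ext fun x => ?_)
    have h1 : φ' (algebraMap A B x) = algebraMap O O' (φ x) := DFunLike.congr_fun hφ' x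
    have h2 : ψ' (algebraMap O O' (φ x)) = ψ (φ x) := DFunLike.congr_fun hψ' (φ x)
    change ψ' (φ' (algebraMap A B x)) = algebraMap A B x
    rw [h1, h2, h]
  have hid' : ∀ b, ψ' (φ' b) = b := fun b => DFunLike.congr_fun hid b
  -- `B` is a retract of the smooth algebra `O'`: lift a map from `B` after composing it with `ψ'`,
  -- then restrict the lift along `φ'`.
  have hfs : Algebra.FormallySmooth ℂ B := by
    rw [Algebra.FormallySmooth.iff_comp_surjective]
    intro C _ _ I hI g
    obtain ⟨g', hg'⟩ := Algebra.FormallySmooth.comp_surjective ℂ O' I hI (g.comp ψ')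
    refine ⟨g'.comp φ', ?_⟩
    rw [← AlgHom.comp_assoc, hg', AlgHom.comp_assoc, hid, AlgHom.comp_id]
  have hft : Algebra.FiniteType ℂ B :=
    Algebra.FiniteType.of_surjective ψ' (fun b => ⟨φ' b, hid' b⟩)
  exact { formallySmooth := hfs
          finitePresentation := Algebra.FinitePresentation.of_finiteType.mp hft }

end Retract

/-! ### The additive and multiplicative relations and their linearizations. -/

/-- The two kinds of relation between the members of a tuple: `∑ X k = 0` and `∏ X k = 1`. -/
inductive RelKind
  | sum
  | prod

/-- The derivative of the ordered product of a tuple. -/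
def prodDeriv {M : Type} [Ring M] : ∀ {m : ℕ}, (Fin m → M) → (Fin m → M) → M
  | 0, _, _ => 0
  | _ + 1, X, V => V 0 * (List.ofFn (Fin.tail X)).prod + X 0 * prodDeriv (Fin.tail X) (Fin.tail V)

namespace RelKind

/-- The element whose vanishing is the relation. -/
def rel (κ : RelKind) {M : Type} [Ring M] {m : ℕ} (X : Fin m → M) : M :=
  match κ with
  | sum => ∑ k, X k
  | prod => (List.ofFn X).prod - 1

/-- The derivative of the relation. -/
def relDeriv (κ : RelKind) {M : Type} [Ring M] {m : ℕ} (X V : Fin m → M) : M :=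
  match κ with
  | sum => ∑ k, V k
  | prod => prodDeriv X V

end RelKind

section Deriv

variable {M : Type} [Ring M]

theorem prodDeriv_add {m : ℕ} (X V W : Fin m → M) :
    prodDeriv X (V + W) = prodDeriv X V + prodDeriv X W := by
  induction m with
  | zero => simp [prodDeriv]
  | succ m ih =>
    have : Fin.tail (V + W) = Fin.tail V + Fin.tail W := rfl
    simp only [prodDeriv, this, ih, Pi.add_apply]
    noncomm_ring

theorem prodDeriv_smul {C : Type} [CommRing C] [Algebra C M] {m : ℕ} (X V : Fin m → M) (r : C) :
    prodDeriv X (r • V) = r • prodDeriv X V := by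
  induction m with
  | zero => simp [prodDeriv]
  | succ m ih =>
    have : Fin.tail (r • V) = r • Fin.tail V := rfl
    simp only [prodDeriv, this, ih, Pi.smul_apply, smul_add, smul_mul_assoc, mul_smul_comm]

theorem map_prodDeriv {M' : Type} [Ring M'] (f : M →+* M') {m : ℕ} (X V : Fin m → M) :
    f (prodDeriv X V) = prodDeriv (fun k => f (X k)) (fun k => f (V k)) := by
  induction m with
  | zero => simp [prodDeriv]
  | succ m ih =>
    simp only [prodDeriv, map_add, map_mul, ih, map_list_prod, List.map_ofFn]
    rfl

theorem mul_prodDeriv_eq_zero {m : ℕ} (X V : Fin m → M) (z : M)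
    (h : ∀ l y, z * y * V l = 0) : z * prodDeriv X V = 0 := by
  induction m generalizing z with
  | zero => simp [prodDeriv]
  | succ m ih =>
    rw [prodDeriv, mul_add, ← mul_assoc, ← mul_assoc]
    have h0 := h 0 1
    rw [mul_one] at h0
    rw [h0, zero_mul, zero_add]
    exact ih _ _ _ fun l y => by rw [mul_assoc z]; exact h l.succ _

/-- Terms of degree at least two in `V` vanish. The hypothesis allows any `y` in the middle because
members of `X` stand between two members of `V`. -/
theorem prod_ofFn_add {m : ℕ} (X V : Fin m → M) (h : ∀ k l y, V k * y * V l = 0) :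
    (List.ofFn (X + V)).prod = (List.ofFn X).prod + prodDeriv X V := by
  induction m with
  | zero => simp [prodDeriv]
  | succ m ih =>
    have h1 := ih (Fin.tail X) (Fin.tail V) (fun k l y => h k.succ l.succ y)
    have h2 : V 0 * prodDeriv (Fin.tail X) (Fin.tail V) = 0 :=
      mul_prodDeriv_eq_zero _ _ _ fun l y => h 0 l.succ y
    have h3 : (fun i : Fin m => (X + V) i.succ) = Fin.tail X + Fin.tail V := rfl
    have h4 : (fun i : Fin m => X i.succ) = Fin.tail X := rfl
    rw [List.ofFn_succ, List.ofFn_succ, List.prod_cons, List.prod_cons, h3, h4, h1, prodDeriv,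
      Pi.add_apply, add_mul, mul_add, mul_add, h2]
    abel

theorem RelKind.relDeriv_add (κ : RelKind) {m : ℕ} (X V W : Fin m → M) :
    κ.relDeriv X (V + W) = κ.relDeriv X V + κ.relDeriv X W := by
  cases κ
  · simp [relDeriv, Finset.sum_add_distrib]
  · exact prodDeriv_add X V W

theorem RelKind.relDeriv_smul (κ : RelKind) {C : Type} [CommRing C] [Algebra C M] {m : ℕ}
    (X V : Fin m → M) (r : C) : κ.relDeriv X (r • V) = r • κ.relDeriv X V := by
  cases κ
  · simp [relDeriv, Finset.smul_sum]
  · exact prodDeriv_smul X V r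

theorem RelKind.map_relDeriv (κ : RelKind) {M' : Type} [Ring M'] (f : M →+* M') {m : ℕ}
    (X V : Fin m → M) :
    f (κ.relDeriv X V) = κ.relDeriv (fun k => f (X k)) (fun k => f (V k)) := by
  cases κ
  · simp [relDeriv]
  · exact map_prodDeriv f X V

theorem RelKind.map_rel (κ : RelKind) {M' : Type} [Ring M'] (f : M →+* M') {m : ℕ}
    (X : Fin m → M) : f (κ.rel X) = κ.rel (fun k => f (X k)) := by
  cases κ
  · simp [rel]
  · simp [rel, map_list_prod, List.map_ofFn, Function.comp_def]

theorem RelKind.rel_add (κ : RelKind) {m : ℕ} (X V : Fin m → M)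
    (h : ∀ k l y, V k * y * V l = 0) : κ.rel (X + V) = κ.rel X + κ.relDeriv X V := by
  cases κ
  · simp [relDeriv, rel, Finset.sum_add_distrib]
  · simp only [relDeriv, rel, prod_ofFn_add X V h]
    abel

/-- The relation is equivariant for conjugation. -/
theorem RelKind.rel_conj (κ : RelKind) {m : ℕ} (X : Fin m → M) (g : Mˣ) :
    κ.rel (fun k => g * X k * (g⁻¹ : Mˣ)) = g * κ.rel X * (g⁻¹ : Mˣ) := by
  have := κ.map_rel (MulSemiringAction.toRingHom (ConjAct Mˣ) M (ConjAct.toConjAct g)) X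
  simp only [MulSemiringAction.toRingHom_apply, ConjAct.units_smul_def,
    ConjAct.ofConjAct_toConjAct] at this
  exact this.symm

/-- The derivative of the relation along infinitesimal conjugations, as a linear map. -/
def RelKind.conjDeriv (κ : RelKind) (C : Type) [CommRing C] [Algebra C M] {m : ℕ}
    (X : Fin m → M) : (Fin m → M) →ₗ[C] M where
  toFun η := κ.relDeriv X (fun k => η k * X k - X k * η k)
  map_add' η θ := by
    rw [← κ.relDeriv_add]
    congr 1
    ext k
    simp only [Pi.add_apply]
    noncomm_ring
  map_smul' r η := by
    rw [RingHom.id_apply, ← κ.relDeriv_smul]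
    congr 1
    ext k
    simp [smul_sub]

theorem RelKind.conjDeriv_apply (κ : RelKind) (C : Type) [CommRing C] [Algebra C M] {m : ℕ}
    (X η : Fin m → M) :
    κ.conjDeriv C X η = κ.relDeriv X (fun k => η k * X k - X k * η k) := rfl

theorem RelKind.map_conjDeriv (κ : RelKind) (C C' : Type) [CommRing C] [Algebra C M] {M' : Type}
    [Ring M'] [CommRing C'] [Algebra C' M'] (f : M →+* M') {m : ℕ} (X η : Fin m → M) :
    f (κ.conjDeriv C X η) = κ.conjDeriv C' (fun k => f (X k)) (fun k => f (η k)) := by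
  simp [conjDeriv_apply, map_relDeriv]

/-- The effect on the relation of conjugation by `1 + η`, for `η` in an ideal of square zero. -/
theorem RelKind.rel_conj_one_add (κ : RelKind) (C : Type) [CommRing C] [Algebra C M] {m : ℕ}
    (X η : Fin m → M) (h : ∀ k l y, η k * y * η l = 0) :
    κ.rel (fun k => (1 + η k) * X k * (1 - η k)) = κ.rel X + κ.conjDeriv C X η := by
  have h1 : (fun k => (1 + η k) * X k * (1 - η k)) = X + fun k => η k * X k - X k * η k := by
    ext k
    have := h k k (X k)
    simp only [Pi.add_apply]
    rw [← sub_eq_zero]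
    calc _ = -(η k * X k * η k) := by noncomm_ring
      _ = 0 := by rw [this, neg_zero]
  rw [h1, κ.rel_add, conjDeriv_apply]
  intro k l y
  have e : (η k * X k - X k * η k) * y * (η l * X l - X l * η l) =
    (η k * (X k * y) * η l) * X l - η k * (X k * y * X l) * η l -
      X k * (η k * y * η l) * X l + X k * (η k * (y * X l) * η l) := by noncomm_ring
  rw [e]
  simp [h]

end Deriv

/-! ### The cokernel of the linearized relation and the centralizer. -/

section Matrices

open Matrix

variable {N : ℕ} {C : Type} [CommRing C]

/-- Induction on the length of the product, using nondegeneracy of the trace form. The product `∏ X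
k` is kept on the left of `Z` since partial products need not be `1`. -/
theorem commute_of_forall_trace_prodDeriv {m : ℕ} (X : Fin m → Matrix (Fin N) (Fin N) C)
    (Z : Matrix (Fin N) (Fin N) C)
    (h : ∀ η : Fin m → Matrix (Fin N) (Fin N) C,
      trace (Z * prodDeriv X (fun k => η k * X k - X k * η k)) = 0) (k : Fin m) :
    Commute ((List.ofFn X).prod * Z) (X k) := by
  induction m generalizing Z with
  | zero => exact k.elim0
  | succ m ih =>
    set P := (List.ofFn (Fin.tail X)).prod with hP
    have hp : (List.ofFn X).prod = X 0 * P := by rw [List.ofFn_succ, List.prod_cons]; rfl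
    -- Test with `η` supported at the first index.
    have h0 : X 0 * P * Z = P * Z * X 0 := by
      apply Matrix.ext_iff_trace_mul_left.mpr
      intro η
      have := h (Fin.cons η 0)
      have ht : (Fin.tail fun k => (Fin.cons η 0 : Fin (m + 1) → Matrix (Fin N) (Fin N) C) k * X k -
          X k * (Fin.cons η 0 : Fin (m + 1) → Matrix (Fin N) (Fin N) C) k) = (0 : C) • 0 := by
        ext k
        simp [Fin.tail]
      rw [prodDeriv, ht, prodDeriv_smul, zero_smul, mul_zero, add_zero, ← hP, Fin.cons_zero,
        sub_mul, mul_sub, trace_sub, sub_eq_zero] at this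
      rw [mul_assoc η, mul_assoc (X 0), trace_mul_comm Z, trace_mul_comm Z] at this
      calc trace (η * (X 0 * P * Z)) = trace (η * (X 0 * P) * Z) := by simp only [mul_assoc]
        _ = trace (X 0 * (η * P) * Z) := this
        _ = trace (η * (P * Z * X 0)) := by
          rw [mul_assoc, trace_mul_comm]; simp only [mul_assoc]
    -- Test with `η` vanishing at the first index: the derivative is `X 0` times that of the tail,
    -- so the tail satisfies the hypothesis with `Z * X 0`.
    have h1 : ∀ j, Commute (P * (Z * X 0)) (Fin.tail X j) := by
      intro j
      refine ih (Fin.tail X) (Z * X 0) (fun η => ?_) j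
      have := h (Fin.cons 0 η)
      rw [prodDeriv] at this
      simp only [Fin.cons_zero, zero_mul, mul_zero, sub_zero, zero_add] at this
      rw [mul_assoc]
      exact this
    have h2 : (List.ofFn X).prod * Z = P * (Z * X 0) := by rw [hp, h0, mul_assoc]
    rw [h2]
    refine Fin.cases ?_ (fun j => h1 j) k
    change P * (Z * X 0) * X 0 = X 0 * (P * (Z * X 0))
    calc P * (Z * X 0) * X 0 = X 0 * P * Z * X 0 := by rw [h0]; simp only [mul_assoc]
      _ = X 0 * (P * (Z * X 0)) := by simp only [mul_assoc]

/-- Under the trace form, the orthogonal complement of the image of the linearized relation lies in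
the centralizer of the solution. This turns trivial centralizers into near-surjectivity. -/
theorem RelKind.commute_of_forall_trace (κ : RelKind) {m : ℕ}
    (X : Fin m → Matrix (Fin N) (Fin N) C) (hX : κ.rel X = 0) (Z : Matrix (Fin N) (Fin N) C)
    (h : ∀ η : Fin m → Matrix (Fin N) (Fin N) C, trace (Z * κ.conjDeriv C X η) = 0) (k : Fin m) :
    Commute Z (X k) := by
  cases κ with
  | sum =>
    apply Matrix.ext_iff_trace_mul_left.mpr
    intro η
    have := h (Pi.single k η)
    rw [conjDeriv_apply, relDeriv, Finset.sum_eq_single k] at this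
    · rw [Pi.single_eq_same, mul_sub, trace_sub, sub_eq_zero] at this
      calc trace (η * (Z * X k)) = trace (Z * (X k * η)) := by
            rw [trace_mul_comm, mul_assoc]
        _ = trace (Z * (η * X k)) := this.symm
        _ = trace (η * (X k * Z)) := by rw [trace_mul_comm, mul_assoc]
    · intro j _ hj
      simp [Pi.single_eq_of_ne hj]
    · simp
  | prod =>
    have hp : (List.ofFn X).prod = 1 := sub_eq_zero.mp hX
    have := commute_of_forall_trace_prodDeriv X Z h k
    rwa [hp, one_mul] at this

/-- The compatibility of the eigenvalues with the relation. -/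
def RelKind.Compat (κ : RelKind) {m N : ℕ} (c : Fin m → Fin N → ℂ) : Prop :=
  match κ with
  | sum => ∑ k, ∑ i, c k i = 0
  | prod => ∏ k, ∏ i, c k i = 1

/-- The diagonal matrix with given complex eigenvalues over a complex algebra. -/
def diagMat (C : Type) [CommRing C] [Algebra ℂ C] (c : Fin N → ℂ) : Matrix (Fin N) (Fin N) C :=
  diagonal fun i => algebraMap ℂ C (c i)

/-- The one remaining obstruction is scalar, and the fixed eigenvalues forbid it: the trace of the
sum gives `N z = 0`, the determinant of the product gives `(1 + z) ^ N = 1 + N z = 1`, and `N` is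
invertible. -/
theorem RelKind.eq_zero_of_rel_eq_smul (κ : RelKind) [Algebra ℂ C] {m : ℕ} (hN : 0 < N)
    (c : Fin m → Fin N → ℂ) (hc : κ.Compat c) (G H : Fin m → Matrix (Fin N) (Fin N) C)
    (hGH : ∀ k, H k * G k = 1) (z : C) (hz : z * z = 0)
    (h : κ.rel (fun k => G k * diagMat C (c k) * H k) = z • 1) : z = 0 := by
  have hNu : IsUnit (N : C) := by
    have : IsUnit (N : ℂ) := isUnit_iff_ne_zero.mpr (by exact_mod_cast hN.ne')
    simpa using this.map (algebraMap ℂ C)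
  have key : (N : C) * z = 0 := by
    cases κ with
    | sum =>
      have h1 := congrArg trace h
      rw [trace_smul, trace_one, rel, trace_sum] at h1
      have h2 : ∀ k, trace (G k * diagMat C (c k) * H k) = algebraMap ℂ C (∑ i, c k i) := by
        intro k
        rw [trace_mul_cycle, hGH, one_mul, diagMat, trace_diagonal, map_sum]
      simp only [h2] at h1
      rw [← map_sum, hc, map_zero] at h1
      simpa [mul_comm] using h1.symm
    | prod =>
      have h1 : (List.ofFn fun k => G k * diagMat C (c k) * H k).prod = (1 + z) • 1 := by
        rw [add_smul, one_smul, ← h, rel]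
        abel
      have h2 := congrArg (detMonoidHom (n := Fin N) (R := C)) h1
      rw [map_list_prod, List.map_ofFn, List.prod_ofFn] at h2
      have h3 : ∀ k, det (G k * diagMat C (c k) * H k) = algebraMap ℂ C (∏ i, c k i) := by
        intro k
        have : det (G k) * det (H k) = 1 := by rw [mul_comm, ← det_mul, hGH, det_one]
        rw [det_mul, det_mul, mul_right_comm, this, one_mul, diagMat, det_diagonal, map_prod]
      simp only [Function.comp_apply, coe_detMonoidHom, h3] at h2
      rw [← map_prod, hc, map_one, det_smul, det_one, mul_one, Fintype.card_fin] at h2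
      have h4 : (1 + z) ^ N = 1 + N * z := by
        clear h1 h h2 h3 hN hNu
        generalize N = n
        induction n with
        | zero => simp
        | succ n ih =>
          rw [pow_succ, ih]
          push_cast
          linear_combination (n : C) * hz
      rw [h4] at h2
      linear_combination -h2
  exact (hNu.mul_right_eq_zero).mp key

end Matrices

end DeligneSimpson
end

open scoped Kronecker TensorProduct

noncomputable section

namespace DeligneSimpson

open Matrix

/-- A maximal ideal of a finitely generated complex algebra is the kernel of a complex point. -/
theorem exists_algHom_of_isMaximal {A : Type} [CommRing A] [Algebra ℂ A] [Algebra.FiniteType ℂ A]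
    (m : Ideal A) [hm : m.IsMaximal] : ∃ χ : A →ₐ[ℂ] ℂ, ∀ x, χ x = 0 ↔ x ∈ m := by
  let := Ideal.Quotient.field m
  have : Algebra.FiniteType ℂ (A ⧸ m) :=
    Algebra.FiniteType.of_surjective (Ideal.Quotient.mkₐ ℂ m) (Ideal.Quotient.mkₐ_surjective ℂ m)
  have : Module.Finite ℂ (A ⧸ m) := finite_of_finite_type_of_isJacobsonRing ℂ (A ⧸ m)
  have hb : Function.Bijective (algebraMap ℂ (A ⧸ m)) :=
    IsAlgClosed.algebraMap_bijective_of_isIntegral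
  let e : ℂ ≃ₐ[ℂ] A ⧸ m := AlgEquiv.ofBijective (Algebra.ofId ℂ (A ⧸ m)) hb
  refine ⟨e.symm.toAlgHom.comp (Ideal.Quotient.mkₐ ℂ m), fun x => ?_⟩
  rw [← Ideal.Quotient.eq_zero_iff_mem]
  exact (map_eq_zero_iff e.symm e.symm.injective)

variable {m N : ℕ}

theorem RelKind.algHom_rel (κ : RelKind) {M M' : Type} [Ring M] [Ring M'] [Algebra ℂ M]
    [Algebra ℂ M'] (f : M →ₐ[ℂ] M') (X : Fin m → M) : f (κ.rel X) = κ.rel (fun k => f (X k)) :=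
  κ.map_rel f.toRingHom X

theorem mapMatrix_diagMat {C C' : Type} [CommRing C] [Algebra ℂ C] [CommRing C'] [Algebra ℂ C']
    (f : C →ₐ[ℂ] C') (c : Fin N → ℂ) : f.mapMatrix (diagMat C c) = diagMat C' c := by
  ext i j
  by_cases h : i = j <;> simp [diagMat, h]

/-! ### Surjectivity of the linearized relation up to scalars. -/

section Span

theorem RelKind.algHom_conjDeriv (κ : RelKind) {C C' : Type} [CommRing C] [Algebra ℂ C]
    [CommRing C'] [Algebra ℂ C'] (f : C →ₐ[ℂ] C') (X η : Fin m → Matrix (Fin N) (Fin N) C) :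
    f.mapMatrix (κ.conjDeriv C X η) =
      κ.conjDeriv C' (fun k => f.mapMatrix (X k)) (fun k => f.mapMatrix (η k)) :=
  κ.map_conjDeriv C C' f.mapMatrix.toRingHom X η

/-- Infinitesimal conjugations and scalar matrices span the target of the linearized relation. -/
theorem exists_conjDeriv_add_smul (κ : RelKind) (hN : 0 < N) {O : Type} [CommRing O] [Algebra ℂ O]
    [Algebra.FiniteType ℂ O] (X : Fin m → Matrix (Fin N) (Fin N) O) (hX : κ.rel X = 0)
    (hcent : ∀ (χ : O →ₐ[ℂ] ℂ) (Z : Matrix (Fin N) (Fin N) ℂ),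
      (∀ k, Commute Z (χ.mapMatrix (X k))) → ∃ z : ℂ, Z = z • 1)
    (V : Matrix (Fin N) (Fin N) O) :
    ∃ (η : Fin m → Matrix (Fin N) (Fin N) O) (s : O), κ.conjDeriv O X η + s • 1 = V := by
  let Ψ : ((Fin m → Matrix (Fin N) (Fin N) O) × O) →ₗ[O] Matrix (Fin N) (Fin N) O :=
    (κ.conjDeriv O X).coprod (LinearMap.toSpanSingleton O _ 1)
  suffices h : LinearMap.range Ψ = ⊤ by
    obtain ⟨⟨η, s⟩, h⟩ := LinearMap.range_eq_top.mp h V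
    exact ⟨η, s, by simpa [Ψ] using h⟩
  by_contra hne
  -- A proper submodule of a finite module lies in a maximal one, whose quotient is a residue field
  -- of `O`, that is `ℂ`. So the failure of surjectivity is seen at one complex point `χ`.
  obtain ⟨W, hW, hle⟩ := (eq_top_or_exists_le_coatom (LinearMap.range Ψ)).resolve_left hne
  have hs : IsSimpleModule O (Matrix (Fin N) (Fin N) O ⧸ W) := isSimpleModule_iff_isCoatom.mpr hW
  obtain ⟨I, hI, ⟨e⟩⟩ := isSimpleModule_iff_quot_maximal.mp hs
  obtain ⟨χ, hχ⟩ := exists_algHom_of_isMaximal I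
  let χ' : O ⧸ I →ₐ[ℂ] ℂ := Ideal.Quotient.liftₐ I χ fun a ha => (hχ a).mpr ha
  have hχ' : ∀ a : O, χ' (Ideal.Quotient.mk I a) = χ a := fun a => rfl
  let l : Matrix (Fin N) (Fin N) O → ℂ := fun V => χ' (e (W.mkQ V))
  have ladd : ∀ V V', l (V + V') = l V + l V' := fun V V' => by simp [l]
  have lsmul : ∀ (o : O) V, l (o • V) = χ o * l V := fun o V => by
    have : ∀ q : O ⧸ I, o • q = Ideal.Quotient.mk I o * q := fun q => by
      obtain ⟨q, rfl⟩ := Ideal.Quotient.mk_surjective q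
      rw [← map_mul]; rfl
    simp only [l, map_smul, this, map_mul, hχ']
  let L : Matrix (Fin N) (Fin N) O →+ ℂ := AddMonoidHom.mk' l ladd
  -- The functional `l` is the trace pairing with `Z`, hence the transposed indices.
  let Z : Matrix (Fin N) (Fin N) ℂ := of fun j i => l (single i j 1)
  have hZ : ∀ V, l V = trace (Z * χ.mapMatrix V) := by
    intro V
    have : L V = ∑ i, ∑ j, χ (V i j) * l (single i j 1) := by
      conv_lhs => rw [matrix_eq_sum_single V]
      rw [map_sum]
      refine Finset.sum_congr rfl fun i _ => ?_
      rw [map_sum]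
      refine Finset.sum_congr rfl fun j _ => ?_
      rw [← lsmul, smul_single, smul_eq_mul, mul_one]
      rfl
    change L V = _
    rw [this, trace, Finset.sum_comm]
    refine Finset.sum_congr rfl fun j _ => ?_
    rw [diag_apply, mul_apply]
    exact Finset.sum_congr rfl fun i _ => mul_comm _ _
  clear_value Z
  have hl0 : ∀ V ∈ LinearMap.range Ψ, l V = 0 := by
    intro V hV
    have : W.mkQ V = 0 := (Submodule.Quotient.mk_eq_zero W).mpr (hle hV)
    change χ' (e (W.mkQ V)) = 0
    rw [this, map_zero, map_zero]
  have hcomm : ∀ k, Commute Z (χ.mapMatrix (X k)) := by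
    refine κ.commute_of_forall_trace _ (by rw [← κ.algHom_rel, hX, map_zero]) Z fun η => ?_
    let ηO : Fin m → Matrix (Fin N) (Fin N) O := fun k => (Algebra.ofId ℂ O).mapMatrix (η k)
    have h1 : ∀ k, χ.mapMatrix (ηO k) = η k := fun k => by
      ext i j
      simp [ηO, Algebra.ofId_apply]
    have h2 := hl0 (κ.conjDeriv O X ηO) ⟨(ηO, 0), by simp [Ψ]⟩
    have h3 : χ.mapMatrix (κ.conjDeriv O X ηO) =
        κ.conjDeriv ℂ (fun k => χ.mapMatrix (X k)) (fun k => χ.mapMatrix (ηO k)) :=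
      κ.algHom_conjDeriv χ _ _
    rw [hZ, h3] at h2
    simpa only [h1] using h2
  obtain ⟨z, hz⟩ := hcent χ Z hcomm
  -- `Z = z • 1` is also orthogonal to the identity matrix, so `N z = 0` and `l` vanishes.
  have h1 := hl0 1 ⟨(0, 1), by simp [Ψ]⟩
  rw [hZ, map_one, mul_one, hz, trace_smul, trace_one, Fintype.card_fin, smul_eq_mul] at h1
  have hz0 : z = 0 := (mul_eq_zero.mp h1).resolve_right (by exact_mod_cast hN.ne')
  have hall : ∀ V, l V = 0 := fun V => by rw [hZ, hz, hz0]; simp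
  obtain ⟨V, hV⟩ := W.mkQ_surjective (e.symm 1)
  have := hall V
  simp only [l, hV, LinearEquiv.apply_symm_apply, map_one] at this
  exact one_ne_zero this

end Span

/-! ### The scheme of framed solutions. -/

section FrameRing

/-- The coordinates on pairs of tuples of matrices. -/
abbrev FrameIndex (m N : ℕ) : Type := Bool × Fin m × Fin N × Fin N

/-- The generic matrices. -/
def genericMatrix (b : Bool) (k : Fin m) :
    Matrix (Fin N) (Fin N) (MvPolynomial (FrameIndex m N) ℂ) :=
  of fun i j => MvPolynomial.X (b, k, i, j)

variable (κ : RelKind) (c : Fin m → Fin N → ℂ)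

/-- The equations of the variety of framed solutions: tuples `g` of invertible matrices with inverses
`h` such that the matrices `g k * diagMat (c k) * h k` satisfy the relation. -/
def frameIdeal : Ideal (MvPolynomial (FrameIndex m N) ℂ) :=
  Ideal.span
    ({p | ∃ k i j, p = (genericMatrix true k * genericMatrix false k - 1 : Matrix (Fin N) _ _) i j} ∪
      {p | ∃ i j, p = (κ.rel (fun k : Fin m =>
        genericMatrix true k * diagMat _ (c k) * genericMatrix false k) : Matrix _ _ _) i j})

/-- The coordinate ring of the scheme of framed solutions. -/
def FrameRing : Type := MvPolynomial (FrameIndex m N) ℂ ⧸ frameIdeal κ c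

instance : CommRing (FrameRing κ c) :=
  inferInstanceAs (CommRing (MvPolynomial (FrameIndex m N) ℂ ⧸ frameIdeal κ c))

instance : Algebra ℂ (FrameRing κ c) :=
  inferInstanceAs (Algebra ℂ (MvPolynomial (FrameIndex m N) ℂ ⧸ frameIdeal κ c))

instance : Algebra.FiniteType ℂ (FrameRing κ c) :=
  inferInstanceAs (Algebra.FiniteType ℂ (MvPolynomial (FrameIndex m N) ℂ ⧸ frameIdeal κ c))

/-- The quotient map onto the coordinate ring. -/
def frameMk : MvPolynomial (FrameIndex m N) ℂ →ₐ[ℂ] FrameRing κ c :=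
  Ideal.Quotient.mkₐ ℂ (frameIdeal κ c)

theorem frameMk_eq_zero {p : MvPolynomial (FrameIndex m N) ℂ} (hp : p ∈ frameIdeal κ c) :
    frameMk κ c p = 0 := Ideal.Quotient.eq_zero_iff_mem.mpr hp

/-- The universal frame and its inverse. -/
def univFrame (b : Bool) (k : Fin m) : Matrix (Fin N) (Fin N) (FrameRing κ c) :=
  (frameMk κ c).mapMatrix (genericMatrix b k)

/-- The universal solution. -/
def univSol (k : Fin m) : Matrix (Fin N) (Fin N) (FrameRing κ c) :=
  univFrame κ c true k * diagMat _ (c k) * univFrame κ c false k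

theorem univFrame_mul (k : Fin m) : univFrame κ c true k * univFrame κ c false k = 1 := by
  rw [← sub_eq_zero, univFrame, univFrame, ← map_mul,
    ← map_one (frameMk κ c).mapMatrix, ← map_sub]
  ext i j
  exact frameMk_eq_zero κ c (Ideal.subset_span (Or.inl ⟨k, i, j, rfl⟩))

theorem univSol_eq (k : Fin m) : univSol κ c k =
    (frameMk κ c).mapMatrix
      (genericMatrix true k * diagMat _ (c k) * genericMatrix false k) := by
  rw [map_mul, map_mul, mapMatrix_diagMat]
  rfl

theorem rel_univSol : κ.rel (univSol κ c) = 0 := by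
  have : univSol κ c = fun k => _ := funext (univSol_eq κ c)
  rw [this, ← κ.algHom_rel]
  ext i j
  exact frameMk_eq_zero κ c (Ideal.subset_span (Or.inr ⟨i, j, rfl⟩))

variable {κ c}

theorem frameRing_hom_ext {C : Type} [CommRing C] [Algebra ℂ C] {f g : FrameRing κ c →ₐ[ℂ] C}
    (h : ∀ b k, f.mapMatrix (univFrame κ c b k) = g.mapMatrix (univFrame κ c b k)) : f = g := by
  refine Ideal.Quotient.algHom_ext _ (MvPolynomial.algHom_ext fun x => ?_)
  obtain ⟨b, k, i, j⟩ := x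
  exact congrFun (congrFun (h b k) i) j

/-- With `frameRing_hom_ext` this is the universal property: `C`-valued points of the scheme are
framed solutions over `C`. -/
theorem exists_frameRing_hom {C : Type} [CommRing C] [Algebra ℂ C]
    (G H : Fin m → Matrix (Fin N) (Fin N) C) (hGH : ∀ k, G k * H k = 1)
    (hrel : κ.rel (fun k => G k * diagMat C (c k) * H k) = 0) :
    ∃ f : FrameRing κ c →ₐ[ℂ] C,
      (∀ k, f.mapMatrix (univFrame κ c true k) = G k) ∧
      (∀ k, f.mapMatrix (univFrame κ c false k) = H k) := by
  let F : MvPolynomial (FrameIndex m N) ℂ →ₐ[ℂ] C :=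
    MvPolynomial.aeval fun x => (bif x.1 then G else H) x.2.1 x.2.2.1 x.2.2.2
  have hG : ∀ k, F.mapMatrix (genericMatrix true k) = G k := fun k => by
    ext i j; simp [F, genericMatrix]
  have hH : ∀ k, F.mapMatrix (genericMatrix false k) = H k := fun k => by
    ext i j; simp [F, genericMatrix]
  have hF : ∀ p ∈ frameIdeal κ c, F p = 0 := by
    intro p hp
    have hle : frameIdeal κ c ≤ RingHom.ker F := by
      refine Ideal.span_le.mpr ?_
      rintro p (⟨k, i, j, rfl⟩ | ⟨i, j, rfl⟩)
      · have : F.mapMatrix (genericMatrix true k * genericMatrix false k - 1) = 0 := by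
          rw [map_sub, map_mul, map_one, hG, hH, hGH, sub_self]
        exact congrFun (congrFun this i) j
      · have : F.mapMatrix (κ.rel (fun k : Fin m =>
            genericMatrix true k * diagMat _ (c k) * genericMatrix false k)) = 0 := by
          rw [κ.algHom_rel, ← hrel]
          simp only [map_mul, hG, hH, mapMatrix_diagMat]
        exact congrFun (congrFun this i) j
    exact hle hp
  refine ⟨Ideal.Quotient.liftₐ _ F hF, fun k => ?_, fun k => ?_⟩
  · rw [← hG]
    ext i j
    rfl
  · rw [← hH]
    ext i j
    rfl

theorem mapMatrix_univSol {C : Type} [CommRing C] [Algebra ℂ C] (f : FrameRing κ c →ₐ[ℂ] C)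
    (k : Fin m) : f.mapMatrix (univSol κ c k) = f.mapMatrix (univFrame κ c true k) *
      diagMat C (c k) * f.mapMatrix (univFrame κ c false k) := by
  rw [univSol, map_mul, map_mul, mapMatrix_diagMat]

theorem mapMatrix_univFrame_mul {C : Type} [CommRing C] [Algebra ℂ C] (f : FrameRing κ c →ₐ[ℂ] C)
    (k : Fin m) : f.mapMatrix (univFrame κ c true k) * f.mapMatrix (univFrame κ c false k) = 1 := by
  rw [← map_mul, univFrame_mul, map_one]

theorem rel_mapMatrix_univSol {C : Type} [CommRing C] [Algebra ℂ C] (f : FrameRing κ c →ₐ[ℂ] C) :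
    κ.rel (fun k => f.mapMatrix (univSol κ c k)) = 0 := by
  rw [← κ.algHom_rel, rel_univSol, map_zero]

variable (κ c) in
/-- Only scalar matrices commute with all members of a solution. -/
def TrivialCentralizer : Prop :=
  ∀ (f : FrameRing κ c →ₐ[ℂ] ℂ) (Z : Matrix (Fin N) (Fin N) ℂ),
    (∀ k, Commute Z (f.mapMatrix (univSol κ c k))) → ∃ z : ℂ, Z = z • 1

end FrameRing

/-! ### Infinitesimal lifting of framed solutions. -/

section Lifting

variable {C : Type} [CommRing C] {I : Ideal C}

theorem mul_mul_eq_zero_of_mem (hI : I ^ 2 = ⊥) {A B : Matrix (Fin N) (Fin N) C}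
    (hA : ∀ i j, A i j ∈ I) (hB : ∀ i j, B i j ∈ I) (y : Matrix (Fin N) (Fin N) C) :
    A * y * B = 0 := by
  have key : ∀ a ∈ I, ∀ b ∈ I, a * b = 0 := fun a ha b hb => by
    have : a * b ∈ I ^ 2 := by rw [pow_two]; exact Ideal.mul_mem_mul ha hb
    rwa [hI] at this
  ext i j
  rw [mul_apply, Matrix.zero_apply]
  refine Finset.sum_eq_zero fun l _ => key _ ?_ _ (hB l j)
  rw [mul_apply]
  exact Ideal.sum_mem _ fun x _ => I.mul_mem_right _ (hA i x)

variable {κ : RelKind} {c : Fin m → Fin N → ℂ}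

/-- Lift the frames arbitrarily; the relation then holds up to an error with entries in `I`.
Changing the frames by `1 + η`, with `η` over `I`, removes the error up to a scalar matrix, and that
scalar is zero by `RelKind.eq_zero_of_rel_eq_smul`. -/
theorem exists_lift_frame [Algebra ℂ C] (hN : 0 < N) (hc : κ.Compat c)
    (hcent : TrivialCentralizer κ c) (hI : I ^ 2 = ⊥) (g : FrameRing κ c →ₐ[ℂ] C ⧸ I) :
    ∃ f : FrameRing κ c →ₐ[ℂ] C, (Ideal.Quotient.mkₐ ℂ I).comp f = g := by
  let π := Ideal.Quotient.mkₐ ℂ I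
  have hπ : ∀ x, π x = 0 ↔ x ∈ I := fun x => Ideal.Quotient.eq_zero_iff_mem
  have hlift : ∀ M : Matrix (Fin N) (Fin N) (C ⧸ I), ∃ M' : Matrix (Fin N) (Fin N) C,
      π.mapMatrix M' = M := fun M => by
    choose s hs using Ideal.Quotient.mkₐ_surjective ℂ I
    exact ⟨of fun i j => s (M i j), by ext i j; exact hs _⟩
  have hmem : ∀ M : Matrix (Fin N) (Fin N) C, π.mapMatrix M = 0 → ∀ i j, M i j ∈ I :=
    fun M hM i j => (hπ _).mp (congrFun (congrFun hM i) j)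
  choose G hG using fun k => hlift (g.mapMatrix (univFrame κ c true k))
  choose H₀ hH₀ using fun k => hlift (g.mapMatrix (univFrame κ c false k))
  let μ : Fin m → Matrix (Fin N) (Fin N) C := fun k => G k * H₀ k - 1
  have hμ0 : ∀ k, π.mapMatrix (μ k) = 0 := fun k => by
    simp only [μ]
    rw [map_sub, map_mul, hG, hH₀, mapMatrix_univFrame_mul, map_one, sub_self]
  -- A Newton step makes the lifted inverses exact, since `μ k * μ k = 0`.
  let H : Fin m → Matrix (Fin N) (Fin N) C := fun k => H₀ k * (1 - μ k)
  have hH : ∀ k, π.mapMatrix (H k) = g.mapMatrix (univFrame κ c false k) := fun k => by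
    simp only [H]
    rw [map_mul, map_sub, map_one, hμ0, sub_zero, mul_one, hH₀]
  have hGH : ∀ k, G k * H k = 1 := fun k => by
    have h1 := mul_mul_eq_zero_of_mem hI (hmem _ (hμ0 k)) (hmem _ (hμ0 k)) 1
    rw [mul_one] at h1
    have h2 : G k * H₀ k = 1 + μ k := by simp [μ]
    simp only [H]
    rw [← mul_assoc, h2]
    calc (1 + μ k) * (1 - μ k) = 1 - μ k * μ k := by noncomm_ring
      _ = 1 := by rw [h1, sub_zero]
  let X : Fin m → Matrix (Fin N) (Fin N) C := fun k => G k * diagMat C (c k) * H k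
  have hX : ∀ k, π.mapMatrix (X k) = g.mapMatrix (univSol κ c k) := fun k => by
    simp only [X]
    rw [map_mul, map_mul, hG, hH, mapMatrix_diagMat, mapMatrix_univSol]
  set ε := κ.rel X with hε
  have hε0 : π.mapMatrix ε = 0 := by
    rw [hε, κ.algHom_rel]
    simp only [hX]
    exact rel_mapMatrix_univSol g
  -- Preimages of the matrix units over the universal solution, to be moved to `C ⧸ I` and lifted to
  -- `C`. The ambiguity in the lifts is harmless because they get multiplied by entries of `ε`,
  -- which lie in `I`.
  choose θ s hθ using fun i j => exists_conjDeriv_add_smul κ hN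
    (univSol κ c) (rel_univSol κ c) hcent (single i j 1)
  choose θ' hθ' using fun i j k => hlift (g.mapMatrix (θ i j k))
  have hlift' : ∀ x : C ⧸ I, ∃ y, π y = x := Ideal.Quotient.mkₐ_surjective ℂ I
  choose s' hs' using fun i j => hlift' (g (s i j))
  have hL : ∀ i j, π.mapMatrix (κ.conjDeriv C X (θ' i j) + s' i j • 1) = single i j 1 := by
    intro i j
    have h1 : π.mapMatrix (κ.conjDeriv C X (θ' i j)) = κ.conjDeriv (C ⧸ I)
        (fun k => π.mapMatrix (X k)) (fun k => π.mapMatrix (θ' i j k)) :=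
      κ.algHom_conjDeriv π _ _
    have h2 : g.mapMatrix (κ.conjDeriv _ (univSol κ c) (θ i j)) = κ.conjDeriv (C ⧸ I)
        (fun k => g.mapMatrix (univSol κ c k)) (fun k => g.mapMatrix (θ i j k)) :=
      κ.algHom_conjDeriv g _ _
    have h3 := congrArg g.mapMatrix (hθ i j)
    rw [map_add, h2] at h3
    rw [map_add, h1]
    simp only [hX, hθ']
    have h4 : π.mapMatrix (s' i j • (1 : Matrix (Fin N) (Fin N) C)) =
        g.mapMatrix (s i j • (1 : Matrix (Fin N) (Fin N) (FrameRing κ c))) := by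
      ext a b
      have := hs' i j
      by_cases hab : a = b
      · simp [hab, this]
      · simp [hab]
    rw [h4, h3]
    ext a b
    simp [single_apply, apply_ite g]
  let η : Fin m → Matrix (Fin N) (Fin N) C := -∑ i, ∑ j, ε i j • θ' i j
  have hη : ∀ k i j, η k i j ∈ I := by
    intro k i j
    simp only [η, Pi.neg_apply, Finset.sum_apply, Pi.smul_apply, Matrix.neg_apply, Matrix.sum_apply,
      Matrix.smul_apply, smul_eq_mul]
    exact I.neg_mem (Ideal.sum_mem _ fun a _ => Ideal.sum_mem _ fun b _ =>
      I.mul_mem_right _ (hmem ε hε0 a b))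
  let z : C := ∑ i, ∑ j, ε i j * s' i j
  have key : ∀ a ∈ I, ∀ b ∈ I, a * b = 0 := fun a ha b hb => by
    have : a * b ∈ I ^ 2 := by rw [pow_two]; exact Ideal.mul_mem_mul ha hb
    rwa [hI] at this
  have hLη : κ.conjDeriv C X η = -ε + z • 1 := by
    have h1 : ∀ i j, ε i j • (κ.conjDeriv C X (θ' i j) + s' i j • 1) = single i j (ε i j) := by
      intro i j
      have h2 : π.mapMatrix (κ.conjDeriv C X (θ' i j) + s' i j • 1 - single i j 1) = 0 := by
        rw [map_sub, hL]
        ext a b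
        simp [single_apply]
      ext a b
      have h3 := key _ (hmem ε hε0 i j) _ (hmem _ h2 a b)
      rw [Matrix.sub_apply, mul_sub, sub_eq_zero] at h3
      rw [Matrix.smul_apply, smul_eq_mul, h3]
      simp [single_apply]
    have h4 : ∑ i, ∑ j, ε i j • (κ.conjDeriv C X (θ' i j) + s' i j • 1) = ε := by
      simp only [h1]
      exact (matrix_eq_sum_single ε).symm
    have h5 : κ.conjDeriv C X η = -∑ i, ∑ j, ε i j • κ.conjDeriv C X (θ' i j) := by
      simp only [η, map_neg, map_sum, map_smul]
    rw [h5]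
    nth_rewrite 2 [← h4]
    simp only [smul_add, Finset.sum_add_distrib, z, Finset.sum_smul, smul_smul]
    abel
  have hηη : ∀ k l y, η k * y * η l = 0 := fun k l y => mul_mul_eq_zero_of_mem hI (hη k) (hη l) y
  let G' : Fin m → Matrix (Fin N) (Fin N) C := fun k => (1 + η k) * G k
  let H' : Fin m → Matrix (Fin N) (Fin N) C := fun k => H k * (1 - η k)
  have hGH' : ∀ k, G' k * H' k = 1 := fun k => by
    have h1 := hηη k k 1
    rw [mul_one] at h1
    calc G' k * H' k = (1 + η k) * (G k * H k) * (1 - η k) := by simp only [G', H', mul_assoc]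
      _ = 1 - η k * η k := by rw [hGH]; noncomm_ring
      _ = 1 := by rw [h1, sub_zero]
  have hrel : κ.rel (fun k => G' k * diagMat C (c k) * H' k) = z • 1 := by
    have h1 : (fun k => G' k * diagMat C (c k) * H' k) =
        fun k => (1 + η k) * X k * (1 - η k) := by
      ext1 k
      simp only [G', H', X, mul_assoc]
    rw [h1, κ.rel_conj_one_add C X η hηη, hLη, ← hε]
    abel
  have hzI : z ∈ I := Ideal.sum_mem _ fun a _ => Ideal.sum_mem _ fun b _ =>
    I.mul_mem_right _ (hmem ε hε0 a b)
  have hz : z = 0 := κ.eq_zero_of_rel_eq_smul hN c hc G' H'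
    (fun k => mul_eq_one_comm.mp (hGH' k)) z (key z hzI z hzI) hrel
  rw [hz, zero_smul] at hrel
  obtain ⟨f, hf1, hf2⟩ := exists_frameRing_hom G' H' hGH' hrel
  have hπη : ∀ k, π.mapMatrix (η k) = 0 := fun k => by
    ext i j
    exact (hπ _).mpr (hη k i j)
  have hcomp : ∀ M : Matrix (Fin N) (Fin N) (FrameRing κ c),
      ((Ideal.Quotient.mkₐ ℂ I).comp f).mapMatrix M = π.mapMatrix (f.mapMatrix M) := fun M => rfl
  refine ⟨f, frameRing_hom_ext fun b k => ?_⟩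
  rw [hcomp]
  match b with
  | false =>
    rw [hf2]
    simp only [H']
    rw [map_mul, map_sub, map_one, hπη, sub_zero, mul_one, hH]
  | true =>
    rw [hf1]
    simp only [G']
    rw [map_mul, map_add, map_one, hπη, add_zero, one_mul, hG]

theorem smooth_frameRing (hN : 0 < N) (hc : κ.Compat c) (hcent : TrivialCentralizer κ c) :
    Algebra.Smooth ℂ (FrameRing κ c) where
  formallySmooth := by
    rw [Algebra.FormallySmooth.iff_comp_surjective]
    intro C _ _ I hI g
    exact exists_lift_frame hN hc hcent hI g
  finitePresentation := Algebra.FinitePresentation.of_finiteType.mp inferInstance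

end Lifting

end DeligneSimpson
end

open scoped Kronecker TensorProduct

noncomputable section

namespace DeligneSimpson

open Matrix

/-! ### Diagonalization with prescribed eigenvalues. -/

section Diagonalization

variable {N : ℕ}

theorem aeval_conj_diagMat {C : Type} [CommRing C] [Algebra ℂ C] (c : Fin N → ℂ)
    {G H : Matrix (Fin N) (Fin N) C} (hGH : G * H = 1) (q : Polynomial ℂ) :
    Polynomial.aeval (G * diagMat C c * H) q = G * diagMat C (fun i => q.eval (c i)) * H := by
  have hHG : H * G = 1 := mul_eq_one_comm.mp hGH
  induction q using Polynomial.induction_on' with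
  | add p q hp hq =>
    rw [map_add, hp, hq, ← add_mul, ← mul_add]
    congr 2
    rw [diagMat, diagMat, diagMat, diagonal_add]
    simp
  | monomial n a =>
    have hpow : (G * diagMat C c * H) ^ n = G * diagMat C (fun i => c i ^ n) * H := by
      induction n with
      | zero =>
        rw [pow_zero]
        have : diagMat C (fun i : Fin N => c i ^ 0) = 1 := by simp [diagMat]
        rw [this, mul_one, hGH]
      | succ n ih =>
        have e : diagMat C (fun i => c i ^ (n + 1)) = diagMat C (fun i => c i ^ n) * diagMat C c := by
          rw [diagMat, diagMat, diagMat, diagonal_mul_diagonal]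
          simp [pow_succ]
        rw [pow_succ, ih, e]
        calc _ = G * diagMat C (fun i => c i ^ n) * (H * G) * diagMat C c * H := by
              simp only [mul_assoc]
          _ = _ := by rw [hHG]; simp only [mul_assoc, one_mul]
    rw [Polynomial.aeval_monomial, hpow]
    have e : diagMat C (fun i => Polynomial.eval (c i) (Polynomial.monomial n a)) =
        algebraMap ℂ (Matrix (Fin N) (Fin N) C) a * diagMat C (fun i => c i ^ n) := by
      rw [Matrix.algebraMap_eq_diagonal, diagMat, diagMat, diagonal_mul_diagonal]
      simp
    rw [e]
    simp only [mul_assoc, Algebra.left_comm]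

/-- A matrix annihilated by a product of distinct linear factors is diagonalizable. -/
theorem exists_diagonalization {K : Type} [Field K] [Algebra ℂ K] (X : Matrix (Fin N) (Fin N) K)
    (s : Finset ℂ) (hs : Polynomial.aeval X (∏ z ∈ s, (Polynomial.X - Polynomial.C z)) = 0) :
    ∃ (G H : Matrix (Fin N) (Fin N) K) (d : Fin N → ℂ), G * H = 1 ∧ (∀ i, d i ∈ s) ∧
      X = G * diagMat K d * H := by
  let E : Set (Fin N → K) := {v | ∃ z ∈ s, X *ᵥ v = algebraMap ℂ K z • v}
  have hE : ⊤ ≤ Submodule.span K E := by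
    rintro v -
    rcases s.eq_empty_or_nonempty with rfl | hne
    · have h1 : (1 : Matrix (Fin N) (Fin N) K) = 0 := by simpa using hs
      have : v = 0 := by rw [← one_mulVec v, h1, zero_mulVec]
      rw [this]
      exact zero_mem _
    -- Lagrange polynomials sum to one and each maps into an eigenspace, so the eigenvectors span; a
    -- basis is extracted from them.
    · have h1 : ∑ z ∈ s, Polynomial.aeval X (Lagrange.basis s id z) = 1 := by
        rw [← map_sum, Lagrange.sum_basis (Set.injOn_id _) hne, map_one]
      rw [← one_mulVec v, ← h1, sum_mulVec]
      refine Submodule.sum_mem _ fun z hz => Submodule.subset_span ⟨z, hz, ?_⟩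
      have h2 : (Polynomial.X - Polynomial.C z) * Lagrange.basis s id z =
          Polynomial.C (∏ w ∈ s.erase z, (z - w)⁻¹) * ∏ w ∈ s, (Polynomial.X - Polynomial.C w) := by
        rw [← Finset.mul_prod_erase s _ hz, Lagrange.basis]
        simp only [Lagrange.basisDivisor, Finset.prod_mul_distrib, id, map_prod]
        ring
      have h3 := congrArg (Polynomial.aeval X) h2
      rw [map_mul, map_mul, hs, mul_zero, map_sub, Polynomial.aeval_X, Polynomial.aeval_C, sub_mul,
        sub_eq_zero] at h3
      rw [mulVec_mulVec, h3, ← mulVec_mulVec, Matrix.algebraMap_eq_diagonal]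
      ext i
      simp [mulVec_diagonal]
  let b := Module.Basis.ofSpan hE
  have : Fintype ((linearIndepOn_empty K id).extend (Set.empty_subset E)) :=
    FiniteDimensional.fintypeBasisIndex b
  have hcard : Fintype.card ((linearIndepOn_empty K id).extend (Set.empty_subset E)) = N := by
    rw [← Module.finrank_eq_card_basis b, Module.finrank_fin_fun]
  let b' := b.reindex (Fintype.equivFinOfCardEq hcard)
  have hb' : ∀ i, b' i ∈ E := fun i => by
    rw [Module.Basis.reindex_apply]
    exact Module.Basis.ofSpan_subset hE ⟨_, rfl⟩
  choose d hd hdX using hb'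
  let G : Matrix (Fin N) (Fin N) K := (Pi.basisFun K (Fin N)).toMatrix b'
  let H : Matrix (Fin N) (Fin N) K := b'.toMatrix (Pi.basisFun K (Fin N))
  have hGH : G * H = 1 := Module.Basis.toMatrix_mul_toMatrix_flip _ _
  refine ⟨G, H, d, hGH, hd, ?_⟩
  have hXG : X * G = G * diagMat K d := by
    ext i j
    have h1 := congrFun (hdX j) i
    rw [diagMat, mul_diagonal]
    have h2 : ∀ i, G i j = b' j i := fun i => by simp [G, Module.Basis.toMatrix_apply]
    rw [h2, mul_apply]
    simp only [h2]
    rw [mulVec, dotProduct] at h1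
    rw [h1, Pi.smul_apply, smul_eq_mul, mul_comm]
  rw [← hXG, mul_assoc, hGH, mul_one]

/-- Take the trace or the determinant of the relation. The matrices live over `K`, but the
eigenvalues and the conclusion are complex. -/
theorem RelKind.compat_of_rel_eq_zero (κ : RelKind) {m : ℕ} {K : Type} [Field K] [Algebra ℂ K]
    (d : Fin m → Fin N → ℂ) (G H : Fin m → Matrix (Fin N) (Fin N) K) (hGH : ∀ k, G k * H k = 1)
    (h : κ.rel (fun k => G k * diagMat K (d k) * H k) = 0) : κ.Compat d := by
  have hHG : ∀ k, H k * G k = 1 := fun k => mul_eq_one_comm.mp (hGH k)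
  cases κ with
  | sum =>
    have h1 := congrArg trace h
    rw [trace_zero, rel, trace_sum] at h1
    have h2 : ∀ k, trace (G k * diagMat K (d k) * H k) = algebraMap ℂ K (∑ i, d k i) := by
      intro k
      rw [trace_mul_cycle, hHG, one_mul, diagMat, trace_diagonal, map_sum]
    simp only [h2] at h1
    rw [← map_sum] at h1
    exact (map_eq_zero _).mp h1
  | prod =>
    have h1 : (List.ofFn fun k => G k * diagMat K (d k) * H k).prod = 1 := sub_eq_zero.mp h
    have h2 := congrArg (detMonoidHom (n := Fin N) (R := K)) h1
    rw [map_list_prod, List.map_ofFn, List.prod_ofFn, map_one] at h2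
    have h3 : ∀ k, det (G k * diagMat K (d k) * H k) = algebraMap ℂ K (∏ i, d k i) := by
      intro k
      have : det (G k) * det (H k) = 1 := by rw [← det_mul, hGH, det_one]
      rw [det_mul, det_mul, mul_right_comm, this, one_mul, diagMat, det_diagonal, map_prod]
    simp only [Function.comp_apply, coe_detMonoidHom, h3] at h2
    rw [← map_prod, ← map_one (algebraMap ℂ K)] at h2
    exact (algebraMap ℂ K).injective h2

end Diagonalization

/-! ### Reconstructing a representation from a functional. -/

section Gram

variable {L : Type} [Ring L] [Algebra ℂ L] {B : Type} [CommRing B] [Algebra ℂ B]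

/-- The matrix of the bilinear form `(a, b) ↦ t (a * z * b)` on given elements. -/
def gram (t : L →ₗ[ℂ] B) {r : ℕ} (y w : Fin r → L) (z : L) : Matrix (Fin r) (Fin r) B :=
  of fun i j => t (y i * z * w j)

/-- Border the invertible Gram matrix by the row of `a` and the column of `b`. Its determinant is
zero, and is also the Gram determinant times the Schur complement, which is the difference of the
two sides. -/
theorem eq_of_minors_eq_zero (t : L →ₗ[ℂ] B) {r : ℕ} (y w : Fin r → L)
    (hG : IsUnit (gram t y w 1).det)
    (hminor : ∀ y' w' : Fin (r + 1) → L, (gram t y' w' 1).det = 0) (a b : L) :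
    t (a * b) = (fun j => t (a * w j)) ⬝ᵥ ((gram t y w 1)⁻¹ *ᵥ fun i => t (y i * b)) := by
  let e : Fin r ⊕ Unit ≃ Fin (r + 1) :=
    (Equiv.sumCongr (Equiv.refl _) (Equiv.ofUnique Unit (Fin 1))).trans finSumFinEquiv
  let y' : Fin r ⊕ Unit → L := Sum.elim y fun _ => a
  let w' : Fin r ⊕ Unit → L := Sum.elim w fun _ => b
  have h1 := hminor (y' ∘ e.symm) (w' ∘ e.symm)
  have h2 : gram t (y' ∘ e.symm) (w' ∘ e.symm) 1 =
      reindex e e (fromBlocks (gram t y w 1) (of fun i (_ : Unit) => t (y i * b))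
        (of fun (_ : Unit) j => t (a * w j)) (of fun _ _ => t (a * b))) := by
    ext i j
    rw [reindex_apply, submatrix_apply]
    simp only [gram, of_apply, Function.comp_apply, mul_one]
    rcases e.symm i with i | i <;> rcases e.symm j with j | j <;> simp [y', w']
  have := invertibleOfIsUnitDet _ hG
  rw [h2, det_reindex_self, det_fromBlocks₁₁, invOf_eq_nonsing_inv] at h1
  have h3 := (hG.mul_right_eq_zero).mp h1
  rw [det_unique, Matrix.sub_apply, sub_eq_zero] at h3
  rw [of_apply] at h3
  rw [h3, Matrix.mul_assoc]
  simp [mul_apply, dotProduct, mulVec]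

/-- The representation attached to a functional `t` such that the form `(a, b) ↦ t (a * b)` has
rank `r`, the elements `y`, `w` being bases for it. -/
def gramRep (t : L →ₗ[ℂ] B) {r : ℕ} (y w : Fin r → L)
    (hG : IsUnit (gram t y w 1).det)
    (hminor : ∀ y' w' : Fin (r + 1) → L, (gram t y' w' 1).det = 0) :
    L →ₐ[ℂ] Matrix (Fin r) (Fin r) B :=
  AlgHom.ofLinearMap
    { toFun := fun z => (gram t y w 1)⁻¹ * gram t y w z
      map_add' := fun a b => by
        rw [← mul_add]
        congr 1
        ext i j
        simp [gram, mul_add, add_mul]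
      map_smul' := fun c a => by
        rw [RingHom.id_apply, ← mul_smul_comm]
        congr 1
        ext i j
        simp [gram] }
    (nonsing_inv_mul _ hG)
    (fun a b => by
      change (gram t y w 1)⁻¹ * gram t y w (a * b) =
        ((gram t y w 1)⁻¹ * gram t y w a) * ((gram t y w 1)⁻¹ * gram t y w b)
      -- This is `eq_of_minors_eq_zero` entry by entry, applied to `y i * a` and `b * w j`.
      have : gram t y w (a * b) = gram t y w a * (gram t y w 1)⁻¹ * gram t y w b := by
        ext i j
        have := eq_of_minors_eq_zero t y w hG hminor (y i * a) (b * w j)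
        simp only [← mul_assoc] at this
        simp only [gram, of_apply, ← mul_assoc]
        rw [this, mul_assoc, mul_apply]
        simp only [dotProduct, mulVec, mul_apply, of_apply]
        rfl
      rw [this]
      simp only [mul_assoc])

theorem gramRep_apply (t : L →ₗ[ℂ] B) {r : ℕ} (y w : Fin r → L)
    (hG : IsUnit (gram t y w 1).det)
    (hminor : ∀ y' w' : Fin (r + 1) → L, (gram t y' w' 1).det = 0) (z : L) :
    gramRep t y w hG hminor z = (gram t y w 1)⁻¹ * gram t y w z := rfl

theorem gramRep_eq_zero (t : L →ₗ[ℂ] B) {r : ℕ} (y w : Fin r → L)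
    (hG : IsUnit (gram t y w 1).det)
    (hminor : ∀ y' w' : Fin (r + 1) → L, (gram t y' w' 1).det = 0) (z : L)
    (hz : ∀ a b, t (a * z * b) = 0) : gramRep t y w hG hminor z = 0 := by
  have : gram t y w z = 0 := by ext i j; exact hz _ _
  rw [gramRep_apply, this, mul_zero]

/-- By `hp` the Gram matrix of `p` is an outer product, so the trace contracts to `t (1 * 1) = 1`.
It shows that the simple eigenvalue survives exactly once in the reconstructed representation. -/
theorem trace_gramRep (t : L →ₗ[ℂ] B) {r : ℕ} (y w : Fin r → L)
    (hG : IsUnit (gram t y w 1).det)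
    (hminor : ∀ y' w' : Fin (r + 1) → L, (gram t y' w' 1).det = 0) (p : L) (h1 : t 1 = 1)
    (hp : ∀ a b, t (a * p * b) = t a * t b) :
    trace (gramRep t y w hG hminor p) = 1 := by
  have h2 := eq_of_minors_eq_zero t y w hG hminor 1 1
  simp only [one_mul, mul_one, h1] at h2
  rw [gramRep_apply, h2]
  simp only [trace, diag_apply, mul_apply, dotProduct, mulVec, gram, of_apply, hp, Finset.mul_sum]
  refine Finset.sum_congr rfl fun i _ => Finset.sum_congr rfl fun j _ => ?_
  ring

/-- The form is given by a representation with a vector and a covector. -/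
theorem gram_eq_mul {N : ℕ} (ρ : L →ₐ[ℂ] Matrix (Fin N) (Fin N) B) (v φ : Fin N → B)
    (t : L →ₗ[ℂ] B) (ht : ∀ z, t z = φ ⬝ᵥ (ρ z *ᵥ v)) {r : ℕ} (y w : Fin r → L) (z : L) :
    gram t y w z = (of fun i => φ ᵥ* ρ (y i) : Matrix (Fin r) (Fin N) B) * ρ z *
      (of fun a j => (ρ (w j) *ᵥ v) a : Matrix (Fin N) (Fin r) B) := by
  ext i j
  rw [Matrix.mul_assoc, mul_apply, gram, of_apply, ht, map_mul, map_mul, ← mulVec_mulVec,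
    ← mulVec_mulVec, dotProduct_mulVec, dotProduct]
  refine Finset.sum_congr rfl fun a _ => ?_
  rw [of_apply]
  congr 1

theorem det_mul_eq_zero {K : Type} [Field K] {N r : ℕ} (h : N < r) (Y : Matrix (Fin r) (Fin N) K)
    (W : Matrix (Fin N) (Fin r) K) : (Y * W).det = 0 := by
  by_contra hne
  have h1 := rank_of_isUnit (Y * W) ((isUnit_iff_isUnit_det _).mpr (isUnit_iff_ne_zero.mpr hne))
  have h2 := (rank_mul_le_left Y W).trans (rank_le_width Y)
  rw [h1, Fintype.card_fin] at h2
  omega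

/-- The matrices reconstructed from the form are conjugate to the original ones. -/
theorem exists_conj_of_isUnit_gram {N : ℕ} (ρ : L →ₐ[ℂ] Matrix (Fin N) (Fin N) B) (v φ : Fin N → B)
    (t : L →ₗ[ℂ] B) (ht : ∀ z, t z = φ ⬝ᵥ (ρ z *ᵥ v)) (y w : Fin N → L)
    (hG : IsUnit (gram t y w 1).det) :
    ∃ W : Matrix (Fin N) (Fin N) B, IsUnit W.det ∧ (∀ a j, W a j = (ρ (w j) *ᵥ v) a) ∧
      ∀ z, W * ((gram t y w 1)⁻¹ * gram t y w z) = ρ z * W := by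
  set Y : Matrix (Fin N) (Fin N) B := of fun i => φ ᵥ* ρ (y i) with hY
  set W : Matrix (Fin N) (Fin N) B := of fun a j => (ρ (w j) *ᵥ v) a with hW
  have h1 : ∀ z, gram t y w z = Y * ρ z * W := gram_eq_mul ρ v φ t ht y w
  have h2 : gram t y w 1 = Y * W := by rw [h1, map_one, mul_one]
  have hYW : IsUnit (Y.det * W.det) := by rw [← det_mul, ← h2]; exact hG
  have hYu : IsUnit Y.det := isUnit_of_mul_isUnit_left hYW
  have hWu : IsUnit W.det := isUnit_of_mul_isUnit_right hYW
  refine ⟨W, hWu, fun a j => rfl, fun z => ?_⟩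
  rw [h1 z, h2, Matrix.mul_inv_rev]
  calc W * (W⁻¹ * Y⁻¹ * (Y * ρ z * W)) = (W * W⁻¹) * (Y⁻¹ * Y) * ρ z * W := by
        simp only [mul_assoc]
    _ = ρ z * W := by rw [mul_nonsing_inv _ hWu, nonsing_inv_mul _ hYu, one_mul, one_mul]

end Gram

end DeligneSimpson
end

open scoped Kronecker TensorProduct

noncomputable section

namespace DeligneSimpson

open Matrix

/-- An element of a reduced finitely generated complex algebra that vanishes at all complex points
is zero. -/
theorem eq_zero_of_forall_algHom {A : Type} [CommRing A] [Algebra ℂ A] [Algebra.FiniteType ℂ A]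
    [IsReduced A] (x : A) (h : ∀ χ : A →ₐ[ℂ] ℂ, χ x = 0) : x = 0 := by
  have : IsJacobsonRing A := isJacobsonRing_of_finiteType (A := ℂ)
  have hrad : (⊥ : Ideal A).IsRadical := by
    rintro y ⟨n, hn⟩
    exact Ideal.mem_bot.mpr (IsReduced.eq_zero y ⟨n, Ideal.mem_bot.mp hn⟩)
  have h1 : (⊥ : Ideal A).jacobson = ⊥ := IsJacobsonRing.out ‹_› hrad
  rw [← Ideal.mem_bot, ← h1, Ideal.jacobson, Ideal.mem_sInf]
  rintro I ⟨-, hI⟩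
  obtain ⟨χ, hχ⟩ := exists_algHom_of_isMaximal I
  exact (hχ x).mp (h χ)

variable {m N : ℕ}

/-! ### Noncommutative polynomials in the matrices and invariant functions. -/

section Words

/-- The evaluation of noncommutative polynomials at a tuple of matrices. -/
def wordEval {C : Type} [CommRing C] [Algebra ℂ C] (X : Fin m → Matrix (Fin N) (Fin N) C) :
    FreeAlgebra ℂ (Fin m) →ₐ[ℂ] Matrix (Fin N) (Fin N) C := FreeAlgebra.lift ℂ X

@[simp] theorem wordEval_ι {C : Type} [CommRing C] [Algebra ℂ C]
    (X : Fin m → Matrix (Fin N) (Fin N) C) (k : Fin m) :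
    wordEval X (FreeAlgebra.ι ℂ k) = X k := FreeAlgebra.lift_ι_apply _ _

theorem mapMatrix_wordEval {C C' : Type} [CommRing C] [Algebra ℂ C] [CommRing C'] [Algebra ℂ C']
    (f : C →ₐ[ℂ] C') (X : Fin m → Matrix (Fin N) (Fin N) C) (z : FreeAlgebra ℂ (Fin m)) :
    f.mapMatrix (wordEval X z) = wordEval (fun k => f.mapMatrix (X k)) z := by
  have : f.mapMatrix.comp (wordEval X) = wordEval (fun k => f.mapMatrix (X k)) := by
    apply FreeAlgebra.hom_ext
    ext1 k
    simp
  exact DFunLike.congr_fun this z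

theorem wordEval_intertwine {C : Type} [CommRing C] [Algebra ℂ C] {r : ℕ}
    (X : Fin m → Matrix (Fin N) (Fin N) C) (Y : Fin m → Matrix (Fin r) (Fin r) C)
    (g : Matrix (Fin N) (Fin r) C) (h : ∀ k, X k * g = g * Y k) (z : FreeAlgebra ℂ (Fin m)) :
    wordEval X z * g = g * wordEval Y z := by
  induction z using FreeAlgebra.induction with
  | grade0 r => simp [Algebra.algebraMap_eq_smul_one]
  | grade1 k => simpa using h k
  | mul a b ha hb =>
    rw [map_mul, map_mul, Matrix.mul_assoc, hb, ← Matrix.mul_assoc, ha, Matrix.mul_assoc]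
  | add a b ha hb => rw [map_add, map_add, Matrix.add_mul, Matrix.mul_add, ha, hb]

/-- The evaluation of polynomials in the matrix entries. -/
def polyEval {C : Type} [CommRing C] [Algebra ℂ C] (X : Fin m → Matrix (Fin N) (Fin N) C) :
    MvPolynomial (Fin m × Fin N × Fin N) ℂ →ₐ[ℂ] C :=
  MvPolynomial.aeval fun i => X i.1 i.2.1 i.2.2

theorem map_polyEval {C C' : Type} [CommRing C] [Algebra ℂ C] [CommRing C'] [Algebra ℂ C']
    (f : C →ₐ[ℂ] C') (X : Fin m → Matrix (Fin N) (Fin N) C)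
    (P : MvPolynomial (Fin m × Fin N × Fin N) ℂ) :
    f (polyEval X P) = polyEval (fun k => f.mapMatrix (X k)) P := by
  have : f.comp (polyEval X) = polyEval (fun k => f.mapMatrix (X k)) := by
    apply MvPolynomial.algHom_ext
    intro i
    simp [polyEval]
  exact DFunLike.congr_fun this P

end Words

section InvariantRing

variable (S : Set (Fin m → Matrix (Fin N) (Fin N) ℂ))

/-- The algebra of invariant regular functions. -/
abbrev InvRing : Subalgebra ℂ (S → ℂ) := coordinateRing S ⊓ conjInvariant S

variable {S}

/-- The evaluation of invariant functions at a point. -/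
def evalAt (X : S) : InvRing S →ₐ[ℂ] ℂ := (Pi.evalAlgHom ℂ (fun _ : S => ℂ) X).comp (Subalgebra.val _)

theorem evalAt_apply (X : S) (a : InvRing S) : evalAt X a = a.1 X := rfl

theorem invRing_ext {a b : InvRing S} (h : ∀ X, evalAt X a = evalAt X b) : a = b :=
  Subtype.ext (funext h)

theorem aeval_coord_apply (P : MvPolynomial (Fin m × Fin N × Fin N) ℂ) (X : S) :
    MvPolynomial.aeval (R := ℂ)
      (fun (i : Fin m × Fin N × Fin N) (X : S) => X.1 i.1 i.2.1 i.2.2) P X = polyEval X.1 P := by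
  have : (Pi.evalAlgHom ℂ (fun _ : S => ℂ) X).comp (MvPolynomial.aeval (R := ℂ)
      (fun (i : Fin m × Fin N × Fin N) (X : S) => X.1 i.1 i.2.1 i.2.2)) = polyEval X.1 := by
    apply MvPolynomial.algHom_ext
    intro i
    simp [polyEval]
  exact DFunLike.congr_fun this P

theorem exists_polyEval (a : InvRing S) : ∃ P, ∀ X : S, evalAt X a = polyEval X.1 P := by
  obtain ⟨P, hP⟩ := a.2.1
  refine ⟨P, fun X => ?_⟩
  rw [← aeval_coord_apply, evalAt_apply, ← hP]
  rfl

theorem evalAt_conj (a : InvRing S) (X Y : S) (g : Matrix (Fin N) (Fin N) ℂ) (hg : IsUnit g.det)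
    (h : ∀ k, Y.1 k * g = g * X.1 k) : evalAt Y a = evalAt X a := by
  refine a.2.2 (GeneralLinearGroup.mkOfDetNeZero g hg.ne_zero) X Y fun k => ?_
  have hu : (GeneralLinearGroup.mkOfDetNeZero g hg.ne_zero : Matrix (Fin N) (Fin N) ℂ) = g := rfl
  rw [Units.eq_mul_inv_iff_mul_eq, hu, h]

variable (S) in
/-- The invariant function `X ↦ tr z(X)`. -/
def traceInv : FreeAlgebra ℂ (Fin m) →ₗ[ℂ] InvRing S where
  toFun z := ⟨fun X => trace (wordEval X.1 z), by
    refine ⟨⟨trace (wordEval (fun k => of fun i j => MvPolynomial.X (k, i, j)) z), ?_⟩, ?_⟩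
    · ext X
      refine (aeval_coord_apply _ X).trans ?_
      have h1 : ∀ M : Matrix (Fin N) (Fin N) (MvPolynomial (Fin m × Fin N × Fin N) ℂ),
          polyEval X.1 (trace M) = trace ((polyEval X.1).mapMatrix M) := fun M => by
        simp [trace]
      rw [h1, mapMatrix_wordEval]
      congr 3
      ext k i j
      simp [polyEval]
    · intro g X Y h
      change trace (wordEval Y.1 z) = trace (wordEval X.1 z)
      have h1 := wordEval_intertwine Y.1 X.1 (g : Matrix (Fin N) (Fin N) ℂ) (fun k => by
        rw [h k, mul_assoc, Units.inv_mul, mul_one]) z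
      rw [← Units.eq_mul_inv_iff_mul_eq] at h1
      rw [h1, trace_mul_comm, Units.inv_mul_cancel_left]⟩
  map_add' a b := by
    apply Subtype.ext
    ext X
    simp
  map_smul' r a := by
    apply Subtype.ext
    ext X
    simp

end InvariantRing

/-! ### The form attached to a simple eigenvalue, and genericity. -/

section Solutions

variable (κ : RelKind) (c : Fin m → Fin N → ℂ)

/-- The solutions: tuples of matrices with the given eigenvalues that satisfy the relation. -/
def solSet : Set (Fin m → Matrix (Fin N) (Fin N) ℂ) :=
  {X | ∃ f : FrameRing κ c →ₐ[ℂ] ℂ, ∀ k, X k = f.mapMatrix (univSol κ c k)}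

variable {κ c}

/-- The solution attached to a framed solution. -/
def solAt (f : FrameRing κ c →ₐ[ℂ] ℂ) : solSet κ c := ⟨fun k => f.mapMatrix (univSol κ c k), f, fun _ => rfl⟩

theorem exists_solAt_eq (X : solSet κ c) : ∃ f, solAt f = X := by
  obtain ⟨X, f, hf⟩ := X
  exact ⟨f, Subtype.ext (funext fun k => (hf k).symm)⟩

/-- Invariant functions as functions on the scheme of framed solutions. -/
theorem exists_invRing_hom [IsReduced (FrameRing κ c)] :
    ∃ φ : InvRing (solSet κ c) →ₐ[ℂ] FrameRing κ c, ∀ a f, f (φ a) = evalAt (solAt f) a := by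
  -- The polynomial representatives are arbitrary. The result is still a homomorphism, since
  -- equalities in the reduced ring `FrameRing κ c` may be checked at complex points.
  choose P hP using exists_polyEval (S := solSet κ c)
  have h1 : ∀ a (f : FrameRing κ c →ₐ[ℂ] ℂ), f (polyEval (univSol κ c) (P a)) =
      evalAt (solAt f) a := fun a f => by
    rw [hP, map_polyEval]
    rfl
  have hext : ∀ x y : FrameRing κ c, (∀ f : FrameRing κ c →ₐ[ℂ] ℂ, f x = f y) → x = y :=
    fun x y h => sub_eq_zero.mp (eq_zero_of_forall_algHom _ fun f => by rw [map_sub, h, sub_self])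
  refine ⟨AlgHom.mk' ⟨⟨⟨fun a => polyEval (univSol κ c) (P a), ?_⟩, ?_⟩, ?_, ?_⟩ ?_, h1⟩
  · exact hext _ _ fun f => by rw [h1, map_one, map_one]
  · exact fun a b => hext _ _ fun f => by simp only [h1, map_mul]
  · exact hext _ _ fun f => by simp only [h1, map_zero]
  · exact fun a b => hext _ _ fun f => by
      simp only [h1, map_add]
  · exact fun r a => hext _ _ fun f => by
      change f (polyEval (univSol κ c) (P (r • a))) = f (r • polyEval (univSol κ c) (P a))
      rw [map_smul, h1, h1, map_smul]

/-- The Lagrange idempotent of the eigenvalue `z` of the `k`-th matrix. -/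
def eigenPoly (c : Fin N → ℂ) (z : ℂ) : Polynomial ℂ := Lagrange.basis (Finset.univ.image c) id z

theorem eval_eigenPoly (c : Fin N → ℂ) (i j : Fin N) :
    (eigenPoly c (c i)).eval (c j) = if c j = c i then 1 else 0 := by
  have hi : ∀ i, c i ∈ Finset.univ.image c := fun i => Finset.mem_image_of_mem c (Finset.mem_univ i)
  split_ifs with h
  · rw [h]
    exact Lagrange.eval_basis_self (v := id) (Set.injOn_id _) (hi i)
  · exact Lagrange.eval_basis_of_ne (v := id) (Ne.symm h) (hi j)

variable (c)

/-- The noncommutative polynomial that gives the projection to the eigenline of a simple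
eigenvalue. -/
def lineProj (k₀ : Fin m) (i₀ : Fin N) : FreeAlgebra ℂ (Fin m) :=
  Polynomial.aeval (FreeAlgebra.ι ℂ k₀) (eigenPoly (c k₀) (c k₀ i₀))

/-- The functional `z ↦ tr (p z)` with values in invariant functions, for the projection `p` to the
eigenline. -/
def lineForm (κ : RelKind) (k₀ : Fin m) (i₀ : Fin N) :
    FreeAlgebra ℂ (Fin m) →ₗ[ℂ] InvRing (solSet κ c) :=
  traceInv (solSet κ c) ∘ₗ LinearMap.mulLeft ℂ (lineProj c k₀ i₀)

/-- The eigenvalue with index `i₀` of the matrix with index `k₀` is simple. -/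
def IsSimpleEigenvalue (k₀ : Fin m) (i₀ : Fin N) : Prop := ∀ i, c k₀ i = c k₀ i₀ → i = i₀

variable {c} {k₀ : Fin m} {i₀ : Fin N}

theorem wordEval_aeval {C : Type} [CommRing C] [Algebra ℂ C]
    (X : Fin m → Matrix (Fin N) (Fin N) C) (k : Fin m) (q : Polynomial ℂ) :
    wordEval X (Polynomial.aeval (FreeAlgebra.ι ℂ k) q) = Polynomial.aeval (X k) q := by
  rw [← Polynomial.aeval_algHom_apply, wordEval_ι]

section Point

variable {C : Type} [CommRing C] [Algebra ℂ C] (f : FrameRing κ c →ₐ[ℂ] C)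

/-- The solution with values in an algebra attached to a framed solution. -/
def pointSol (k : Fin m) : Matrix (Fin N) (Fin N) C := f.mapMatrix (univSol κ c k)

/-- The eigenvector for the eigenvalue with index `i₀`. -/
def eigenVec (k₀ : Fin m) (i₀ : Fin N) : Fin N → C := fun i => f.mapMatrix (univFrame κ c true k₀) i i₀

/-- The eigencovector for the eigenvalue with index `i₀`. -/
def eigenCovec (k₀ : Fin m) (i₀ : Fin N) : Fin N → C :=
  fun i => f.mapMatrix (univFrame κ c false k₀) i₀ i

theorem wordEval_aeval_pointSol (k : Fin m) (q : Polynomial ℂ) :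
    wordEval (pointSol f) (Polynomial.aeval (FreeAlgebra.ι ℂ k) q) =
      f.mapMatrix (univFrame κ c true k) * diagMat C (fun i => q.eval (c k i)) *
        f.mapMatrix (univFrame κ c false k) := by
  rw [wordEval_aeval, pointSol, mapMatrix_univSol, aeval_conj_diagMat _ (mapMatrix_univFrame_mul f k)]

/-- In the eigenframe the Lagrange polynomial becomes the diagonal matrix unit at `i₀`; simplicity
of the eigenvalue makes the projection rank one. -/
theorem wordEval_lineProj (h₀ : IsSimpleEigenvalue c k₀ i₀) :
    wordEval (pointSol f) (lineProj c k₀ i₀) =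
      vecMulVec (eigenVec f k₀ i₀) (eigenCovec f k₀ i₀) := by
  rw [lineProj, wordEval_aeval_pointSol]
  ext a b
  rw [diagMat, mul_apply, vecMulVec_apply, Finset.sum_eq_single i₀]
  · rw [mul_diagonal, eval_eigenPoly, if_pos rfl, map_one, mul_one]
    rfl
  · intro i _ hi
    rw [mul_diagonal, eval_eigenPoly, if_neg (fun h => hi (h₀ i h)), map_zero, mul_zero, zero_mul]
  · simp

theorem eigenCovec_dotProduct_eigenVec : eigenCovec f k₀ i₀ ⬝ᵥ eigenVec f k₀ i₀ = 1 := by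
  have h1 : f.mapMatrix (univFrame κ c false k₀) * f.mapMatrix (univFrame κ c true k₀) = 1 :=
    mul_eq_one_comm.mp (mapMatrix_univFrame_mul f k₀)
  have h2 := congrFun (congrFun h1 i₀) i₀
  rwa [mul_apply, one_apply_eq] at h2

theorem trace_wordEval_lineProj_mul (h₀ : IsSimpleEigenvalue c k₀ i₀) (z : FreeAlgebra ℂ (Fin m)) :
    trace (wordEval (pointSol f) (lineProj c k₀ i₀ * z)) =
      eigenCovec f k₀ i₀ ⬝ᵥ (wordEval (pointSol f) z *ᵥ eigenVec f k₀ i₀) := by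
  rw [map_mul, wordEval_lineProj f h₀, trace_mul_comm, mul_vecMulVec, trace_vecMulVec,
    dotProduct_comm]

end Point

theorem evalAt_lineForm (h₀ : IsSimpleEigenvalue c k₀ i₀) (f : FrameRing κ c →ₐ[ℂ] ℂ)
    (z : FreeAlgebra ℂ (Fin m)) : evalAt (solAt f) (lineForm c κ k₀ i₀ z) =
      eigenCovec f k₀ i₀ ⬝ᵥ (wordEval (pointSol f) z *ᵥ eigenVec f k₀ i₀) := by
  rw [← trace_wordEval_lineProj_mul f h₀]
  rfl

theorem invRing_ext_solAt {a b : InvRing (solSet κ c)}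
    (h : ∀ f, evalAt (solAt f) a = evalAt (solAt f) b) : a = b :=
  invRing_ext fun X => by
    obtain ⟨f, rfl⟩ := exists_solAt_eq X
    exact h f

theorem lineForm_one (h₀ : IsSimpleEigenvalue c k₀ i₀) : lineForm c κ k₀ i₀ 1 = 1 :=
  invRing_ext_solAt fun f => by
    rw [evalAt_lineForm h₀, map_one, one_mulVec, eigenCovec_dotProduct_eigenVec, map_one]

/-- A rank-one projection satisfies `p a p = tr (p a) p`. -/
theorem lineForm_mul (h₀ : IsSimpleEigenvalue c k₀ i₀) (a b : FreeAlgebra ℂ (Fin m)) :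
    lineForm c κ k₀ i₀ (a * lineProj c k₀ i₀ * b) = lineForm c κ k₀ i₀ a * lineForm c κ k₀ i₀ b :=
  invRing_ext_solAt fun f => by
    rw [map_mul (evalAt _), evalAt_lineForm h₀, evalAt_lineForm h₀, evalAt_lineForm h₀, map_mul, map_mul,
      wordEval_lineProj f h₀, ← mulVec_mulVec, ← mulVec_mulVec, vecMulVec_mulVec, mulVec_smul]
    simp [mul_comm]

theorem lineForm_eq_zero (z : FreeAlgebra ℂ (Fin m))
    (hz : ∀ f : FrameRing κ c →ₐ[ℂ] ℂ, wordEval (pointSol f) z = 0) (a b : FreeAlgebra ℂ (Fin m)) :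
    lineForm c κ k₀ i₀ (a * z * b) = 0 :=
  invRing_ext_solAt fun f => by
    change trace (wordEval (pointSol f) (lineProj c k₀ i₀ * (a * z * b))) = 0
    rw [map_mul, map_mul, map_mul, hz]
    simp

theorem algHom_gram {B B' : Type} [CommRing B] [Algebra ℂ B] [CommRing B'] [Algebra ℂ B']
    (τ : B →ₐ[ℂ] B') {L : Type} [Ring L] [Algebra ℂ L] (t : L →ₗ[ℂ] B) {r : ℕ} (y w : Fin r → L)
    (z : L) : τ.mapMatrix (gram t y w z) = gram (τ.toLinearMap ∘ₗ t) y w z := rfl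

theorem algHom_det_gram {B B' : Type} [CommRing B] [Algebra ℂ B] [CommRing B'] [Algebra ℂ B']
    (τ : B →ₐ[ℂ] B') {L : Type} [Ring L] [Algebra ℂ L] (t : L →ₗ[ℂ] B) {r : ℕ} (y w : Fin r → L)
    (z : L) : τ (gram t y w z).det = (gram (τ.toLinearMap ∘ₗ t) y w z).det := by
  rw [AlgHom.map_det, algHom_gram]

/-- At each solution the form factors through `ℂ ^ N`, and invariant functions are determined by
their values at solutions. -/
theorem det_gram_lineForm (h₀ : IsSimpleEigenvalue c k₀ i₀) {r : ℕ} (hr : N < r)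
    (y w : Fin r → FreeAlgebra ℂ (Fin m)) : (gram (lineForm c κ k₀ i₀) y w 1).det = 0 :=
  invRing_ext_solAt fun f => by
    rw [algHom_det_gram, map_zero, gram_eq_mul (wordEval (pointSol f)) (eigenVec f k₀ i₀)
      (eigenCovec f k₀ i₀) _ (evalAt_lineForm h₀ f), Matrix.mul_assoc]
    exact det_mul_eq_zero hr _ _

variable (κ c k₀ i₀) in
/-- The eigenvalues are generic: no proper part of them that contains the simple eigenvalue exactly
once is compatible with the relation. -/
def RelKind.Generic : Prop :=
  ∀ r < N, ∀ e : Fin m → Fin r → Fin N,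
    (Finset.univ.filter fun i => e k₀ i = i₀).card = 1 → ¬ κ.Compat fun k i => c k (e k i)

theorem wordEval_prod_eq_zero (f : FrameRing κ c →ₐ[ℂ] ℂ) (k : Fin m) :
    wordEval (pointSol f) (Polynomial.aeval (FreeAlgebra.ι ℂ k)
      (∏ z ∈ Finset.univ.image (c k), (Polynomial.X - Polynomial.C z))) = 0 := by
  rw [wordEval_aeval_pointSol]
  have : diagMat ℂ (fun i => (∏ z ∈ Finset.univ.image (c k),
      (Polynomial.X - Polynomial.C z)).eval (c k i)) = (0 : Matrix (Fin N) (Fin N) ℂ) := by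
    rw [diagMat, diagonal_eq_zero]
    ext i
    simp only [Polynomial.eval_prod, Polynomial.eval_sub, Polynomial.eval_X, Polynomial.eval_C,
      Pi.zero_apply, map_eq_zero]
    exact Finset.prod_eq_zero (Finset.mem_image_of_mem (c k) (Finset.mem_univ i)) (sub_self _)
  rw [this, mul_zero, zero_mul]

theorem wordEval_rel (f : FrameRing κ c →ₐ[ℂ] ℂ) :
    wordEval (pointSol f) (κ.rel fun k => FreeAlgebra.ι ℂ k) = 0 := by
  rw [κ.algHom_rel]
  simp only [wordEval_ι]
  exact rel_mapMatrix_univSol f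

/-- The structure of representations over a field that satisfy the equations of solutions. -/
theorem exists_diagonalization_of_rep {K : Type} [Field K] [Algebra ℂ K] {r : ℕ}
    (M : FreeAlgebra ℂ (Fin m) →ₐ[ℂ] Matrix (Fin r) (Fin r) K)
    (hM : ∀ z, (∀ f : FrameRing κ c →ₐ[ℂ] ℂ, wordEval (pointSol f) z = 0) → M z = 0) :
    ∃ (G H : Fin m → Matrix (Fin r) (Fin r) K) (e : Fin m → Fin r → Fin N),
      (∀ k, G k * H k = 1) ∧
      (∀ k, M (FreeAlgebra.ι ℂ k) = G k * diagMat K (fun i => c k (e k i)) * H k) ∧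
      κ.rel (fun k => G k * diagMat K (fun i => c k (e k i)) * H k) = 0 := by
  have h1 : ∀ k, ∃ (G H : Matrix (Fin r) (Fin r) K) (e : Fin r → Fin N), G * H = 1 ∧
      M (FreeAlgebra.ι ℂ k) = G * diagMat K (fun i => c k (e i)) * H := by
    intro k
    have := hM _ fun f => wordEval_prod_eq_zero f k
    rw [← Polynomial.aeval_algHom_apply] at this
    obtain ⟨G, H, d, hGH, hd, hX⟩ := exists_diagonalization _ _ this
    choose e he using fun i => Finset.mem_image.mp (hd i)
    refine ⟨G, H, e, hGH, ?_⟩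
    rw [hX]
    simp only [he]
  choose G H e hGH hX using h1
  refine ⟨G, H, e, hGH, hX, ?_⟩
  have := hM _ wordEval_rel
  rw [κ.algHom_rel] at this
  simpa only [hX] using this

/-- A form of rank `r < N` would reconstruct a representation of dimension `r` that obeys all
identities of solutions and contains the simple eigenvalue once, against genericity. It matters that
`τ` is any field-valued point: points of the quotient are not yet known to come from solutions. -/
theorem exists_det_gram_ne_zero (h₀ : IsSimpleEigenvalue c k₀ i₀) (hgen : κ.Generic c k₀ i₀)
    {K : Type} [Field K] [Algebra ℂ K] (τ : InvRing (solSet κ c) →ₐ[ℂ] K) :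
    ∃ y w : Fin N → FreeAlgebra ℂ (Fin m), τ (gram (lineForm c κ k₀ i₀) y w 1).det ≠ 0 := by
  classical
  by_contra hcon
  have hex : ∃ r : ℕ, ∀ y w : Fin r → FreeAlgebra ℂ (Fin m),
      τ (gram (lineForm c κ k₀ i₀) y w 1).det = 0 :=
    ⟨N + 1, fun y w => by rw [det_gram_lineForm h₀ (Nat.lt_succ_self N), map_zero]⟩
  -- The least size at which all Gram determinants vanish is positive, as the empty determinant is
  -- `1`; `r` is the rank of the form over `K`.
  obtain ⟨r, hr⟩ : ∃ r, Nat.find hex = r + 1 := by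
    refine Nat.exists_eq_succ_of_ne_zero fun h0 => ?_
    have := Nat.find_spec hex
    rw [h0] at this
    have := this ![] ![]
    rw [det_isEmpty, map_one] at this
    exact one_ne_zero this
  have hr1 : ∀ y w : Fin (r + 1) → FreeAlgebra ℂ (Fin m),
      τ (gram (lineForm c κ k₀ i₀) y w 1).det = 0 := hr ▸ Nat.find_spec hex
  have hr2 := Nat.find_min hex (m := r) (by omega)
  push Not at hr2
  obtain ⟨y, w, hyw⟩ := hr2
  have hrN : r < N := by
    have h1 : Nat.find hex ≤ N + 1 := Nat.find_min' hex fun y w => by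
      rw [det_gram_lineForm h₀ (Nat.lt_succ_self N), map_zero]
    have h2 : r ≠ N := by
      rintro rfl
      exact hcon ⟨y, w, hyw⟩
    omega
  set t : FreeAlgebra ℂ (Fin m) →ₗ[ℂ] K := τ.toLinearMap ∘ₗ lineForm c κ k₀ i₀ with ht
  rw [algHom_det_gram] at hyw
  have hG : IsUnit (gram t y w 1).det := isUnit_iff_ne_zero.mpr hyw
  have hminor : ∀ y' w' : Fin (r + 1) → FreeAlgebra ℂ (Fin m), (gram t y' w' 1).det = 0 :=
    fun y' w' => by rw [ht, ← algHom_det_gram, hr1]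
  set M := gramRep t y w hG hminor
  have hM : ∀ z, (∀ f : FrameRing κ c →ₐ[ℂ] ℂ, wordEval (pointSol f) z = 0) → M z = 0 :=
    fun z hz => gramRep_eq_zero t y w hG hminor z fun a b => by
      rw [ht, LinearMap.comp_apply, lineForm_eq_zero z hz, map_zero]
  obtain ⟨G, H, e, hGH, hX, hrel⟩ := exists_diagonalization_of_rep M hM
  refine hgen r hrN e ?_ (κ.compat_of_rel_eq_zero _ G H hGH hrel)
  -- This trace counts the indices `i` with `e k₀ i = i₀`.
  have htr : trace (M (lineProj c k₀ i₀)) = 1 := by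
    refine trace_gramRep t y w hG hminor _ ?_ fun a b => ?_
    · rw [ht, LinearMap.comp_apply, lineForm_one h₀]
      exact map_one τ
    · simp only [ht, LinearMap.comp_apply, lineForm_mul h₀]
      exact map_mul τ _ _
  rw [lineProj, ← Polynomial.aeval_algHom_apply, hX, aeval_conj_diagMat _ (hGH k₀), trace_mul_cycle,
    mul_eq_one_comm.mp (hGH k₀), one_mul, diagMat, trace_diagonal] at htr
  have h3 : ∀ i, (eigenPoly (c k₀) (c k₀ i₀)).eval (c k₀ (e k₀ i)) =
      if e k₀ i = i₀ then 1 else 0 := fun i => by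
    rw [eval_eigenPoly]
    exact if_congr ⟨h₀ _, fun h => by rw [h]⟩ rfl rfl
  simp only [h3] at htr
  rw [← map_sum, ← map_one (algebraMap ℂ K)] at htr
  have h4 := (algebraMap ℂ K).injective htr
  rw [Finset.sum_boole] at h4
  exact_mod_cast h4

/-- A matrix `Z` commuting with the solution preserves the eigenline, so it acts on the eigenvector
by a scalar. Words applied to that vector span, being the columns of the invertible `W`, so `Z` is
that scalar. -/
theorem trivialCentralizer (h₀ : IsSimpleEigenvalue c k₀ i₀) (hgen : κ.Generic c k₀ i₀) :
    TrivialCentralizer κ c := by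
  intro f Z hZ
  obtain ⟨y, w, hyw⟩ := exists_det_gram_ne_zero h₀ hgen (evalAt (solAt f))
  rw [algHom_det_gram] at hyw
  obtain ⟨W, hW, hWv, -⟩ := exists_conj_of_isUnit_gram (wordEval (pointSol f)) (eigenVec f k₀ i₀)
    (eigenCovec f k₀ i₀) _ (evalAt_lineForm h₀ f) y w (isUnit_iff_ne_zero.mpr hyw)
  have hcomm : ∀ z, wordEval (pointSol f) z * Z = Z * wordEval (pointSol f) z :=
    wordEval_intertwine _ _ Z fun k => (hZ k).symm
  have h1 : Z *ᵥ eigenVec f k₀ i₀ =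
      (eigenCovec f k₀ i₀ ⬝ᵥ (Z *ᵥ eigenVec f k₀ i₀)) • eigenVec f k₀ i₀ := by
    have h2 := congrArg (· *ᵥ eigenVec f k₀ i₀) (hcomm (lineProj c k₀ i₀))
    simp only [wordEval_lineProj f h₀, ← mulVec_mulVec, vecMulVec_mulVec,
      eigenCovec_dotProduct_eigenVec] at h2
    simpa using h2.symm
  refine ⟨eigenCovec f k₀ i₀ ⬝ᵥ (Z *ᵥ eigenVec f k₀ i₀), ?_⟩
  have h3 : Z * W = (eigenCovec f k₀ i₀ ⬝ᵥ (Z *ᵥ eigenVec f k₀ i₀)) • W := by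
    ext a j
    have h4 : Z *ᵥ (wordEval (pointSol f) (w j) *ᵥ eigenVec f k₀ i₀) =
        (eigenCovec f k₀ i₀ ⬝ᵥ (Z *ᵥ eigenVec f k₀ i₀)) •
          (wordEval (pointSol f) (w j) *ᵥ eigenVec f k₀ i₀) := by
      rw [mulVec_mulVec, ← hcomm, ← mulVec_mulVec, h1, mulVec_smul, ← h1]
    have h5 := congrFun h4 a
    rw [Matrix.smul_apply, hWv, mul_apply]
    simp only [hWv]
    exact h5
  calc Z = Z * W * W⁻¹ := by rw [mul_assoc, mul_nonsing_inv _ hW, mul_one]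
    _ = _ := by rw [h3, smul_mul_assoc, mul_nonsing_inv _ hW]

end Solutions

end DeligneSimpson
end

open scoped Kronecker TensorProduct

noncomputable section

namespace DeligneSimpson

open Matrix

variable {m N : ℕ} {κ : RelKind} {c : Fin m → Fin N → ℂ} {k₀ : Fin m} {i₀ : Fin N}

/-! ### Local slices over the quotient. -/

section Slice

variable (φ : InvRing (solSet κ c) →ₐ[ℂ] FrameRing κ c)

/-- `φ` is the pullback of invariant functions to the scheme of framed solutions. -/
def IsPullback : Prop := ∀ a f, f (φ a) = evalAt (solAt f) a

variable {φ}

theorem IsPullback.apply_eq [IsReduced (FrameRing κ c)] (hφ : IsPullback φ)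
    {a : InvRing (solSet κ c)} {x : FrameRing κ c} (h : ∀ f, f x = evalAt (solAt f) a) :
    φ a = x :=
  sub_eq_zero.mp (eq_zero_of_forall_algHom _ fun f => by rw [map_sub, hφ, h, sub_self])

theorem IsPullback.apply_eq_polyEval [IsReduced (FrameRing κ c)] (hφ : IsPullback φ)
    {a : InvRing (solSet κ c)} {P : MvPolynomial (Fin m × Fin N × Fin N) ℂ}
    (hP : ∀ X : solSet κ c, evalAt X a = polyEval X.1 P) : φ a = polyEval (univSol κ c) P :=
  hφ.apply_eq fun f => by
    rw [hP, map_polyEval]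
    rfl

theorem IsPullback.map_traceInv [IsReduced (FrameRing κ c)] (hφ : IsPullback φ)
    {C : Type} [CommRing C] [Algebra ℂ C] (F : FrameRing κ c →ₐ[ℂ] C) (z : FreeAlgebra ℂ (Fin m)) :
    F (φ (traceInv (solSet κ c) z)) = trace (wordEval (pointSol F) z) := by
  have h1 : ∀ {C : Type} [CommRing C] [Algebra ℂ C] (F : FrameRing κ c →ₐ[ℂ] C),
      F (trace (wordEval (univSol κ c) z)) = trace (wordEval (pointSol F) z) := by
    intro C _ _ F
    have h2 := mapMatrix_wordEval F (univSol κ c) z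
    have h3 : F (trace (wordEval (univSol κ c) z)) =
        trace (F.mapMatrix (wordEval (univSol κ c) z)) := by simp [trace]
    rw [h3, h2]
    rfl
  rw [hφ.apply_eq (x := trace (wordEval (univSol κ c) z)) fun f => ?_, h1]
  rw [h1]
  rfl

theorem IsPullback.map_lineForm [IsReduced (FrameRing κ c)] (hφ : IsPullback φ)
    (h₀ : IsSimpleEigenvalue c k₀ i₀) {C : Type} [CommRing C] [Algebra ℂ C]
    (F : FrameRing κ c →ₐ[ℂ] C) (z : FreeAlgebra ℂ (Fin m)) :
    F (φ (lineForm c κ k₀ i₀ z)) =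
      eigenCovec F k₀ i₀ ⬝ᵥ (wordEval (pointSol F) z *ᵥ eigenVec F k₀ i₀) := by
  rw [← trace_wordEval_lineProj_mul F h₀]
  exact hφ.map_traceInv F _

variable {B : Type} [CommRing B] [Algebra ℂ B] [Algebra (InvRing (solSet κ c)) B]

variable (φ) in
/-- A family of matrices over the invariant functions that represents every solution up to
conjugation. -/
def IsSlice (σ : Fin m → Matrix (Fin N) (Fin N) B) : Prop :=
  ∀ {C : Type} [CommRing C] [Algebra ℂ C] (F : FrameRing κ c →ₐ[ℂ] C) (F' : B →ₐ[ℂ] C),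
    (∀ a, F' (algebraMap _ B a) = F (φ a)) →
    ∃ W : Matrix (Fin N) (Fin N) C, IsUnit W.det ∧
      ∀ k, pointSol F k * W = W * F'.mapMatrix (σ k)

/-- Over the image of a solution, the slice specializes to a conjugate of it, so the conjugated
frames make that specialization a solution too. -/
theorem IsSlice.exists_point {σ : Fin m → Matrix (Fin N) (Fin N) B} (hφ : IsPullback φ) (hσ : IsSlice φ σ) (F : FrameRing κ c →ₐ[ℂ] ℂ)
    (χ : B →ₐ[ℂ] ℂ) (h : ∀ a, χ (algebraMap _ B a) = evalAt (solAt F) a) :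
    ∃ F₁ : FrameRing κ c →ₐ[ℂ] ℂ, (∀ k, pointSol F₁ k = χ.mapMatrix (σ k)) ∧
      ∀ a, evalAt (solAt F₁) a = evalAt (solAt F) a := by
  obtain ⟨W, hW, hWσ⟩ := hσ F χ fun a => by rw [h, hφ]
  have hW1 : W * W⁻¹ = 1 := mul_nonsing_inv _ hW
  have hW2 : W⁻¹ * W = 1 := nonsing_inv_mul _ hW
  have hσ' : ∀ k, W⁻¹ * pointSol F k * W = χ.mapMatrix (σ k) := fun k => by
    rw [mul_assoc, hWσ, ← mul_assoc, hW2, one_mul]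
  have hsol : ∀ k, (W⁻¹ * F.mapMatrix (univFrame κ c true k)) * diagMat ℂ (c k) *
      (F.mapMatrix (univFrame κ c false k) * W) = W⁻¹ * pointSol F k * W := fun k => by
    rw [pointSol, mapMatrix_univSol]
    simp only [mul_assoc]
  obtain ⟨F₁, h1, h2⟩ := exists_frameRing_hom (κ := κ) (c := c)
    (fun k => W⁻¹ * F.mapMatrix (univFrame κ c true k))
    (fun k => F.mapMatrix (univFrame κ c false k) * W)
    (fun k => by
      rw [mul_assoc, ← mul_assoc _ _ W, mapMatrix_univFrame_mul, one_mul, hW2])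
    (by
      simp only [hsol]
      have h3 := κ.rel_conj (pointSol F) (⟨W⁻¹, W, hW2, hW1⟩ : (Matrix (Fin N) (Fin N) ℂ)ˣ)
      have h4 : κ.rel (pointSol F) = 0 := rel_mapMatrix_univSol F
      rw [h4, mul_zero, zero_mul] at h3
      exact h3)
  have hF₁ : ∀ k, pointSol F₁ k = χ.mapMatrix (σ k) := fun k => by
    rw [pointSol, mapMatrix_univSol, h1, h2, hsol, hσ']
  refine ⟨F₁, hF₁, fun a => (evalAt_conj a (solAt F₁) (solAt F) W hW fun k => ?_).symm⟩
  exact (hWσ k).trans (congrArg (W * ·) (hF₁ k).symm)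

variable [IsScalarTower ℂ (InvRing (solSet κ c)) B]

/-- Where a Gram determinant is invertible, the slice is the representation `gramRep` reconstructed
from the invariant form. -/
theorem exists_isSlice [IsReduced (FrameRing κ c)] (hφ : IsPullback φ)
    (h₀ : IsSimpleEigenvalue c k₀ i₀) (y w : Fin N → FreeAlgebra ℂ (Fin m))
    (hu : IsUnit (algebraMap _ B (gram (lineForm c κ k₀ i₀) y w 1).det)) :
    ∃ σ : Fin m → Matrix (Fin N) (Fin N) B, IsSlice φ σ := by
  set α : InvRing (solSet κ c) →ₐ[ℂ] B := IsScalarTower.toAlgHom ℂ _ B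
  set t : FreeAlgebra ℂ (Fin m) →ₗ[ℂ] B := α.toLinearMap ∘ₗ lineForm c κ k₀ i₀ with ht
  have hG : IsUnit (gram t y w 1).det := by
    rw [ht, ← algHom_det_gram]
    exact hu
  have hminor : ∀ y' w' : Fin (N + 1) → FreeAlgebra ℂ (Fin m), (gram t y' w' 1).det = 0 :=
    fun y' w' => by rw [ht, ← algHom_det_gram, det_gram_lineForm h₀ (Nat.lt_succ_self N), map_zero]
  refine ⟨fun k => gramRep t y w hG hminor (FreeAlgebra.ι ℂ k), ?_⟩
  intro C _ _ F F' hF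
  have h1 : ∀ z, (F'.toLinearMap ∘ₗ t) z =
      eigenCovec F k₀ i₀ ⬝ᵥ (wordEval (pointSol F) z *ᵥ eigenVec F k₀ i₀) := fun z => by
    rw [← hφ.map_lineForm h₀]
    exact hF _
  have hG' : IsUnit (gram (F'.toLinearMap ∘ₗ t) y w 1).det := by
    rw [← algHom_det_gram]
    exact hG.map F'
  obtain ⟨W, hW, -, h2⟩ := exists_conj_of_isUnit_gram (wordEval (pointSol F)) _ _ _ h1 y w hG'
  refine ⟨W, hW, fun k => ?_⟩
  have h3 := h2 (FreeAlgebra.ι ℂ k)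
  rw [wordEval_ι] at h3
  rw [← h3]
  change _ = W * F'.mapMatrix ((gram t y w 1)⁻¹ * gram t y w (FreeAlgebra.ι ℂ k))
  rw [map_mul, algHom_gram]
  congr 2
  have h4 : F'.mapMatrix (gram t y w 1) * F'.mapMatrix (gram t y w 1)⁻¹ = 1 := by
    rw [← map_mul, mul_nonsing_inv _ hG, map_one]
  rw [algHom_gram] at h4
  exact inv_eq_right_inv h4

/-- Invariants are honest functions on solutions, so identities in a localization may be checked at
points lying over solutions. No finite generation is needed here, which avoids a circle with
`IsSlice.finiteType`. -/
theorem eq_zero_of_away (f : InvRing (solSet κ c)) [IsLocalization.Away f B] (x : B)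
    (h : ∀ (F : FrameRing κ c →ₐ[ℂ] ℂ) (χ : B →ₐ[ℂ] ℂ),
      (∀ a, χ (algebraMap _ B a) = evalAt (solAt F) a) → χ x = 0) : x = 0 := by
  obtain ⟨n, b, hb⟩ := IsLocalization.Away.surj f x
  have h1 : f * b = 0 := invRing_ext_solAt fun F => by
    rw [map_mul, map_zero, mul_eq_zero, or_iff_not_imp_left]
    intro hf
    obtain ⟨χ, hχ⟩ := exists_algHom_away_comp_eq f (evalAt (solAt F))
      (isUnit_iff_ne_zero.mpr hf) B
    have hχ' : ∀ a, χ (algebraMap _ B a) = evalAt (solAt F) a := DFunLike.congr_fun hχ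
    rw [← hχ', ← hb, map_mul, h F χ hχ', zero_mul]
  have hu := IsLocalization.Away.algebraMap_isUnit (S := B) f
  have h2 := congrArg (algebraMap _ B) h1
  rw [map_mul, map_zero, hu.mul_right_eq_zero, ← hb] at h2
  exact (hu.pow n).mul_left_eq_zero.mp h2

namespace IsSlice

variable {σ : Fin m → Matrix (Fin N) (Fin N) B}

theorem wordEval_eq_zero (f : InvRing (solSet κ c)) [IsLocalization.Away f B] (hφ : IsPullback φ) (hσ : IsSlice φ σ) (z : FreeAlgebra ℂ (Fin m))
    (hz : ∀ F : FrameRing κ c →ₐ[ℂ] ℂ, wordEval (pointSol F) z = 0) : wordEval σ z = 0 := by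
  ext i j
  refine eq_zero_of_away f _ fun F χ h => ?_
  obtain ⟨F₁, hF₁, -⟩ := hσ.exists_point hφ F χ h
  have h1 := mapMatrix_wordEval χ σ z
  rw [← funext hF₁, hz] at h1
  exact congrFun (congrFun h1 i) j

theorem trace_wordEval (f : InvRing (solSet κ c)) [IsLocalization.Away f B] (hφ : IsPullback φ) (hσ : IsSlice φ σ) (z : FreeAlgebra ℂ (Fin m)) (r : ℂ)
    (hz : ∀ F : FrameRing κ c →ₐ[ℂ] ℂ, trace (wordEval (pointSol F) z) = r) :
    trace (wordEval σ z) = algebraMap ℂ B r := by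
  rw [← sub_eq_zero]
  refine eq_zero_of_away f _ fun F χ h => ?_
  obtain ⟨F₁, hF₁, -⟩ := hσ.exists_point hφ F χ h
  have h1 := congrArg trace (mapMatrix_wordEval χ σ z)
  rw [← funext hF₁, hz] at h1
  rw [map_sub, AlgHom.commutes, ← h1, sub_eq_zero]
  simp [trace]

theorem polyEval_eq (f : InvRing (solSet κ c)) [IsLocalization.Away f B] (hφ : IsPullback φ) (hσ : IsSlice φ σ) {a : InvRing (solSet κ c)}
    {P : MvPolynomial (Fin m × Fin N × Fin N) ℂ}
    (hP : ∀ X : solSet κ c, evalAt X a = polyEval X.1 P) :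
    polyEval σ P = algebraMap _ B a := by
  rw [← sub_eq_zero]
  refine eq_zero_of_away f _ fun F χ h => ?_
  obtain ⟨F₁, hF₁, hF₁'⟩ := hσ.exists_point hφ F χ h
  rw [map_sub, map_polyEval, h, ← hF₁', hP, ← funext hF₁]
  exact sub_self _

/-- By `polyEval_eq` every invariant is a polynomial in the entries of the slice, so these entries
and the inverse of `f` generate. The finiteness theorem for invariants is thus bypassed, and the
Nullstellensatz applies locally. -/
theorem finiteType (f : InvRing (solSet κ c)) [IsLocalization.Away f B] (hφ : IsPullback φ) (hσ : IsSlice φ σ) : Algebra.FiniteType ℂ B := by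
  let s : Set B := insert (IsLocalization.Away.invSelf f)
    (Set.range fun i : Fin m × Fin N × Fin N => σ i.1 i.2.1 i.2.2)
  have hs : s.Finite := (Set.finite_range _).insert _
  refine ⟨⟨hs.toFinset, ?_⟩⟩
  rw [hs.coe_toFinset, eq_top_iff]
  rintro x -
  have halg : ∀ a, algebraMap _ B a ∈ Algebra.adjoin ℂ s := fun a => by
    obtain ⟨P, hP⟩ := exists_polyEval a
    rw [← hσ.polyEval_eq f hφ hP]
    refine Algebra.adjoin_mono (Set.subset_insert _ _) ?_
    rw [Algebra.adjoin_range_eq_range_aeval]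
    exact ⟨P, rfl⟩
  obtain ⟨n, b, hb⟩ := IsLocalization.Away.surj f x
  have h1 : x = algebraMap _ B b * IsLocalization.Away.invSelf f ^ n := by
    rw [← hb, mul_assoc, ← mul_pow, IsLocalization.Away.mul_invSelf, one_pow, mul_one]
  rw [h1]
  exact mul_mem (halg b) (pow_mem (Algebra.subset_adjoin (Set.mem_insert _ _)) n)

end IsSlice

end Slice

end DeligneSimpson
end

/-! ### Framing a slice: local sections over the quotient. -/

open scoped Kronecker TensorProduct

noncomputable section

namespace DeligneSimpson

open Matrix

variable {m N : ℕ} {κ : RelKind} {c : Fin m → Fin N → ℂ} {k₀ : Fin m} {i₀ : Fin N}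

/-- Two families with the same values and multiplicities differ by a permutation. -/
theorem exists_perm_of_card_eq (c d : Fin N → ℂ) (hd : ∀ i, ∃ j, d i = c j)
    (h : ∀ i, (Finset.univ.filter fun j => d j = c i).card =
      (Finset.univ.filter fun j => c j = c i).card) :
    ∃ π : Equiv.Perm (Fin N), ∀ j, c (π j) = d j := by
  classical
  have h1 : ∀ z, Nonempty ({j // d j = z} ≃ {j // c j = z}) := fun z => by
    rw [← Fintype.card_eq, Fintype.card_subtype, Fintype.card_subtype]
    by_cases hz : ∃ i, c i = z
    · obtain ⟨i, rfl⟩ := hz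
      exact h i
    · rw [Finset.filter_false_of_mem, Finset.filter_false_of_mem]
      · exact fun i _ hi => hz ⟨i, hi⟩
      · rintro i _ rfl
        obtain ⟨j, hj⟩ := hd i
        exact hz ⟨j, hj.symm⟩
  exact ⟨Equiv.ofFiberEquiv fun z => (h1 z).some, fun j => Equiv.ofFiberEquiv_map _ j⟩

theorem trace_conj_diagMat {C : Type} [CommRing C] [Algebra ℂ C] {G H : Matrix (Fin N) (Fin N) C}
    (hGH : G * H = 1) (d : Fin N → ℂ) :
    trace (G * diagMat C d * H) = algebraMap ℂ C (∑ i, d i) := by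
  rw [trace_mul_cycle, mul_eq_one_comm.mp hGH, one_mul, diagMat, trace_diagonal, map_sum]

/-- Eigenvectors taken column by column from matrices of eigenvectors. -/
theorem exists_eigenvector_matrix {B : Type} [CommRing B] [Algebra ℂ B] (χ : B →ₐ[ℂ] ℂ)
    (σ : Matrix (Fin N) (Fin N) B) (d : Fin N → ℂ) (p : Fin N → Matrix (Fin N) (Fin N) B)
    (hp : ∀ j, σ * p j = algebraMap ℂ B (d j) • p j) (g : Matrix (Fin N) (Fin N) ℂ)
    (e : Fin N → Fin N → ℂ) (h : ∀ j, χ.mapMatrix (p j) * g = g * diagMat ℂ (e j))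
    (he : ∀ j, e j j = 1) :
    ∃ s : Matrix (Fin N) (Fin N) B, σ * s = s * diagMat B d ∧ χ.mapMatrix s = g := by
  let g' : Matrix (Fin N) (Fin N) B := g.map (algebraMap ℂ B)
  have hg' : χ.mapMatrix g' = g := by
    ext i j
    simp [g']
  -- Column `j` is the given eigenvector `g` extended as a constant and projected by `p j`; `he`
  -- ensures that at `χ` the projection fixes it.
  refine ⟨of fun i j => (p j * g') i j, ?_, ?_⟩
  · ext i j
    have h1 : (σ * (p j * g')) i j = algebraMap ℂ B (d j) * (p j * g') i j := by
      rw [← mul_assoc, hp, smul_mul_assoc]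
      rfl
    rw [mul_apply] at h1
    rw [mul_apply, diagMat, mul_diagonal, of_apply, mul_comm _ (algebraMap ℂ B _), ← h1]
    exact Finset.sum_congr rfl fun l _ => by rw [of_apply]
  · ext i j
    have h1 : χ ((p j * g') i j) = χ.mapMatrix (p j * g') i j := rfl
    rw [AlgHom.mapMatrix_apply, map_apply, of_apply, h1, map_mul, hg', h, diagMat, mul_diagonal, he,
      map_one, mul_one]

section

variable {φ : InvRing (solSet κ c) →ₐ[ℂ] FrameRing κ c}
  {B : Type} [CommRing B] [Algebra ℂ B] [Algebra (InvRing (solSet κ c)) B]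
  [IsScalarTower ℂ (InvRing (solSet κ c)) B] {σ : Fin m → Matrix (Fin N) (Fin N) B}

namespace IsSlice

/-- Every complex point of `B` comes from a solution: the slice inherits the polynomial identities
of solutions, hence is diagonalizable there, and the traces of the Lagrange idempotents give the
right multiplicities. -/
theorem exists_frame (f : InvRing (solSet κ c)) [IsLocalization.Away f B] (hφ : IsPullback φ)
    (hσ : IsSlice φ σ) (χ : B →ₐ[ℂ] ℂ) :
    ∃ F : FrameRing κ c →ₐ[ℂ] ℂ, (∀ k, pointSol F k = χ.mapMatrix (σ k)) ∧
      ∀ a, χ (algebraMap _ B a) = evalAt (solAt F) a := by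
  obtain ⟨G, H, e, hGH, hX, hrel⟩ := exists_diagonalization_of_rep
    (χ.mapMatrix.comp (wordEval σ)) fun z hz => by
      rw [AlgHom.comp_apply, hσ.wordEval_eq_zero f hφ z hz, map_zero]
  have hX' : ∀ k, χ.mapMatrix (σ k) = G k * diagMat ℂ (fun i => c k (e k i)) * H k := fun k => by
    rw [← hX, AlgHom.comp_apply, wordEval_ι]
  have hperm : ∀ k, ∃ π : Equiv.Perm (Fin N), ∀ j, c k (π j) = c k (e k j) := by
    intro k
    refine exists_perm_of_card_eq (c k) _ (fun i => ⟨_, rfl⟩) fun i => ?_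
    have h1 := hσ.trace_wordEval f hφ
      (Polynomial.aeval (FreeAlgebra.ι ℂ k) (eigenPoly (c k) (c k i)))
      (∑ j, (eigenPoly (c k) (c k i)).eval (c k j)) fun F => by
        rw [wordEval_aeval_pointSol, trace_conj_diagMat (mapMatrix_univFrame_mul F k)]
        rfl
    have h2 := congrArg χ h1
    have h3 : χ (trace (wordEval σ
        (Polynomial.aeval (FreeAlgebra.ι ℂ k) (eigenPoly (c k) (c k i))))) =
        trace (Polynomial.aeval (χ.mapMatrix (σ k)) (eigenPoly (c k) (c k i))) := by
      rw [Polynomial.aeval_algHom_apply, ← wordEval_aeval]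
      simp [trace]
    rw [h3, hX', aeval_conj_diagMat _ (hGH k), trace_conj_diagMat (hGH k), AlgHom.commutes] at h2
    have h4 := (algebraMap ℂ ℂ).injective h2
    simp only [eval_eigenPoly, Finset.sum_boole] at h4
    exact_mod_cast h4
  choose π hπ using hperm
  have hsub : ∀ k, (G k).submatrix id (π k).symm * diagMat ℂ (c k) *
      (H k).submatrix (π k).symm id = G k * diagMat ℂ (fun i => c k (e k i)) * H k := by
    intro k
    have h1 : diagMat ℂ (c k) =
        (diagMat ℂ (fun i => c k (e k i))).submatrix (π k).symm (π k).symm := by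
      rw [diagMat, diagMat, submatrix_diagonal_equiv]
      congr 1
      ext i
      rw [Function.comp_apply, ← hπ, Equiv.apply_symm_apply]
    rw [h1, submatrix_mul_equiv, submatrix_mul_equiv, submatrix_id_id]
  obtain ⟨F, h1, h2⟩ := exists_frameRing_hom (κ := κ) (c := c)
    (fun k => (G k).submatrix id (π k).symm) (fun k => (H k).submatrix (π k).symm id)
    (fun k => by rw [submatrix_mul_equiv, hGH, submatrix_id_id]) (by simpa only [hsub] using hrel)
  have hF : ∀ k, pointSol F k = χ.mapMatrix (σ k) := fun k => by
    rw [pointSol, mapMatrix_univSol, h1, h2, hsub, hX']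
  refine ⟨F, hF, fun a => ?_⟩
  obtain ⟨P, hP⟩ := exists_polyEval a
  rw [← hσ.polyEval_eq f hφ hP, map_polyEval, hP, ← funext hF]
  rfl

/-- Eigenvectors of a slice near a framed solution. -/
theorem exists_eigenbasis (f : InvRing (solSet κ c)) [IsLocalization.Away f B]
    (hφ : IsPullback φ) (hσ : IsSlice φ σ) (χ : B →ₐ[ℂ] ℂ) (F : FrameRing κ c →ₐ[ℂ] ℂ)
    (hF : ∀ k, pointSol F k = χ.mapMatrix (σ k)) :
    ∃ s : Fin m → Matrix (Fin N) (Fin N) B, (∀ k, σ k * s k = s k * diagMat B (c k)) ∧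
      ∀ k, χ.mapMatrix (s k) = F.mapMatrix (univFrame κ c true k) := by
  let p : Fin m → Fin N → Matrix (Fin N) (Fin N) B := fun k j =>
    Polynomial.aeval (σ k) (eigenPoly (c k) (c k j))
  have hp : ∀ k j, σ k * p k j = algebraMap ℂ B (c k j) • p k j := by
    intro k j
    have h1 := hσ.wordEval_eq_zero f hφ (Polynomial.aeval (FreeAlgebra.ι ℂ k)
      ((Polynomial.X - Polynomial.C (c k j)) * eigenPoly (c k) (c k j))) fun F => by
        rw [wordEval_aeval_pointSol]
        have : diagMat ℂ (fun i => ((Polynomial.X - Polynomial.C (c k j)) *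
            eigenPoly (c k) (c k j)).eval (c k i)) = (0 : Matrix (Fin N) (Fin N) ℂ) := by
          rw [diagMat, diagonal_eq_zero]
          ext i
          by_cases h : c k i = c k j <;> simp [eval_eigenPoly, h]
        rw [this, mul_zero, zero_mul]
    rw [wordEval_aeval, map_mul, map_sub, Polynomial.aeval_X, Polynomial.aeval_C, sub_mul,
      sub_eq_zero] at h1
    rw [h1, Algebra.algebraMap_eq_smul_one, smul_mul_assoc, one_mul, algebraMap_smul]
  have hpF : ∀ k j, χ.mapMatrix (p k j) * F.mapMatrix (univFrame κ c true k) =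
      F.mapMatrix (univFrame κ c true k) *
        diagMat ℂ (fun i => (eigenPoly (c k) (c k j)).eval (c k i)) := fun k j => by
    have h3 : χ.mapMatrix (p k j) = wordEval (pointSol F)
        (Polynomial.aeval (FreeAlgebra.ι ℂ k) (eigenPoly (c k) (c k j))) := by
      rw [wordEval_aeval, hF, Polynomial.aeval_algHom_apply]
    rw [h3, wordEval_aeval_pointSol, mul_assoc,
      mul_eq_one_comm.mp (mapMatrix_univFrame_mul F k), mul_one]
  choose s hs using fun k => exists_eigenvector_matrix χ (σ k) (c k) (p k) (hp k) _ _ (hpF k)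
    fun j => by rw [eval_eigenPoly, if_pos rfl]
  exact ⟨s, fun k => (hs k).1, fun k => (hs k).2⟩

/-- A slice has frames after a further localization. -/
theorem exists_hom [IsReduced (FrameRing κ c)] (f : InvRing (solSet κ c))
    [IsLocalization.Away f B] (hφ : IsPullback φ) (hσ : IsSlice φ σ) (χ₀ : B →ₐ[ℂ] ℂ)
    (F₀ : FrameRing κ c →ₐ[ℂ] ℂ) (hF₀ : ∀ k, pointSol F₀ k = χ₀.mapMatrix (σ k))
    (hF₀' : ∀ a, χ₀ (algebraMap _ B a) = evalAt (solAt F₀) a) :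
    ∃ a : InvRing (solSet κ c), evalAt (solAt F₀) a ≠ 0 ∧
      ∀ (B' : Type) [CommRing B'] [Algebra ℂ B'] [Algebra (InvRing (solSet κ c)) B']
        [IsScalarTower ℂ (InvRing (solSet κ c)) B'] [IsLocalization.Away a B'],
        ∃ (ψ : FrameRing κ c →ₐ[ℂ] B') (χ : B' →ₐ[ℂ] ℂ),
          (∀ x, ψ (φ x) = algebraMap _ _ x) ∧ χ.comp ψ = F₀ := by
  obtain ⟨s, hs, hsF⟩ := hσ.exists_eigenbasis f hφ χ₀ F₀ hF₀
  -- The eigenvectors form bases at `χ₀`, hence wherever the numerator `b` of their determinants is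
  -- invertible.
  obtain ⟨n, b, hb⟩ := IsLocalization.Away.surj f (∏ k, (s k).det)
  have hdet : χ₀ (∏ k, (s k).det) ≠ 0 := by
    rw [map_prod, Finset.prod_ne_zero_iff]
    intro k _
    have h1 := congrArg det (mapMatrix_univFrame_mul F₀ k)
    rw [det_mul, det_one] at h1
    rw [AlgHom.map_det, hsF]
    exact left_ne_zero_of_mul_eq_one h1
  have hfF : evalAt (solAt F₀) f ≠ 0 := by
    rw [← hF₀']
    exact ((IsLocalization.Away.algebraMap_isUnit (S := B) f).map χ₀).ne_zero
  have hbF : evalAt (solAt F₀) b ≠ 0 := by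
    rw [← hF₀', ← hb, map_mul, map_pow, hF₀']
    exact mul_ne_zero hdet (pow_ne_zero n hfF)
  have haF : evalAt (solAt F₀) (f * b) ≠ 0 := by
    rw [map_mul]
    exact mul_ne_zero hfF hbF
  refine ⟨f * b, haF, fun B' _ _ _ _ _ => ?_⟩
  have hau : IsUnit (algebraMap (InvRing (solSet κ c)) B' f) ∧
      IsUnit (algebraMap (InvRing (solSet κ c)) B' b) := by
    rw [← IsUnit.mul_iff, ← map_mul]
    exact IsLocalization.Away.algebraMap_isUnit (f * b)
  obtain ⟨j, hj⟩ := exists_algHom_away_comp_eq f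
    (IsScalarTower.toAlgHom ℂ (InvRing (solSet κ c)) B') hau.1 B
  have hj' : ∀ x, j (algebraMap _ _ x) = algebraMap _ _ x := DFunLike.congr_fun hj
  have hsu : ∀ k, IsUnit (j.mapMatrix (s k)).det := by
    intro k
    have h1 : IsUnit (j (∏ k, (s k).det)) := by
      have h2 := congrArg j hb
      rw [map_mul, hj'] at h2
      exact isUnit_of_mul_isUnit_left (h2 ▸ hau.2)
    rw [map_prod, IsUnit.prod_univ_iff] at h1
    have h2 := h1 k
    rwa [AlgHom.map_det] at h2
  have hconj : ∀ k, j.mapMatrix (s k) * diagMat _ (c k) * (j.mapMatrix (s k))⁻¹ =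
      j.mapMatrix (σ k) := fun k => by
    rw [← mapMatrix_diagMat j, ← map_mul, ← hs, map_mul, mul_assoc, mul_nonsing_inv _ (hsu k),
      mul_one]
  have hσrel : κ.rel σ = 0 := by
    have h1 := hσ.wordEval_eq_zero f hφ _ wordEval_rel
    rw [κ.algHom_rel] at h1
    simpa only [wordEval_ι] using h1
  obtain ⟨ψ, hψ, hψ'⟩ := exists_frameRing_hom (κ := κ) (c := c)
    (fun k => j.mapMatrix (s k)) (fun k => (j.mapMatrix (s k))⁻¹)
    (fun k => mul_nonsing_inv _ (hsu k)) (by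
      simp only [hconj]
      rw [← κ.algHom_rel, hσrel, map_zero])
  have hψσ : ∀ k, ψ.mapMatrix (univSol κ c k) = j.mapMatrix (σ k) := fun k => by
    rw [mapMatrix_univSol, hψ, hψ', hconj]
  obtain ⟨χ, hχ⟩ := exists_algHom_away_comp_eq (f * b) (evalAt (solAt F₀))
    (isUnit_iff_ne_zero.mpr haF) B'
  have hχ' : ∀ x, χ (algebraMap _ _ x) = evalAt (solAt F₀) x := DFunLike.congr_fun hχ
  have hχj : χ.comp j = χ₀ := by
    refine IsLocalization.algHom_ext (Submonoid.powers f) ?_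
    ext x
    change χ (j (algebraMap _ _ x)) = χ₀ (algebraMap _ _ x)
    rw [hj', hχ', hF₀']
  refine ⟨ψ, χ, fun x => ?_, ?_⟩
  · obtain ⟨P, hP⟩ := exists_polyEval x
    rw [hφ.apply_eq_polyEval hP, map_polyEval, funext hψσ, ← map_polyEval, hσ.polyEval_eq f hφ hP,
      hj']
  · have htrue : ∀ k, (χ.comp ψ).mapMatrix (univFrame κ c true k) =
        F₀.mapMatrix (univFrame κ c true k) := fun k => by
      have h1 : (χ.comp ψ).mapMatrix (univFrame κ c true k) =
        χ.mapMatrix (ψ.mapMatrix (univFrame κ c true k)) := rfl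
      have h2 : χ.mapMatrix (j.mapMatrix (s k)) = (χ.comp j).mapMatrix (s k) := rfl
      rw [h1, hψ, h2, hχj, hsF]
    refine frameRing_hom_ext fun b k => ?_
    cases b with
    | true => exact htrue k
    | false =>
      have h1 := mapMatrix_univFrame_mul (χ.comp ψ) k
      rw [htrue] at h1
      exact left_inv_eq_right_inv (mul_eq_one_comm.mp h1) (mapMatrix_univFrame_mul F₀ k)

end IsSlice

end

/-- Near each point of the quotient the framed solutions have a section over the quotient. -/
theorem exists_section [IsReduced (FrameRing κ c)]
    {φ : InvRing (solSet κ c) →ₐ[ℂ] FrameRing κ c} (hφ : IsPullback φ)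
    (h₀ : IsSimpleEigenvalue c k₀ i₀) (hgen : κ.Generic c k₀ i₀)
    (I : Ideal (InvRing (solSet κ c))) [hI : I.IsMaximal] :
    ∃ (F₀ : FrameRing κ c →ₐ[ℂ] ℂ) (a : InvRing (solSet κ c))
      (ψ : FrameRing κ c →ₐ[ℂ] Localization.Away a) (χ : Localization.Away a →ₐ[ℂ] ℂ),
      (∀ x ∈ I, evalAt (solAt F₀) x = 0) ∧ evalAt (solAt F₀) a ≠ 0 ∧
      (∀ x, ψ (φ x) = algebraMap _ _ x) ∧ χ.comp ψ = F₀ ∧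
      ∀ F : FrameRing κ c →ₐ[ℂ] DualNumber ℂ,
        (∀ x, F (φ x) = algebraMap ℂ (DualNumber ℂ) (evalAt (solAt F₀) x)) →
        ∃ W : Matrix (Fin N) (Fin N) (DualNumber ℂ), IsUnit W.det ∧
          ∀ k, pointSol F k * W = W * (Algebra.ofId ℂ (DualNumber ℂ)).mapMatrix (pointSol F₀ k) := by
  let := Ideal.Quotient.field I
  -- The residue field of `I` is not known to be `ℂ`, since the invariant ring is not known to be
  -- finitely generated; the localization is, and gives the complex point `χ₀`.
  obtain ⟨y, w, hyw⟩ := exists_det_gram_ne_zero h₀ hgen (Ideal.Quotient.mkₐ ℂ I)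
  obtain ⟨σ, hσ⟩ := exists_isSlice
    (B := Localization.Away (gram (lineForm c κ k₀ i₀) y w 1).det) hφ h₀ y w
    (IsLocalization.Away.algebraMap_isUnit _)
  generalize (gram (lineForm c κ k₀ i₀) y w 1).det = f at hyw σ hσ
  have hft := hσ.finiteType f hφ
  obtain ⟨χ₀, hχ₀⟩ : ∃ χ₀ : Localization.Away f →ₐ[ℂ] ℂ, ∀ x ∈ I, χ₀ (algebraMap _ _ x) = 0 := by
    obtain ⟨τ, hτ⟩ := exists_algHom_away_comp_eq f (Ideal.Quotient.mkₐ ℂ I)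
      (isUnit_iff_ne_zero.mpr hyw) (Localization.Away f)
    obtain ⟨J, hJ, hle⟩ := Ideal.exists_le_maximal (RingHom.ker τ) (RingHom.ker_ne_top _)
    obtain ⟨χ₀, hχ₀⟩ := exists_algHom_of_isMaximal J
    refine ⟨χ₀, fun x hx => (hχ₀ _).mpr (hle ?_)⟩
    rw [RingHom.mem_ker]
    have h1 := DFunLike.congr_fun hτ x
    exact h1.trans (Ideal.Quotient.eq_zero_iff_mem.mpr hx)
  obtain ⟨F₀, hF₀, hF₀'⟩ := hσ.exists_frame f hφ χ₀
  obtain ⟨a, haF, h⟩ := hσ.exists_hom f hφ χ₀ F₀ hF₀ hF₀'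
  obtain ⟨ψ, χ, hψ, hχ⟩ := h (Localization.Away a)
  refine ⟨F₀, a, ψ, χ, fun x hx => by rw [← hF₀', hχ₀ x hx], haF, hψ, hχ, fun F hF => ?_⟩
  obtain ⟨W, hW, h1⟩ := hσ F ((Algebra.ofId ℂ (DualNumber ℂ)).comp χ₀) fun x => by
    rw [hF, AlgHom.comp_apply, hF₀', Algebra.ofId_apply]
  refine ⟨W, hW, fun k => ?_⟩
  rw [h1, hF₀]
  rfl

end DeligneSimpson
end

open scoped Kronecker TensorProduct

noncomputable section

namespace DeligneSimpson

open Matrix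

variable {m N : ℕ} {κ : RelKind} {c : Fin m → Fin N → ℂ}

/-! ### First-order deformations and the tangent space of framed solutions. -/

section DualNumber

/-- Constant matrices over the dual numbers. -/
abbrev dualConst : Matrix (Fin N) (Fin N) ℂ →ₐ[ℂ] Matrix (Fin N) (Fin N) (DualNumber ℂ) :=
  (Algebra.ofId ℂ (DualNumber ℂ)).mapMatrix

local notation "ε" => (DualNumber.eps : DualNumber ℂ)

@[simp] theorem fst_algebraMap_dualNumber (z : ℂ) : (algebraMap ℂ (DualNumber ℂ) z).fst = z := rfl

@[simp] theorem snd_algebraMap_dualNumber (z : ℂ) : (algebraMap ℂ (DualNumber ℂ) z).snd = 0 := rfl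

theorem dualConst_add_smul_eq_zero {A B : Matrix (Fin N) (Fin N) ℂ}
    (h : dualConst A + ε • dualConst B = 0) : A = 0 ∧ B = 0 := by
  have h1 : ∀ i j, algebraMap ℂ (DualNumber ℂ) (A i j) + ε * algebraMap ℂ _ (B i j) = 0 :=
    fun i j => congrFun (congrFun h i) j
  constructor
  · ext i j
    simpa using congrArg TrivSqZeroExt.fst (h1 i j)
  · ext i j
    simpa using congrArg TrivSqZeroExt.snd (h1 i j)

theorem exists_dualConst_add_smul (W : Matrix (Fin N) (Fin N) (DualNumber ℂ)) :
    ∃ A B : Matrix (Fin N) (Fin N) ℂ, W = dualConst A + ε • dualConst B := by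
  refine ⟨W.map TrivSqZeroExt.fst, W.map TrivSqZeroExt.snd, ?_⟩
  ext i j
  · simp [Algebra.ofId_apply]
  · simp [Algebra.ofId_apply]

theorem eps_smul_mul_eps_smul (A B : Matrix (Fin N) (Fin N) (DualNumber ℂ)) :
    (ε • A) * (ε • B) = 0 := by
  rw [smul_mul_smul_comm, DualNumber.eps_mul_eps, zero_smul]

theorem one_add_eps_smul_mul (A : Matrix (Fin N) (Fin N) (DualNumber ℂ)) :
    (1 + ε • A) * (1 - ε • A) = 1 := by
  have := eps_smul_mul_eps_smul A A
  generalize ε • A = E at this ⊢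
  calc (1 + E) * (1 - E) = 1 - E * E := by noncomm_ring
    _ = 1 := by rw [this, sub_zero]

theorem conj_one_add_eps_smul (A X : Matrix (Fin N) (Fin N) (DualNumber ℂ)) :
    (1 + ε • A) * X * (1 - ε • A) = X + ε • (A * X - X * A) := by
  have h1 := eps_smul_mul_eps_smul (A * X) A
  have h2 : (ε • A) * X * (ε • A) = 0 := by rw [smul_mul_assoc, h1]
  rw [smul_sub, ← smul_mul_assoc, ← mul_smul_comm]
  generalize ε • A = E at h2 ⊢
  calc (1 + E) * X * (1 - E) = X + (E * X - X * E) - E * X * E := by noncomm_ring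
    _ = X + (E * X - X * E) := by rw [h2, sub_zero]

end DualNumber

section Tangent

local notation "ε" => (DualNumber.eps : DualNumber ℂ)

variable (F₀ : FrameRing κ c →ₐ[ℂ] ℂ)

/-- The logarithmic derivatives of the frames in the direction of a point derivation. -/
def logDeriv : pointDerivation F₀ →ₗ[ℂ] (Fin m → Matrix (Fin N) (Fin N) ℂ) where
  toFun D k := (univFrame κ c true k).map D.1 * F₀.mapMatrix (univFrame κ c false k)
  map_add' D E := by
    ext1 k
    rw [Pi.add_apply, ← Matrix.add_mul]
    congr 1
  map_smul' r D := by
    ext1 k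
    rw [Pi.smul_apply, RingHom.id_apply, ← Matrix.smul_mul]
    congr 1

variable {F₀}

theorem mapMatrix_toDualNumber (D : pointDerivation F₀)
    (M : Matrix (Fin N) (Fin N) (FrameRing κ c)) :
    (toDualNumber D.2).mapMatrix M = dualConst (F₀.mapMatrix M) + ε • dualConst (M.map D.1) := by
  ext i j
  · simp [Algebra.ofId_apply]
  · simp [Algebra.ofId_apply]

theorem mapMatrix_univFrame_true (D : pointDerivation F₀) (k : Fin m) :
    (toDualNumber D.2).mapMatrix (univFrame κ c true k) =
      (1 + ε • dualConst (logDeriv F₀ D k)) * dualConst (F₀.mapMatrix (univFrame κ c true k)) := by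
  have h1 : (univFrame κ c true k).map D.1 =
      logDeriv F₀ D k * F₀.mapMatrix (univFrame κ c true k) := by
    change _ = (univFrame κ c true k).map D.1 * F₀.mapMatrix (univFrame κ c false k) * _
    rw [mul_assoc, mul_eq_one_comm.mp (mapMatrix_univFrame_mul F₀ k), mul_one]
  rw [mapMatrix_toDualNumber, h1, map_mul, add_mul, one_mul, smul_mul_assoc]

theorem mapMatrix_univFrame_false (D : pointDerivation F₀) (k : Fin m) :
    (toDualNumber D.2).mapMatrix (univFrame κ c false k) =
      dualConst (F₀.mapMatrix (univFrame κ c false k)) * (1 - ε • dualConst (logDeriv F₀ D k)) := by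
  refine left_inv_eq_right_inv
    (mul_eq_one_comm.mp (mapMatrix_univFrame_mul (toDualNumber D.2) k)) ?_
  rw [mapMatrix_univFrame_true, mul_assoc, ← mul_assoc (dualConst _), ← map_mul,
    mapMatrix_univFrame_mul, map_one, one_mul, one_add_eps_smul_mul]

theorem pointSol_toDualNumber (D : pointDerivation F₀) (k : Fin m) :
    pointSol (toDualNumber D.2) k = (1 + ε • dualConst (logDeriv F₀ D k)) *
      dualConst (pointSol F₀ k) * (1 - ε • dualConst (logDeriv F₀ D k)) := by
  rw [pointSol, mapMatrix_univSol, mapMatrix_univFrame_true, mapMatrix_univFrame_false, pointSol,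
    mapMatrix_univSol, map_mul, map_mul, mapMatrix_diagMat]
  simp only [mul_assoc]

theorem logDeriv_injective : Function.Injective (logDeriv F₀) := by
  rw [injective_iff_map_eq_zero]
  intro D hD
  have hD' : ∀ k, logDeriv F₀ D k = 0 := fun k => congrFun hD k
  have h1 : toDualNumber D.2 = (Algebra.ofId ℂ (DualNumber ℂ)).comp F₀ := by
    refine frameRing_hom_ext fun b k => ?_
    have h2 : ((Algebra.ofId ℂ (DualNumber ℂ)).comp F₀).mapMatrix (univFrame κ c b k) =
      dualConst (F₀.mapMatrix (univFrame κ c b k)) := rfl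
    rw [h2]
    cases b
    · rw [mapMatrix_univFrame_false, hD', map_zero, smul_zero, sub_zero, mul_one]
    · rw [mapMatrix_univFrame_true, hD', map_zero, smul_zero, add_zero, one_mul]
  ext x
  have h3 := congrArg TrivSqZeroExt.snd (DFunLike.congr_fun h1 x)
  rw [snd_toDualNumber] at h3
  rw [h3]
  simp [Algebra.ofId_apply]

theorem rel_conj_dualConst (X η : Fin m → Matrix (Fin N) (Fin N) ℂ) (hX : κ.rel X = 0) :
    κ.rel (fun k => (1 + ε • dualConst (η k)) * dualConst (X k) * (1 - ε • dualConst (η k))) =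
      ε • dualConst (κ.conjDeriv ℂ X η) := by
  rw [κ.rel_conj_one_add (DualNumber ℂ) (fun k => dualConst (X k)) (fun k => ε • dualConst (η k)),
    ← κ.algHom_rel, hX, map_zero, zero_add]
  · have h1 : (fun k => ε • dualConst (η k)) = ε • fun k => dualConst (η k) := rfl
    rw [h1, map_smul, κ.algHom_conjDeriv]
  · intro k l y
    rw [smul_mul_assoc, eps_smul_mul_eps_smul]

/-- A frame over the dual numbers above `F₀` is `1 + ε η` times the frame of `F₀`, and the relation
becomes the vanishing of its linearization at `η`. -/
theorem range_logDeriv : LinearMap.range (logDeriv F₀) = LinearMap.ker (κ.conjDeriv ℂ (pointSol F₀)) := by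
  have hX : κ.rel (pointSol F₀) = 0 := rel_mapMatrix_univSol F₀
  ext η
  constructor
  · rintro ⟨D, rfl⟩
    have h1 : κ.rel (pointSol (toDualNumber D.2)) = 0 := rel_mapMatrix_univSol _
    rw [funext (pointSol_toDualNumber D), rel_conj_dualConst _ _ hX] at h1
    refine (dualConst_add_smul_eq_zero (A := 0) ?_).2
    rw [map_zero, zero_add, h1]
  · intro hη
    rw [LinearMap.mem_ker] at hη
    obtain ⟨F, hF, -⟩ := exists_frameRing_hom (κ := κ) (c := c)
      (fun k => (1 + ε • dualConst (η k)) * dualConst (F₀.mapMatrix (univFrame κ c true k)))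
      (fun k => dualConst (F₀.mapMatrix (univFrame κ c false k)) * (1 - ε • dualConst (η k)))
      (fun k => by
        rw [mul_assoc, ← mul_assoc (dualConst _), ← map_mul, mapMatrix_univFrame_mul, map_one,
          one_mul, one_add_eps_smul_mul])
      (by
        have h1 := rel_conj_dualConst (κ := κ) _ η hX
        rw [hη, map_zero, smul_zero] at h1
        rw [← h1]
        congr 1
        ext1 k
        rw [pointSol, mapMatrix_univSol, map_mul, map_mul, mapMatrix_diagMat]
        simp only [mul_assoc])
    have hfst : (TrivSqZeroExt.fstHom ℂ ℂ ℂ).comp F = F₀ := by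
      have h0 : ∀ M : Matrix (Fin N) (Fin N) ℂ,
          (TrivSqZeroExt.fstHom ℂ ℂ ℂ).mapMatrix (dualConst M) = M := fun M => by
        ext i j
        simp [Algebra.ofId_apply]
      have h1 : ∀ M : Matrix (Fin N) (Fin N) (DualNumber ℂ),
          (TrivSqZeroExt.fstHom ℂ ℂ ℂ).mapMatrix (ε • M) = 0 := fun M => by
        ext i j
        simp
      have htrue : ∀ k, ((TrivSqZeroExt.fstHom ℂ ℂ ℂ).comp F).mapMatrix (univFrame κ c true k) =
          F₀.mapMatrix (univFrame κ c true k) := fun k => by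
        have h2 : ((TrivSqZeroExt.fstHom ℂ ℂ ℂ).comp F).mapMatrix (univFrame κ c true k) =
          (TrivSqZeroExt.fstHom ℂ ℂ ℂ).mapMatrix (F.mapMatrix (univFrame κ c true k)) := rfl
        rw [h2, hF, map_mul, map_add, map_one, h1, h0, add_zero, one_mul]
      refine frameRing_hom_ext fun b k => ?_
      cases b with
      | true => exact htrue k
      | false =>
        have h3 := mapMatrix_univFrame_mul ((TrivSqZeroExt.fstHom ℂ ℂ ℂ).comp F) k
        rw [htrue] at h3
        exact left_inv_eq_right_inv (mul_eq_one_comm.mp h3) (mapMatrix_univFrame_mul F₀ k)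
    have hfst' : ∀ x, (F x).fst = F₀ x := DFunLike.congr_fun hfst
    refine ⟨⟨sndPart F, sndPart_mem hfst'⟩, funext fun k => ?_⟩
    have h1 : (univFrame κ c true k).map (sndPart F) =
        η k * F₀.mapMatrix (univFrame κ c true k) := by
      have h2 : F.mapMatrix (univFrame κ c true k) =
          dualConst (F₀.mapMatrix (univFrame κ c true k)) +
            ε • dualConst ((univFrame κ c true k).map (sndPart F)) := by
        ext i j
        · simp [Algebra.ofId_apply, hfst']
        · simp [Algebra.ofId_apply, sndPart]
      rw [hF, add_mul, one_mul, smul_mul_assoc, ← map_mul] at h2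
      have h3 := add_left_cancel h2
      refine (sub_eq_zero.mp (dualConst_add_smul_eq_zero (A := 0) ?_).2).symm
      rw [map_zero, zero_add, map_sub, smul_sub, h3, sub_self]
    change (univFrame κ c true k).map (sndPart F) * F₀.mapMatrix (univFrame κ c false k) = η k
    rw [h1, mul_assoc, mapMatrix_univFrame_mul, mul_one]

/-- The image of the linearized relation is a complement of the scalars, hence of dimension `N² -
1`. -/
theorem finrank_ker_conjDeriv (hN : 0 < N) (hc : κ.Compat c) (hcent : TrivialCentralizer κ c)
    (F₀ : FrameRing κ c →ₐ[ℂ] ℂ) :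
    Module.finrank ℂ (LinearMap.ker (κ.conjDeriv ℂ (pointSol F₀))) + N ^ 2 = m * N ^ 2 + 1 := by
  set L := κ.conjDeriv ℂ (pointSol F₀)
  have hX : κ.rel (pointSol F₀) = 0 := rel_mapMatrix_univSol F₀
  have h1 := L.finrank_range_add_finrank_ker
  have h2 : IsCompl (LinearMap.range L) (ℂ ∙ (1 : Matrix (Fin N) (Fin N) ℂ)) := by
    constructor
    · rw [Submodule.disjoint_span_singleton]
      rintro ⟨η, hη⟩
      exfalso
      have h3 := rel_conj_dualConst (κ := κ) _ η hX
      have h4 : κ.conjDeriv ℂ (pointSol F₀) η = 1 := hη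
      rw [h4, map_one] at h3
      -- If the identity were in the image, some deformation over the dual numbers would have
      -- relation `ε • 1`; the trace or determinant then forces `ε = 0`.
      have h5 := κ.eq_zero_of_rel_eq_smul hN c hc
        (fun k => (1 + ε • dualConst (η k)) * dualConst (F₀.mapMatrix (univFrame κ c true k)))
        (fun k => dualConst (F₀.mapMatrix (univFrame κ c false k)) * (1 - ε • dualConst (η k)))
        (fun k => mul_eq_one_comm.mp (by
          rw [mul_assoc, ← mul_assoc (dualConst _), ← map_mul, mapMatrix_univFrame_mul, map_one,
            one_mul, one_add_eps_smul_mul])) ε DualNumber.eps_mul_eps (by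
          rw [← h3]
          congr 1
          ext1 k
          rw [pointSol, mapMatrix_univSol, map_mul, map_mul, mapMatrix_diagMat]
          simp only [mul_assoc])
      simpa using congrArg TrivSqZeroExt.snd h5
    · rw [codisjoint_iff, eq_top_iff]
      rintro V -
      obtain ⟨η, s, h⟩ := exists_conjDeriv_add_smul κ hN (pointSol F₀) hX (fun χ Z hZ => by
        refine hcent F₀ Z fun k => ?_
        have h1 := hZ k
        have h2 : χ = AlgHom.id ℂ ℂ := Subsingleton.elim _ _
        rw [h2] at h1
        exact h1) V
      rw [← h]
      exact Submodule.add_mem_sup ⟨η, rfl⟩ (Submodule.mem_span_singleton.mpr ⟨s, rfl⟩)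
  have h3 := Submodule.finrank_add_eq_of_isCompl h2
  have : Nonempty (Fin N) := ⟨⟨0, hN⟩⟩
  rw [finrank_span_singleton one_ne_zero, Module.finrank_matrix] at h3
  rw [Module.finrank_pi_fintype] at h1
  simp only [Module.finrank_matrix, Module.finrank_self, Fintype.card_fin, Finset.sum_const,
    Finset.card_univ, smul_eq_mul, mul_one] at h1 h3
  rw [pow_two]
  omega

end Tangent

end DeligneSimpson
end

open scoped Kronecker TensorProduct

noncomputable section

namespace DeligneSimpson

open Matrix

variable {m N : ℕ} {κ : RelKind} {c : Fin m → Fin N → ℂ} {k₀ : Fin m} {i₀ : Fin N}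

/-! ### Invariance under conjugation over arbitrary algebras. -/

section Conjugation

theorem exists_pointSol_conj {C : Type} [CommRing C] [Algebra ℂ C] (F : FrameRing κ c →ₐ[ℂ] C)
    {W V : Matrix (Fin N) (Fin N) C} (h : W * V = 1) :
    ∃ F₁ : FrameRing κ c →ₐ[ℂ] C, ∀ k, pointSol F₁ k = W * pointSol F k * V := by
  have h' : V * W = 1 := mul_eq_one_comm.mp h
  have hsol : ∀ k, (W * F.mapMatrix (univFrame κ c true k)) * diagMat C (c k) *
      (F.mapMatrix (univFrame κ c false k) * V) = W * pointSol F k * V := fun k => by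
    rw [pointSol, mapMatrix_univSol]
    simp only [mul_assoc]
  obtain ⟨F₁, h1, h2⟩ := exists_frameRing_hom (κ := κ) (c := c)
    (fun k => W * F.mapMatrix (univFrame κ c true k))
    (fun k => F.mapMatrix (univFrame κ c false k) * V)
    (fun k => by rw [mul_assoc, ← mul_assoc _ _ V, mapMatrix_univFrame_mul, one_mul, h])
    (by
      simp only [hsol]
      have h3 := κ.rel_conj (pointSol F) (⟨W, V, h, h'⟩ : (Matrix (Fin N) (Fin N) C)ˣ)
      have h4 : κ.rel (pointSol F) = 0 := rel_mapMatrix_univSol F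
      rw [h4, mul_zero, zero_mul] at h3
      exact h3)
  exact ⟨F₁, fun k => by rw [pointSol, mapMatrix_univSol, h1, h2, hsol]⟩

/-- Polynomials that represent invariant functions are invariant over every algebra. -/
theorem polyEval_conj {a : InvRing (solSet κ c)} {P : MvPolynomial (Fin m × Fin N × Fin N) ℂ}
    (hP : ∀ X : solSet κ c, evalAt X a = polyEval X.1 P) (F : FrameRing κ c →ₐ[ℂ] ℂ) {C : Type}
    [CommRing C] [Algebra ℂ C] {W V : Matrix (Fin N) (Fin N) C} (h : W * V = 1) :
    polyEval (fun k => W * (Algebra.ofId ℂ C).mapMatrix (pointSol F k) * V) P =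
      algebraMap ℂ C (evalAt (solAt F) a) := by
  -- The identity is proved for the universal invertible matrix, over the reduced coordinate ring of
  -- `GL_N` where complex points suffice, and then specialized to `W`.
  let g : Matrix (Fin N) (Fin N) (MvPolynomial (Fin N × Fin N) ℂ) :=
    mvPolynomialX (Fin N) (Fin N) ℂ
  let R := Localization.Away g.det
  have hR : IsReduced R := inferInstance
  have hft : Algebra.FiniteType ℂ R :=
    .trans (inferInstanceAs (Algebra.FiniteType ℂ (MvPolynomial (Fin N × Fin N) ℂ)))
      (IsLocalization.finiteType_of_monoid_fg (Submonoid.powers g.det) R)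
  let π : MvPolynomial (Fin N × Fin N) ℂ →ₐ[ℂ] R := IsScalarTower.toAlgHom ℂ _ R
  have hu : IsUnit (π.mapMatrix g).det := by
    rw [← AlgHom.map_det]
    exact IsLocalization.Away.algebraMap_isUnit g.det
  have hmap : ∀ {C C' : Type} [CommRing C] [Algebra ℂ C] [CommRing C'] [Algebra ℂ C']
      (χ : C →ₐ[ℂ] C') (W V : Matrix (Fin N) (Fin N) C),
      χ (polyEval (fun k => W * (Algebra.ofId ℂ C).mapMatrix (pointSol F k) * V) P) =
      polyEval (fun k => χ.mapMatrix W * (Algebra.ofId ℂ C').mapMatrix (pointSol F k) *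
        χ.mapMatrix V) P := by
    intro C C' _ _ _ _ χ W V
    have h1 : ∀ M : Matrix (Fin N) (Fin N) ℂ, χ.mapMatrix ((Algebra.ofId ℂ C).mapMatrix M) =
        (Algebra.ofId ℂ C').mapMatrix M := fun M => by
      ext i j
      simp [Algebra.ofId_apply]
    simp only [map_polyEval, map_mul, h1]
  have huniv : polyEval (fun k => π.mapMatrix g * (Algebra.ofId ℂ R).mapMatrix (pointSol F k) *
      (π.mapMatrix g)⁻¹) P = algebraMap ℂ R (evalAt (solAt F) a) := by
    rw [← sub_eq_zero]
    refine eq_zero_of_forall_algHom _ fun χ => ?_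
    have h2 : χ.mapMatrix (π.mapMatrix g) * χ.mapMatrix (π.mapMatrix g)⁻¹ = 1 := by
      rw [← map_mul, mul_nonsing_inv _ hu, map_one]
    obtain ⟨F₁, hF₁⟩ := exists_pointSol_conj F h2
    have h3 : evalAt (solAt F₁) a = evalAt (solAt F) a := by
      refine evalAt_conj a (solAt F) (solAt F₁) (χ.mapMatrix (π.mapMatrix g)) ?_ fun k => ?_
      · rw [← AlgHom.map_det]
        exact hu.map χ
      · have h4 := hF₁ k
        change pointSol F₁ k * _ = _ * pointSol F k
        rw [h4, mul_assoc, mul_eq_one_comm.mp h2, mul_one]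
    rw [map_sub, AlgHom.commutes, ← h3, hP, hmap, sub_eq_zero]
    change _ = polyEval (pointSol F₁) P
    rw [funext hF₁]
    rfl
  have hW : IsUnit W.det := isUnit_det_of_right_inverse h
  obtain ⟨τ, hτ⟩ := exists_algHom_away_comp_eq g.det
    (MvPolynomial.aeval (R := ℂ) fun i : Fin N × Fin N => W i.1 i.2) (by
      rw [AlgHom.map_det]
      have : (MvPolynomial.aeval (R := ℂ) fun i : Fin N × Fin N => W i.1 i.2).mapMatrix g = W := by
        ext i j
        simp [g]
      rwa [this]) R
  have hτg : τ.mapMatrix (π.mapMatrix g) = W := by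
    ext i j
    have h1 := DFunLike.congr_fun hτ (g i j)
    refine Eq.trans h1 ?_
    simp [g]
  have hτg' : τ.mapMatrix (π.mapMatrix g)⁻¹ = V := by
    refine left_inv_eq_right_inv (a := W) ?_ h
    rw [← hτg, ← map_mul, nonsing_inv_mul _ hu, map_one]
  have h5 := congrArg τ huniv
  rwa [hmap, hτg, hτg', AlgHom.commutes] at h5

end Conjugation

/-! ### Dimensions of centralizers and of the gauge directions. -/

section Commutant

/-- The matrices that commute with a given matrix. -/
def commutant (X : Matrix (Fin N) (Fin N) ℂ) : Submodule ℂ (Matrix (Fin N) (Fin N) ℂ) where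
  carrier := {Z | Z * X = X * Z}
  add_mem' hA hB := by
    rw [Set.mem_ofPred_eq] at *
    rw [Matrix.add_mul, Matrix.mul_add, hA, hB]
  zero_mem' := by simp
  smul_mem' r A hA := by
    rw [Set.mem_ofPred_eq] at *
    rw [smul_mul_assoc, hA, mul_smul_comm]

theorem mem_commutant {X Z : Matrix (Fin N) (Fin N) ℂ} : Z ∈ commutant X ↔ Z * X = X * Z := Iff.rfl

/-- The number of pairs of indices with equal values. -/
def pairCount (d : Fin N → ℂ) : ℕ := Fintype.card {p : Fin N × Fin N // d p.1 = d p.2}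

/-- In the eigenbasis, the commuting matrices are those supported at pairs of indices with equal
eigenvalues. -/
theorem finrank_commutant (d : Fin N → ℂ) {G H : Matrix (Fin N) (Fin N) ℂ} (hGH : G * H = 1) :
    Module.finrank ℂ (commutant (G * diagMat ℂ d * H)) = pairCount d := by
  have hHG : H * G = 1 := mul_eq_one_comm.mp hGH
  have hmem : ∀ Z, Z ∈ commutant (G * diagMat ℂ d * H) ↔
      ∀ i j, (H * Z * G) i j ≠ 0 → d i = d j := by
    intro Z
    have h1 : Z ∈ commutant (G * diagMat ℂ d * H) ↔
        (H * Z * G) * diagMat ℂ d = diagMat ℂ d * (H * Z * G) := by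
      rw [mem_commutant]
      constructor
      · intro h
        calc _ = H * (Z * (G * diagMat ℂ d * H)) * G := by
              simp only [mul_assoc, hHG, mul_one]
          _ = H * G * diagMat ℂ d * H * Z * G := by rw [h]; simp only [mul_assoc]
          _ = _ := by rw [hHG, one_mul]; simp only [mul_assoc]
      · intro h
        calc _ = (G * H) * Z * G * diagMat ℂ d * H := by
              rw [hGH, one_mul]; simp only [mul_assoc]
          _ = G * (H * Z * G * diagMat ℂ d) * H := by simp only [mul_assoc]
          _ = _ := by rw [h]; simp only [mul_assoc, hGH, mul_one]
    rw [h1, ← Matrix.ext_iff]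
    refine forall_congr' fun i => forall_congr' fun j => ?_
    rw [diagMat, mul_diagonal, diagonal_mul, mul_comm, mul_eq_mul_right_iff, ne_eq,
      or_iff_not_imp_right]
    exact imp_congr Iff.rfl ⟨fun h => h.symm, fun h => h.symm⟩
  let E : commutant (G * diagMat ℂ d * H) →ₗ[ℂ] ({p : Fin N × Fin N // d p.1 = d p.2} → ℂ) :=
    { toFun := fun Z p => (H * Z.1 * G) p.1.1 p.1.2
      map_add' := fun A B => by
        ext p
        simp [mul_add, add_mul]
      map_smul' := fun r A => by
        ext p
        simp }
  have hbij : Function.Bijective E := by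
    constructor
    · rw [injective_iff_map_eq_zero]
      rintro ⟨Z, hZ'⟩ hZ
      have h1 : H * Z * G = 0 := by
        ext i j
        by_contra hne
        exact hne (congrFun hZ ⟨(i, j), (hmem Z).mp hZ' i j hne⟩)
      apply Subtype.ext
      change Z = 0
      calc Z = G * (H * Z * G) * H := by
            rw [← mul_assoc, ← mul_assoc, hGH, one_mul, mul_assoc, hGH, mul_one]
        _ = 0 := by rw [h1, mul_zero, zero_mul]
    · intro v
      classical
      let V : Matrix (Fin N) (Fin N) ℂ := of fun i j => if h : d i = d j then v ⟨(i, j), h⟩ else 0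
      have hV : H * (G * V * H) * G = V := by
        rw [← mul_assoc, ← mul_assoc, hHG, one_mul, mul_assoc, hHG, mul_one]
      refine ⟨⟨G * V * H, (hmem _).mpr fun i j hij => ?_⟩, ?_⟩
      · rw [hV] at hij
        by_contra hne
        exact hij (dif_neg hne)
      · ext p
        change (H * (G * V * H) * G) p.1.1 p.1.2 = v p
        rw [hV]
        exact dif_pos p.2
  rw [(LinearEquiv.ofBijective E hbij).finrank_eq, Module.finrank_fintype_fun_eq_card, pairCount]

/-- Infinitesimal changes of frames that change a tuple of matrices by a simultaneous infinitesimal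
conjugation. -/
def gaugeMap (X : Fin m → Matrix (Fin N) (Fin N) ℂ) :
    (Matrix (Fin N) (Fin N) ℂ × ∀ k, commutant (X k)) →ₗ[ℂ] (Fin m → Matrix (Fin N) (Fin N) ℂ) where
  toFun p k := p.1 + p.2 k
  map_add' p q := by
    ext1 k
    simp only [Prod.fst_add, Prod.snd_add, Pi.add_apply, Submodule.coe_add]
    abel
  map_smul' r p := by
    ext1 k
    simp

theorem mem_range_gaugeMap {X η : Fin m → Matrix (Fin N) (Fin N) ℂ} :
    η ∈ LinearMap.range (gaugeMap X) ↔ ∃ ξ, ∀ k, η k - ξ ∈ commutant (X k) := by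
  constructor
  · rintro ⟨⟨ξ, ζ⟩, rfl⟩
    refine ⟨ξ, fun k => ?_⟩
    have : gaugeMap X (ξ, ζ) k - ξ = ζ k := add_sub_cancel_left _ _
    rw [this]
    exact (ζ k).2
  · rintro ⟨ξ, h⟩
    exact ⟨(ξ, fun k => ⟨η k - ξ, h k⟩), funext fun k => add_sub_cancel _ _⟩

/-- A conjugation direction cancelled by changes of eigenbases commutes with every matrix, so it is
scalar; the kernel is a line. -/
theorem finrank_range_gaugeMap (hN : 0 < N) (hcent : TrivialCentralizer κ c)
    (F : FrameRing κ c →ₐ[ℂ] ℂ) :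
    Module.finrank ℂ (LinearMap.range (gaugeMap (pointSol F))) + 1 =
      N ^ 2 + ∑ k, pairCount (c k) := by
  have h1 := (gaugeMap (pointSol F)).finrank_range_add_finrank_ker
  have h2 : ∀ k, Module.finrank ℂ (commutant (pointSol F k)) = pairCount (c k) := fun k => by
    rw [← finrank_commutant (c k) (mapMatrix_univFrame_mul F k), pointSol, mapMatrix_univSol]
  rw [Module.finrank_prod, Module.finrank_pi_fintype, Module.finrank_matrix] at h1
  simp only [h2, Module.finrank_self, Fintype.card_fin, mul_one] at h1
  rw [pow_two, ← h1]
  congr 1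
  let v : Matrix (Fin N) (Fin N) ℂ × ∀ k, commutant (pointSol F k) :=
    (1, fun k => ⟨-1, by rw [mem_commutant]; simp⟩)
  have : Nonempty (Fin N) := ⟨⟨0, hN⟩⟩
  have hv : v ≠ 0 := fun h => one_ne_zero (congrArg Prod.fst h)
  have hker : LinearMap.ker (gaugeMap (pointSol F)) = ℂ ∙ v := by
    ext p
    rw [LinearMap.mem_ker, Submodule.mem_span_singleton]
    constructor
    · intro hp
      have h3 : ∀ k, ((p.2 k : commutant (pointSol F k)) : Matrix (Fin N) (Fin N) ℂ) = -p.1 :=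
        fun k => (neg_eq_of_add_eq_zero_right (congrFun hp k)).symm
      obtain ⟨z, hz⟩ := hcent F p.1 fun k => by
        have h4 := (p.2 k).2
        rw [mem_commutant, h3, neg_mul, mul_neg, neg_inj] at h4
        exact h4
      refine ⟨z, Prod.ext hz.symm (funext fun k => Subtype.ext ?_)⟩
      rw [h3, hz]
      change z • (-1 : Matrix (Fin N) (Fin N) ℂ) = _
      rw [smul_neg]
    · rintro ⟨z, rfl⟩
      rw [map_smul]
      have : gaugeMap (pointSol F) v = 0 := by
        ext1 k
        exact add_neg_cancel (1 : Matrix (Fin N) (Fin N) ℂ)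
      rw [this, smul_zero]
  rw [hker, finrank_span_singleton hv]

end Commutant

/-! ### The dimension of the quotient. -/

section Dimension

local notation "ε" => (DualNumber.eps : DualNumber ℂ)

variable {φ : InvRing (solSet κ c) →ₐ[ℂ] FrameRing κ c}

/-- The gauge directions are those along which all invariant functions are constant. -/
theorem map_ker_pointDerivationComap [IsReduced (FrameRing κ c)] (hφ : IsPullback φ)
    (hN : 0 < N) (hcent : TrivialCentralizer κ c) (F₀ : FrameRing κ c →ₐ[ℂ] ℂ)
    (hF₀ : ∀ F : FrameRing κ c →ₐ[ℂ] DualNumber ℂ,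
      (∀ x, F (φ x) = algebraMap ℂ (DualNumber ℂ) (evalAt (solAt F₀) x)) →
      ∃ W : Matrix (Fin N) (Fin N) (DualNumber ℂ), IsUnit W.det ∧
        ∀ k, pointSol F k * W = W * (Algebra.ofId ℂ (DualNumber ℂ)).mapMatrix (pointSol F₀ k)) :
    (LinearMap.ker (pointDerivationComap φ F₀)).map (logDeriv F₀) =
      LinearMap.range (gaugeMap (pointSol F₀)) := by
  have hX : κ.rel (pointSol F₀) = 0 := rel_mapMatrix_univSol F₀
  ext η
  rw [mem_range_gaugeMap]
  constructor
  · rintro ⟨D, hD, rfl⟩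
    have hD' : ∀ x, D.1 (φ x) = 0 := fun x => LinearMap.congr_fun (Subtype.ext_iff.mp hD) x
    obtain ⟨W, hW, h⟩ := hF₀ (toDualNumber D.2) fun x => by
      ext
      · rw [fst_toDualNumber, hφ, fst_algebraMap_dualNumber]
      · rw [snd_toDualNumber, hD', snd_algebraMap_dualNumber]
    obtain ⟨W₀, W₁, rfl⟩ := exists_dualConst_add_smul W
    -- Compare constant terms and coefficients of `ε`. The first makes `W₀` a scalar `z`, nonzero as
    -- `W` is invertible; the second makes the deformation an infinitesimal conjugation, up to the
    -- factor `z`.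
    have h1 : ∀ k, pointSol F₀ k * W₀ - W₀ * pointSol F₀ k = 0 ∧
        (logDeriv F₀ D k * pointSol F₀ k - pointSol F₀ k * logDeriv F₀ D k) * W₀ +
          (pointSol F₀ k * W₁ - W₁ * pointSol F₀ k) = 0 := by
      intro k
      apply dualConst_add_smul_eq_zero
      have h2 := h k
      rw [pointSol_toDualNumber, conj_one_add_eps_smul, ← sub_eq_zero] at h2
      simp only [map_add, map_sub, map_mul] at h2 ⊢
      rw [← h2]
      generalize dualConst (logDeriv F₀ D k) * _ - _ = c'
      generalize dualConst (pointSol F₀ k) = X'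
      simp only [add_mul, mul_add, smul_mul_assoc, mul_smul_comm, smul_add, smul_sub, smul_smul,
        DualNumber.eps_mul_eps, zero_smul]
      abel
    obtain ⟨z, hz⟩ := hcent F₀ W₀ fun k => (sub_eq_zero.mp (h1 k).1).symm
    have hz0 : z ≠ 0 := by
      rintro rfl
      have : Nonempty (Fin N) := ⟨⟨0, hN⟩⟩
      have h2 := hW.map (TrivSqZeroExt.fstHom ℂ ℂ ℂ)
      rw [AlgHom.map_det] at h2
      have h3 : (TrivSqZeroExt.fstHom ℂ ℂ ℂ).mapMatrix (dualConst W₀ + ε • dualConst W₁) = 0 := by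
        rw [hz, zero_smul, map_zero, zero_add]
        ext i j
        simp
      rw [h3, det_zero] at h2
      exact not_isUnit_zero h2
    refine ⟨z⁻¹ • W₁, fun k => ?_⟩
    have h2 := (h1 k).2
    generalize logDeriv F₀ D k = η' at h2 ⊢
    generalize pointSol F₀ k = X' at h2 ⊢
    rw [hz, mul_smul_comm, mul_one] at h2
    have h3 : η' * X' - X' * η' + z⁻¹ • (X' * W₁ - W₁ * X') = 0 := by
      have h4 := congrArg (z⁻¹ • ·) h2
      simpa only [smul_add, smul_smul, inv_mul_cancel₀ hz0, one_smul, smul_zero] using h4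
    rw [mem_commutant, ← sub_eq_zero, ← h3, sub_mul, mul_sub, smul_mul_assoc, mul_smul_comm,
      smul_sub]
    abel
  · rintro ⟨ξ, hξ⟩
    have h1 : ∀ k, η k * pointSol F₀ k - pointSol F₀ k * η k =
        ξ * pointSol F₀ k - pointSol F₀ k * ξ := fun k => by
      have h2 := mem_commutant.mp (hξ k)
      rw [sub_mul, mul_sub, sub_eq_sub_iff_add_eq_add] at h2
      rw [sub_eq_sub_iff_add_eq_add]
      rw [h2, add_comm]
    -- The part of `η k` commuting with the matrix does not move it, so the deformation is
    -- conjugation by the single element `1 + ε ξ`.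
    have hconj : ∀ k, (1 + ε • dualConst (η k)) * dualConst (pointSol F₀ k) *
        (1 - ε • dualConst (η k)) = (1 + ε • dualConst ξ) * dualConst (pointSol F₀ k) *
        (1 - ε • dualConst ξ) := fun k => by
      rw [conj_one_add_eps_smul, conj_one_add_eps_smul]
      simp only [← map_mul, ← map_sub, h1]
    have hη : η ∈ LinearMap.range (logDeriv F₀) := by
      rw [range_logDeriv, LinearMap.mem_ker]
      have h2 := rel_conj_dualConst (κ := κ) _ η hX
      simp only [hconj] at h2
      have h3 := κ.rel_conj (fun k => dualConst (pointSol F₀ k))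
        (⟨1 + ε • dualConst ξ, 1 - ε • dualConst ξ, one_add_eps_smul_mul _,
          mul_eq_one_comm.mp (one_add_eps_smul_mul _)⟩ :
          (Matrix (Fin N) (Fin N) (DualNumber ℂ))ˣ)
      have h4 : κ.rel (fun k => dualConst (pointSol F₀ k)) = 0 := by
        rw [← κ.algHom_rel, hX, map_zero]
      rw [h4, mul_zero, zero_mul] at h3
      refine (dualConst_add_smul_eq_zero (A := 0) ?_).2
      rw [map_zero, zero_add, ← h2]
      exact h3
    obtain ⟨D, rfl⟩ := hη
    refine ⟨D, ?_, rfl⟩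
    refine LinearMap.mem_ker.mpr (Subtype.ext (LinearMap.ext fun a => ?_))
    change D.1 (φ a) = 0
    obtain ⟨P, hP⟩ := exists_polyEval a
    have h2 : toDualNumber D.2 (φ a) = algebraMap ℂ (DualNumber ℂ) (evalAt (solAt F₀) a) := by
      rw [hφ.apply_eq_polyEval hP, map_polyEval,
        ← polyEval_conj hP F₀ (one_add_eps_smul_mul (dualConst ξ))]
      congr 1
      change polyEval (pointSol (toDualNumber D.2)) = _
      rw [funext (pointSol_toDualNumber D), funext hconj]
    rw [← snd_toDualNumber D.2, h2, snd_algebraMap_dualNumber]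

/-- Rank–nullity for the differential of the quotient map: the source has dimension `mN² + 1 - N²`,
the kernel is the space of gauge directions, of dimension `N² + ∑ pairCount (c k) - 1`. -/
theorem finrank_pointDerivation_comp [IsReduced (FrameRing κ c)] (hφ : IsPullback φ)
    (hN : 0 < N) (hc : κ.Compat c) (hcent : TrivialCentralizer κ c)
    {F₀ : FrameRing κ c →ₐ[ℂ] ℂ} {a : InvRing (solSet κ c)}
    {ψ : FrameRing κ c →ₐ[ℂ] Localization.Away a} {χ : Localization.Away a →ₐ[ℂ] ℂ}
    (hψ : ∀ x, ψ (φ x) = algebraMap _ _ x) (hχ : χ.comp ψ = F₀)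
    (hF₀ : ∀ F : FrameRing κ c →ₐ[ℂ] DualNumber ℂ,
      (∀ x, F (φ x) = algebraMap ℂ (DualNumber ℂ) (evalAt (solAt F₀) x)) →
      ∃ W : Matrix (Fin N) (Fin N) (DualNumber ℂ), IsUnit W.det ∧
        ∀ k, pointSol F k * W = W * (Algebra.ofId ℂ (DualNumber ℂ)).mapMatrix (pointSol F₀ k))
    {d : ℕ} (hd : d + 2 * N ^ 2 + ∑ k, pairCount (c k) = m * N ^ 2 + 2) :
    Module.finrank ℂ (pointDerivation (F₀.comp φ)) = d := by
  have hfin : Module.Finite ℂ (pointDerivation F₀) :=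
    Module.Finite.of_injective (logDeriv F₀) logDeriv_injective
  have h1 := finrank_ker_conjDeriv hN hc hcent F₀
  rw [← range_logDeriv, LinearMap.finrank_range_of_inj logDeriv_injective] at h1
  have h2 := finrank_range_gaugeMap hN hcent F₀
  rw [← map_ker_pointDerivationComap hφ hN hcent F₀ hF₀,
    (LinearEquiv.finrank_eq (Submodule.equivMapOfInjective _ logDeriv_injective _)).symm] at h2
  have h3 := (pointDerivationComap φ F₀).finrank_range_add_finrank_ker
  -- The local section `ψ` lifts every tangent vector.
  have hsurj : Function.Surjective (pointDerivationComap φ F₀) := by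
    rintro ⟨D, hD⟩
    have hχ' : ∀ x, χ (algebraMap _ _ x) = F₀ (φ x) := fun x => by rw [← hψ, ← hχ]; rfl
    obtain ⟨⟨D', hD'⟩, h⟩ := (pointDerivationComap_bijective a χ).2
      ⟨D, mem_pointDerivation.mpr fun x y => by
        have := mem_pointDerivation.mp hD x y
        simp only [AlgHom.comp_apply, IsScalarTower.toAlgHom_apply, hχ'] at this ⊢
        exact this⟩
    have h' : ∀ x, D' (algebraMap _ _ x) = D x := LinearMap.congr_fun (Subtype.ext_iff.mp h)
    refine ⟨⟨D' ∘ₗ ψ.toLinearMap, fun x y => ?_⟩, ?_⟩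
    · have := hD' (ψ x) (ψ y)
      rw [← map_mul] at this
      rw [← hχ]
      exact this
    · refine Subtype.ext (LinearMap.ext fun x => ?_)
      change D' (ψ (φ x)) = D x
      rw [hψ, h']
  rw [LinearMap.range_eq_top.mpr hsurj, finrank_top] at h3
  omega

/-- The categorical quotient of the variety of solutions is smooth of the expected dimension. -/
theorem smoothOfRelativeDimension_solSet (hN : 0 < N) (hc : κ.Compat c)
    (h₀ : IsSimpleEigenvalue c k₀ i₀) (hgen : κ.Generic c k₀ i₀) {d : ℕ}
    (hd : d + 2 * N ^ 2 + ∑ k, pairCount (c k) = m * N ^ 2 + 2) :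
    AlgebraicGeometry.SmoothOfRelativeDimension d (quotientByConjToSpec (solSet κ c)) := by
  have hcent := trivialCentralizer h₀ hgen
  have hsm := smooth_frameRing hN hc hcent
  have hred : IsReduced (FrameRing κ c) := isReduced_of_smooth ℂ _
  obtain ⟨φ, hφ⟩ := exists_invRing_hom (κ := κ) (c := c)
  refine smoothOfRelativeDimension_of_forall_maximal d fun I hI => ?_
  obtain ⟨F₀, a, ψ, χ, hI0, ha, hψ, hχ, hF₀⟩ := exists_section hφ h₀ hgen I
  refine ⟨a, fun h => ha (hI0 a h), smooth_away_of_factor a φ ψ hψ, F₀.comp φ, fun x hx => ?_,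
    finrank_pointDerivation_comp hφ hN hc hcent hψ hχ hF₀ hd⟩
  rw [AlgHom.comp_apply, hφ, hI0 x hx]

end Dimension

end DeligneSimpson
end

open scoped Kronecker TensorProduct

noncomputable section

namespace DeligneSimpson

/-! ### Irreducibility of the parameter varieties. -/

section Genericity

variable {σ : Type}

/-- Any two points of the set are joined by an entire curve in the set. -/
def EntirelyConnected (Z : Set (σ → ℂ)) : Prop :=
  ∀ x ∈ Z, ∀ y ∈ Z, ∃ γ : ℂ → σ → ℂ, γ 0 = x ∧ γ 1 = y ∧ (∀ s, γ s ∈ Z) ∧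
    ∀ i, Differentiable ℂ fun s => γ s i

theorem differentiable_eval {γ : ℂ → σ → ℂ} (hγ : ∀ i, Differentiable ℂ fun s => γ s i)
    (p : MvPolynomial σ ℂ) : Differentiable ℂ fun s => MvPolynomial.eval (γ s) p := by
  induction p using MvPolynomial.induction_on with
  | C a => simp
  | add p q hp hq => simpa using hp.fun_add hq
  | mul_X p i hp => simpa using hp.fun_mul (hγ i)

namespace EntirelyConnected

variable {Z : Set (σ → ℂ)}

/-- On an entire curve through a point with `p ≠ 0` and one with `q ≠ 0`, the product of two entire
functions would vanish without either being zero. -/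
theorem eval_eq_zero_or (hZ : EntirelyConnected Z) {p q : MvPolynomial σ ℂ}
    (h : ∀ z ∈ Z, MvPolynomial.eval z (p * q) = 0) :
    (∀ z ∈ Z, MvPolynomial.eval z p = 0) ∨ ∀ z ∈ Z, MvPolynomial.eval z q = 0 := by
  by_contra hcon
  push Not at hcon
  obtain ⟨⟨x, hx, hpx⟩, y, hy, hqy⟩ := hcon
  obtain ⟨γ, rfl, rfl, hγ, hd⟩ := hZ x hx y hy
  have han : ∀ p : MvPolynomial σ ℂ,
      AnalyticOnNhd ℂ (fun s => MvPolynomial.eval (γ s) p) Set.univ :=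
    fun p s _ => (differentiable_eval hd p).analyticAt s
  rcases AnalyticOnNhd.eq_zero_or_eq_zero_of_mul_eq_zero (han p) (han q)
    (fun s _ => by simpa using h _ (hγ s)) isPreconnected_univ with h1 | h1
  · exact hpx (h1 0 trivial)
  · exact hqy (h1 1 trivial)

/-- A finite intersection of nonempty open conditions holds generically. -/
theorem holdsGenerically (hZ : EntirelyConnected Z) (hne : Z.Nonempty) {ι : Type} [Finite ι]
    (p : ι → MvPolynomial σ ℂ) (hp : ∀ s, ∃ z ∈ Z, MvPolynomial.eval z (p s) ≠ 0)
    {P : (σ → ℂ) → Prop} (hP : ∀ z ∈ Z, (∀ s, MvPolynomial.eval z (p s) ≠ 0) → P z) :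
    HoldsGenerically Z P := by
  classical
  have := Fintype.ofFinite ι
  have hprod : ∀ t : Finset ι, ∃ z ∈ Z, MvPolynomial.eval z (∏ s ∈ t, p s) ≠ 0 := by
    intro t
    induction t using Finset.induction_on with
    | empty =>
      obtain ⟨z, hz⟩ := hne
      exact ⟨z, hz, by simp⟩
    | insert s t hs ih =>
      by_contra hcon
      push Not at hcon
      rw [Finset.prod_insert hs] at hcon
      obtain ⟨z₁, hz₁, h₁⟩ := hp s
      obtain ⟨z₂, hz₂, h₂⟩ := ih
      rcases hZ.eval_eq_zero_or hcon with h | h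
      · exact h₁ (h z₁ hz₁)
      · exact h₂ (h z₂ hz₂)
  refine ⟨∏ s, p s, fun g hg => ?_, fun z hz hf => hP z hz fun s hs => hf ?_⟩
  · have h1 : ∀ z ∈ Z, MvPolynomial.eval z ((∏ s, p s) * g) = 0 := fun z hz => by
      rw [map_mul, mul_eq_zero, or_iff_not_imp_left]
      exact hg z hz
    obtain ⟨z, hz, h2⟩ := hprod Finset.univ
    exact (hZ.eval_eq_zero_or h1).resolve_left fun h => h2 (h z hz)
  · rw [map_prod]
    exact Finset.prod_eq_zero (Finset.mem_univ s) hs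

end EntirelyConnected

variable [Fintype σ] (h : σ → ℤ)

/-- The kernel of an integral linear form. -/
def linearLocus : Set (σ → ℂ) := {z | ∑ i, h i * z i = 0}

/-- The kernel of a character of a torus. -/
def torusLocus : Set (σ → ℂ) := {z | (∀ i, z i ≠ 0) ∧ ∏ i, z i ^ h i = 1}

variable {h}

theorem entirelyConnected_linearLocus : EntirelyConnected (linearLocus h) := by
  intro x hx y hy
  refine ⟨fun s i => x i + s * (y i - x i), by simp, by simp, fun s => ?_, fun i => by fun_prop⟩
  have h1 : ∀ i, (h i : ℂ) * (x i + s * (y i - x i)) =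
      (1 - s) * (h i * x i) + s * (h i * y i) := fun i => by ring
  have hx' : ∑ i, h i * x i = 0 := hx
  have hy' : ∑ i, h i * y i = 0 := hy
  change ∑ i, (h i : ℂ) * (x i + s * (y i - x i)) = 0
  simp only [h1, Finset.sum_add_distrib, ← Finset.mul_sum, hx', hy', mul_zero, add_zero]

theorem prod_exp_zpow (μ : σ → ℤ) (α : σ → ℂ) :
    ∏ i, Complex.exp (α i) ^ μ i = Complex.exp (∑ i, μ i * α i) := by
  rw [Complex.exp_sum]
  exact Finset.prod_congr rfl fun i _ => (Complex.exp_int_mul _ _).symm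

theorem exp_mem_torusLocus {α : σ → ℂ} (hα : ∑ i, h i * α i = 0) :
    (fun i => Complex.exp (α i)) ∈ torusLocus h :=
  ⟨fun _ => Complex.exp_ne_zero _, by rw [prod_exp_zpow, hα, Complex.exp_zero]⟩

/-- Logarithms of a point satisfy the linear equation up to a multiple of `2πi`. The coefficient `1`
at `i₀` lets one coordinate absorb it; without such a condition the kernel of the character may be
disconnected. -/
theorem exists_exp_eq {i₀ : σ} (h₀ : h i₀ = 1) {z : σ → ℂ} (hz : z ∈ torusLocus h) :
    ∃ α : σ → ℂ, ∑ i, h i * α i = 0 ∧ ∀ i, Complex.exp (α i) = z i := by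
  classical
  have h1 : ∀ i, Complex.exp (Complex.log (z i)) = z i := fun i => Complex.exp_log (hz.1 i)
  have h2 := prod_exp_zpow h fun i => Complex.log (z i)
  simp only [h1] at h2
  rw [hz.2] at h2
  obtain ⟨n, hn⟩ := Complex.exp_eq_one_iff.mp h2.symm
  have h3 : Complex.exp (n * (2 * Real.pi * Complex.I)) = 1 := Complex.exp_eq_one_iff.mpr ⟨n, rfl⟩
  refine ⟨fun i => Complex.log (z i) - Pi.single (M := fun _ => ℂ) i₀ (n * (2 * Real.pi * Complex.I)) i,
    ?_, fun i => ?_⟩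
  · simp only [mul_sub, Finset.sum_sub_distrib, hn]
    rw [Finset.sum_eq_single i₀]
    · rw [Pi.single_eq_same, h₀, Int.cast_one, one_mul, sub_self]
    · intro j _ hj
      rw [Pi.single_eq_of_ne hj, mul_zero]
    · simp
  · by_cases hi : i = i₀
    · subst hi
      beta_reduce
      rw [Pi.single_eq_same, Complex.exp_sub, h1, h3, div_one]
    · beta_reduce
      rw [Pi.single_eq_of_ne hi, sub_zero, h1]

theorem entirelyConnected_torusLocus {i₀ : σ} (h₀ : h i₀ = 1) :
    EntirelyConnected (torusLocus h) := by
  intro x hx y hy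
  obtain ⟨α, hα, hαx⟩ := exists_exp_eq h₀ hx
  obtain ⟨β, hβ, hβy⟩ := exists_exp_eq h₀ hy
  obtain ⟨γ, hγ0, hγ1, hγ, hd⟩ := entirelyConnected_linearLocus (h := h) α hα β hβ
  refine ⟨fun s i => Complex.exp (γ s i), funext fun i => ?_, funext fun i => ?_,
    fun s => exp_mem_torusLocus (hγ s), fun i => (hd i).cexp⟩
  · beta_reduce
    rw [hγ0, hαx]
  · beta_reduce
    rw [hγ1, hβy]

theorem holdsGenerically_linearLocus {ι : Type} [Finite ι] (l : ι → σ → ℤ)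
    (hl : ∀ s, ∃ z : σ → ℂ, ∑ i, h i * z i = 0 ∧ ∑ i, l s i * z i ≠ 0) {P : (σ → ℂ) → Prop}
    (hP : ∀ z ∈ linearLocus h, (∀ s, ∑ i, l s i * z i ≠ 0) → P z) :
    HoldsGenerically (linearLocus h) P := by
  have heval : ∀ s (z : σ → ℂ), MvPolynomial.eval z (∑ i, MvPolynomial.C (l s i : ℂ) * MvPolynomial.X i) =
      ∑ i, l s i * z i := fun s z => by simp
  refine entirelyConnected_linearLocus.holdsGenerically ⟨0, by simp [linearLocus]⟩
    (fun s => ∑ i, MvPolynomial.C (l s i : ℂ) * MvPolynomial.X i) (fun s => ?_) fun z hz hs => ?_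
  · obtain ⟨z, hz, hz'⟩ := hl s
    exact ⟨z, hz, by rwa [heval]⟩
  · exact hP z hz fun s => by rw [← heval]; exact hs s

theorem prod_zpow_eq_one_iff (l : σ → ℤ) (z : σ → ℂ) (hz : ∀ i, z i ≠ 0) :
    ∏ i, z i ^ l i = 1 ↔ ∏ i, z i ^ (l i).toNat = ∏ i, z i ^ (-l i).toNat := by
  have h1 : ∀ i, z i ^ l i = z i ^ (l i).toNat / z i ^ (-l i).toNat := fun i => by
    conv_lhs => rw [← Int.toNat_sub_toNat_neg (l i)]
    rw [zpow_sub₀ (hz i), zpow_natCast, zpow_natCast]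
  simp only [h1, Finset.prod_div_distrib]
  exact div_eq_one_iff_eq (Finset.prod_ne_zero_iff.mpr fun i _ => pow_ne_zero _ (hz i))

/-- The hypothesis `hl` is the one of the linear case, so the same exponent computation serves both
problems. -/
theorem holdsGenerically_torusLocus {i₀ : σ} (h₀ : h i₀ = 1) {ι : Type} [Finite ι] (l : ι → σ → ℤ)
    (hl : ∀ s, ∃ z : σ → ℂ, ∑ i, h i * z i = 0 ∧ ∑ i, l s i * z i ≠ 0) {P : (σ → ℂ) → Prop}
    (hP : ∀ z ∈ torusLocus h, (∀ s, ∏ i, z i ^ l s i ≠ 1) → P z) :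
    HoldsGenerically (torusLocus h) P := by
  have heval : ∀ s (z : σ → ℂ), (∀ i, z i ≠ 0) → (MvPolynomial.eval z
      (∏ i, MvPolynomial.X i ^ (l s i).toNat - ∏ i, MvPolynomial.X i ^ (-l s i).toNat) ≠ 0 ↔
      ∏ i, z i ^ l s i ≠ 1) := fun s z hz => by
    rw [ne_eq, ne_eq, prod_zpow_eq_one_iff _ _ hz, map_sub, sub_eq_zero]
    simp
  refine (entirelyConnected_torusLocus h₀).holdsGenerically ⟨1, by simp [torusLocus]⟩
    (fun s => ∏ i, MvPolynomial.X i ^ (l s i).toNat - ∏ i, MvPolynomial.X i ^ (-l s i).toNat)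
    (fun s => ?_) fun z hz hs => ?_
  · obtain ⟨z, hz, hz'⟩ := hl s
    -- After scaling by `v⁻¹` and exponentiating, the monomial takes the value `e`, which is not
    -- `1`.
    set v := ∑ i, l s i * z i
    refine ⟨fun i => Complex.exp (v⁻¹ * z i), exp_mem_torusLocus ?_, ?_⟩
    · simp only [mul_left_comm _ v⁻¹, ← Finset.mul_sum, hz, mul_zero]
    · rw [heval _ _ fun i => Complex.exp_ne_zero _, prod_exp_zpow]
      simp only [mul_left_comm _ v⁻¹, ← Finset.mul_sum]
      rw [inv_mul_cancel₀ hz']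
      intro h1
      have h2 := congrArg norm h1
      rw [Complex.norm_exp, norm_one, Complex.one_re] at h2
      exact absurd h2 (Real.one_lt_exp_iff.mpr one_pos).ne'
  · exact hP z hz fun s => (heval s z hz.1).mp (hs s)

end Genericity

end DeligneSimpson
end

open scoped Kronecker TensorProduct

noncomputable section

namespace DeligneSimpson

/-! ### Eigenvalues as monomials or linear forms in the parameters. -/

section Labelling

variable {r : ℕ} {a : Fin (r + 1) → ℕ} {n : ℕ}

/-- A labelling of the indices `0, …, nℓ - 1` by the vertices of each leg, with the right
multiplicities, and a distinguished index with the last label of the last leg. -/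
structure Labelling {r : ℕ} (a : Fin (r + 1) → ℕ) (n : ℕ) where
  /-- The labels for each leg. -/
  lab : ∀ k, Fin (n * ell a) → Fin (legLength a k)
  /-- The distinguished index. -/
  pt : Fin (n * ell a)
  lab_pt : lab (Fin.last r) pt = Fin.last _
  card_lab : ∀ k j, (Finset.univ.filter fun i => lab k i = j).card = n * (ell a / legLength a k)

/-- The linear form `ħ`. -/
def hbarForm {r : ℕ} (a : Fin (r + 1) → ℕ) : ParamIndex a → ℤ
  | none => 0
  | some p => ((ell a / legLength a p.1 : ℕ) : ℤ)

namespace Labelling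

variable (Λ : Labelling a n)

/-- The eigenvalues of `-T`, put at the indices with the last label of the last leg. -/
def weight (k : Fin (r + 1)) (i : Fin (n * ell a)) : ℤ :=
  if k = Fin.last r then
    (if Λ.lab k i = Fin.last (a k) then 1 else 0) - (if i = Λ.pt then (n : ℤ) else 0)
  else 0

/-- The exponents of the parameters in the eigenvalue with index `i` of the `k`-th matrix; `s` is
the scaling of the extra parameter. -/
def form (s : ℤ) (k : Fin (r + 1)) (i : Fin (n * ell a)) : ParamIndex a → ℤ
  | none => s * Λ.weight k i
  | some p => if (⟨k, Λ.lab k i⟩ : (k : Fin (r + 1)) × Fin (legLength a k)) = p then 1 else 0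

theorem form_some_self (s : ℤ) (k : Fin (r + 1)) (i : Fin (n * ell a)) (j : Fin (legLength a k)) :
    Λ.form s k i (some ⟨k, j⟩) = if Λ.lab k i = j then 1 else 0 := by
  simp [form]

theorem sum_form_some (s : ℤ) {ι : Type} [Fintype ι] (e : Fin (r + 1) → ι → Fin (n * ell a))
    (k : Fin (r + 1)) (j : Fin (legLength a k)) :
    ∑ k', ∑ i, Λ.form s k' (e k' i) (some ⟨k, j⟩) =
      ((Finset.univ.filter fun i => Λ.lab k (e k i) = j).card : ℤ) := by
  rw [Finset.sum_eq_single k]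
  · simp only [form_some_self, Finset.sum_boole]
  · intro k' _ hk
    refine Finset.sum_eq_zero fun i _ => if_neg fun h => hk ?_
    exact congrArg Sigma.fst h
  · simp

theorem sum_form_none (s : ℤ) {ι : Type} [Fintype ι] (e : Fin (r + 1) → ι → Fin (n * ell a)) :
    ∑ k, ∑ i, Λ.form s k (e k i) none =
      s * (((Finset.univ.filter fun i => Λ.lab (Fin.last r) (e (Fin.last r) i) = Fin.last _).card : ℤ) -
        n * ((Finset.univ.filter fun i => e (Fin.last r) i = Λ.pt).card : ℤ)) := by
  simp only [form, ← Finset.mul_sum]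
  congr 1
  rw [Finset.sum_eq_single (Fin.last r)]
  · simp only [weight, if_true, Finset.sum_sub_distrib, Finset.sum_boole]
    congr 1
    rw [← Finset.sum_filter, Finset.sum_const, nsmul_eq_mul, mul_comm]
  · intro k _ hk
    exact Finset.sum_eq_zero fun i _ => if_neg hk
  · simp

/-- All eigenvalues together give `n ħ`; the extra parameter cancels because `T` has trace zero.
Hence the compatibility on `ħ = 0` and on `q = 1`. -/
theorem sum_form (s : ℤ) (p : ParamIndex a) :
    ∑ k, ∑ i, Λ.form s k i p = n * hbarForm a p := by
  match p with
  | some ⟨k, j⟩ =>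
    rw [Λ.sum_form_some s (fun _ i => i) k j, Λ.card_lab]
    simp [hbarForm]
  | none =>
    have h1 : (Finset.univ.filter fun i => i = Λ.pt).card = 1 := by
      rw [Finset.card_eq_one]
      exact ⟨Λ.pt, by ext i; simp⟩
    rw [Λ.sum_form_none s (fun _ i => i), Λ.card_lab, h1, Nat.div_self (Nat.succ_pos _)]
    simp [hbarForm]

/-- Two indices for which the eigenvalues of the `k`-th matrix are always equal. -/
def SameClass (k : Fin (r + 1)) (i j : Fin (n * ell a)) : Prop :=
  Λ.lab k i = Λ.lab k j ∧ (k = Fin.last r → (i = Λ.pt ↔ j = Λ.pt))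

/-- The conditions on the parameters: the eigenvalues with different labels are different, and no
proper part of the eigenvalues that contains the distinguished one exactly once is compatible with
the relation. -/
abbrev Cond : Type :=
  {x : Fin (r + 1) × Fin (n * ell a) × Fin (n * ell a) // ¬ Λ.SameClass x.1 x.2.1 x.2.2} ⊕
  {x : (t : Fin (n * ell a)) × (Fin (r + 1) → Fin t → Fin (n * ell a)) //
    (Finset.univ.filter fun i => x.2 (Fin.last r) i = Λ.pt).card = 1}

/-- The exponents of a condition. -/
def condForm (s : ℤ) : Λ.Cond → ParamIndex a → ℤ
  | .inl x => fun p => Λ.form s x.1.1 x.1.2.1 p - Λ.form s x.1.1 x.1.2.2 p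
  | .inr x => fun p => ∑ k, ∑ i, Λ.form s k (x.1.2 k i) p

/-- Test on the coordinate vector of the extra parameter and on differences of two coordinate
vectors of one leg, which lie on `ħ = 0`. -/
theorem eq_of_forall_sum_eq_zero (l : ParamIndex a → ℤ)
    (h : ∀ z : ParamIndex a → ℂ, ∑ p, hbarForm a p * z p = 0 → ∑ p, l p * z p = 0) :
    l none = 0 ∧ ∀ k j j', l (some ⟨k, j⟩) = l (some ⟨k, j'⟩) := by
  have hs : ∀ (l : ParamIndex a → ℤ) (p : ParamIndex a),
      ∑ p', (l p' : ℂ) * Pi.single (M := fun _ => ℂ) p 1 p' = l p := fun l p => by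
    simp [Pi.single_apply]
  constructor
  · have h1 := h (Pi.single none 1) (by rw [hs]; simp [hbarForm])
    rw [hs] at h1
    exact_mod_cast h1
  · intro k j j'
    have h1 := h (Pi.single (some ⟨k, j⟩) 1 - Pi.single (some ⟨k, j'⟩) 1) (by
      simp only [Pi.sub_apply, mul_sub, Finset.sum_sub_distrib, hs]
      simp [hbarForm])
    simp only [Pi.sub_apply, mul_sub, Finset.sum_sub_distrib, hs, sub_eq_zero] at h1
    exact_mod_cast h1

/-- No genericity condition fails identically. For a part of size `t` containing the distinguished
index once, independence of the extra parameter gives `n` indices with the last label, and constancy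
along the last leg gives `n` for each label, so `t = nℓ`. -/
theorem exists_condForm_ne_zero {s : ℤ} (hs : s ≠ 0) (hn : n ≠ 0) (x : Λ.Cond) :
    ∃ z : ParamIndex a → ℂ, ∑ p, hbarForm a p * z p = 0 ∧ ∑ p, Λ.condForm s x p * z p ≠ 0 := by
  by_contra hcon
  push Not at hcon
  obtain ⟨h1, h2⟩ := eq_of_forall_sum_eq_zero (Λ.condForm s x) hcon
  match x with
  | .inl ⟨(k, i, j), hx⟩ =>
    have hlab : Λ.lab k i = Λ.lab k j := by
      by_contra hne
      have h3 := h2 k (Λ.lab k i) (Λ.lab k j)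
      simp only [condForm, form_some_self, if_true, if_neg hne, if_neg (Ne.symm hne)] at h3
      omega
    refine hx ⟨hlab, fun hk => ?_⟩
    subst hk
    simp only [condForm, form, weight, if_true, ← mul_sub, hlab, mul_eq_zero, hs, false_or] at h1
    by_contra hne
    by_cases hi : i = Λ.pt <;> by_cases hj : j = Λ.pt <;> simp [hi, hj] at h1 hne <;> omega
  | .inr ⟨⟨t, e⟩, hx⟩ =>
    simp only [condForm] at h1 h2
    rw [Λ.sum_form_none s e, mul_eq_zero, or_iff_right hs, sub_eq_zero] at h1
    simp only at hx
    rw [hx, Nat.cast_one, mul_one] at h1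
    have h3 : ∀ j, (Finset.univ.filter fun i => Λ.lab (Fin.last r) (e (Fin.last r) i) = j).card = n := by
      intro j
      have h4 := h2 (Fin.last r) j (Fin.last _)
      rw [Λ.sum_form_some, Λ.sum_form_some, h1] at h4
      exact_mod_cast h4
    have h5 := Finset.card_eq_sum_card_fiberwise (s := Finset.univ) (t := Finset.univ)
      (f := fun i => Λ.lab (Fin.last r) (e (Fin.last r) i)) fun _ _ => Finset.mem_coe.mpr (Finset.mem_univ _)
    simp only [h3, Finset.sum_const, Finset.card_univ, Fintype.card_fin, smul_eq_mul] at h5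
    have h6 := t.2
    rw [h5, mul_comm] at h6
    exact lt_irrefl _ h6

/-- The eigenvalues in the additive case. -/
def eigSum (z : ParamIndex a → ℂ) (k : Fin (r + 1)) (i : Fin (n * ell a)) : ℂ :=
  ∑ p, Λ.form 1 k i p * z p

/-- The eigenvalues in the multiplicative case. -/
def eigProd (z : ParamIndex a → ℂ) (k : Fin (r + 1)) (i : Fin (n * ell a)) : ℂ :=
  ∏ p, z p ^ Λ.form (-2) k i p

theorem eigSum_eq (z : ParamIndex a → ℂ) (k : Fin (r + 1)) (i : Fin (n * ell a)) :
    Λ.eigSum z k i = legParam z k (Λ.lab k i) + Λ.weight k i * extraParam z := by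
  rw [eigSum, Fintype.sum_option]
  simp [form, legParam, extraParam, add_comm]

theorem eigProd_eq (z : ParamIndex a → ℂ) (k : Fin (r + 1)) (i : Fin (n * ell a)) :
    Λ.eigProd z k i = legParam z k (Λ.lab k i) * extraParam z ^ (-2 * Λ.weight k i) := by
  rw [eigProd, Fintype.prod_option, mul_comm, Finset.prod_eq_single ⟨k, Λ.lab k i⟩]
  · simp [form, legParam, extraParam]
  · intro p _ hp
    simp [form, Ne.symm hp]
  · simp

theorem weight_congr {k : Fin (r + 1)} {i j : Fin (n * ell a)} (h : Λ.SameClass k i j) :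
    Λ.weight k i = Λ.weight k j := by
  unfold weight
  by_cases hk : k = Fin.last r
  · simp only [if_pos hk, h.1, h.2 hk]
  · rw [if_neg hk, if_neg hk]

theorem isSimpleEigenvalue_of (c : Fin (r + 1) → Fin (n * ell a) → ℂ)
    (h : ∀ k i j, ¬ Λ.SameClass k i j → c k i ≠ c k j) :
    IsSimpleEigenvalue c (Fin.last r) Λ.pt := by
  intro i hi
  by_contra hne
  exact h _ _ _ (fun hs => hne ((hs.2 rfl).mpr rfl)) hi

theorem compat_eigSum {z : ParamIndex a → ℂ} (hz : z ∈ linearLocus (hbarForm a)) :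
    RelKind.sum.Compat (Λ.eigSum z) := by
  change ∑ k, ∑ i, ∑ p, (Λ.form 1 k i p : ℂ) * z p = 0
  have h1 : ∀ p, ∑ k, ∑ i, (Λ.form 1 k i p : ℂ) * z p = n * (hbarForm a p * z p) := fun p => by
    simp only [← Finset.sum_mul]
    rw [← mul_assoc]
    congr 1
    exact_mod_cast Λ.sum_form 1 p
  have h2 : ∑ p, (hbarForm a p : ℂ) * z p = 0 := hz
  rw [Finset.sum_congr rfl fun k _ => Finset.sum_comm, Finset.sum_comm]
  simp only [h1, ← Finset.mul_sum, h2, mul_zero]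

theorem prod_zpow_sum {σ ι : Type} [Fintype σ] (t : Finset ι) (l : ι → σ → ℤ) {z : σ → ℂ}
    (hz : ∀ p, z p ≠ 0) : ∏ p, z p ^ (∑ i ∈ t, l i p) = ∏ i ∈ t, ∏ p, z p ^ l i p := by
  rw [Finset.prod_comm]
  refine Finset.prod_congr rfl fun p _ => ?_
  classical
  induction t using Finset.induction_on with
  | empty => simp
  | insert i t hi ih => rw [Finset.sum_insert hi, Finset.prod_insert hi, zpow_add₀ (hz p), ih]

theorem compat_eigProd {z : ParamIndex a → ℂ} (hz : z ∈ torusLocus (hbarForm a)) :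
    RelKind.prod.Compat (Λ.eigProd z) := by
  change ∏ k, ∏ i, ∏ p, z p ^ Λ.form (-2) k i p = 1
  simp only [← prod_zpow_sum _ _ hz.1, Λ.sum_form]
  have h1 : ∀ p, z p ^ ((n : ℤ) * hbarForm a p) = (z p ^ hbarForm a p) ^ n := fun p => by
    rw [mul_comm, zpow_mul, zpow_natCast]
  simp only [h1, Finset.prod_pow, hz.2, one_pow]

theorem generic_eigSum {z : ParamIndex a → ℂ} (h : ∀ x, ∑ p, Λ.condForm 1 x p * z p ≠ 0) :
    (∀ k i j, ¬ Λ.SameClass k i j → Λ.eigSum z k i ≠ Λ.eigSum z k j) ∧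
      RelKind.sum.Generic (Λ.eigSum z) (Fin.last r) Λ.pt := by
  constructor
  · intro k i j hij heq
    refine h (.inl ⟨(k, i, j), hij⟩) ?_
    rw [← sub_eq_zero] at heq
    rw [← heq, eigSum, eigSum, ← Finset.sum_sub_distrib]
    refine Finset.sum_congr rfl fun p _ => ?_
    simp only [condForm]
    push_cast
    ring
  · intro t ht e he hc
    refine h (.inr ⟨⟨⟨t, ht⟩, e⟩, he⟩) ?_
    have hc' : ∑ k, ∑ i, ∑ p, (Λ.form 1 k (e k i) p : ℂ) * z p = 0 := hc
    rw [← hc', Finset.sum_congr rfl fun k _ => Finset.sum_comm, Finset.sum_comm]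
    refine Finset.sum_congr rfl fun p _ => ?_
    simp only [condForm, ← Finset.sum_mul]
    push_cast
    rfl

theorem generic_eigProd {z : ParamIndex a → ℂ} (hz : ∀ p, z p ≠ 0)
    (h : ∀ x, ∏ p, z p ^ Λ.condForm (-2) x p ≠ 1) :
    (∀ k i j, ¬ Λ.SameClass k i j → Λ.eigProd z k i ≠ Λ.eigProd z k j) ∧
      RelKind.prod.Generic (Λ.eigProd z) (Fin.last r) Λ.pt := by
  constructor
  · intro k i j hij heq
    refine h (.inl ⟨(k, i, j), hij⟩) ?_
    simp only [condForm, zpow_sub₀ (hz _), Finset.prod_div_distrib]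
    rw [eigProd, eigProd] at heq
    rw [heq]
    exact div_self (Finset.prod_ne_zero_iff.mpr fun p _ => zpow_ne_zero _ (hz p))
  · intro t ht e he hc
    refine h (.inr ⟨⟨⟨t, ht⟩, e⟩, he⟩) ?_
    simp only [condForm, prod_zpow_sum _ _ hz]
    exact hc

end Labelling

end Labelling

end DeligneSimpson
end

open scoped Kronecker TensorProduct

noncomputable section

namespace DeligneSimpson

open Matrix

/-! ### Conjugacy classes in terms of eigenvalue lists. -/

section Similar

variable {N : ℕ}

/-- Changing the identification of the index sets only changes the diagonalizing matrices by a
permutation, so one enumeration `e` of the eigenvalues serves for all. -/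
theorem similar_iff {ι : Type} [Fintype ι] [DecidableEq ι] (X : Matrix (Fin N) (Fin N) ℂ)
    {Y P Q : Matrix ι ι ℂ} {d : ι → ℂ} (hPQ : P * Q = 1) (hY : Y = P * diagonal d * Q)
    (e : ι ≃ Fin N) {f : Fin N → ℂ} (hf : ∀ x, f (e x) = d x) :
    Similar X Y ↔ ∃ G H, G * H = 1 ∧ X = G * diagMat ℂ f * H := by
  have hD : diagMat ℂ f = (diagonal d).submatrix e.symm e.symm := by
    rw [submatrix_diagonal_equiv, diagMat]
    congr 1
    ext i
    rw [Function.comp_apply, ← hf, Equiv.apply_symm_apply]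
    rfl
  have key : ∀ e' : ι ≃ Fin N, ∃ A B : Matrix (Fin N) (Fin N) ℂ, A * B = 1 ∧ B * A = 1 ∧
      reindex e' e' Y = A * diagMat ℂ f * B := fun e' => by
    have h1 : P.submatrix e'.symm e.symm * Q.submatrix e.symm e'.symm = 1 := by
      rw [submatrix_mul_equiv, hPQ, submatrix_one_equiv]
    refine ⟨_, _, h1, mul_eq_one_comm.mp h1, ?_⟩
    rw [hD, submatrix_mul_equiv, submatrix_mul_equiv, ← hY]
    rfl
  constructor
  · rintro ⟨e', u, hu⟩
    obtain ⟨A, B, hAB, hBA, h⟩ := key e'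
    refine ⟨(u⁻¹ : (Matrix (Fin N) (Fin N) ℂ)ˣ) * A, B * u, ?_, ?_⟩
    · rw [mul_assoc, ← mul_assoc A, hAB, one_mul, Units.inv_mul]
    · have h1 : (u : Matrix (Fin N) (Fin N) ℂ) * X = reindex e' e' Y * u := hu
      rw [h] at h1
      calc X = (u⁻¹ : (Matrix (Fin N) (Fin N) ℂ)ˣ) * (u * X) := (Units.inv_mul_cancel_left _ _).symm
        _ = _ := by rw [h1]; simp only [mul_assoc]
  · rintro ⟨G, H, hGH, rfl⟩
    obtain ⟨A, B, hAB, hBA, h⟩ := key e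
    have hHG := mul_eq_one_comm.mp hGH
    refine ⟨e, ⟨A * H, G * B, ?_, ?_⟩, ?_⟩
    · rw [mul_assoc, ← mul_assoc H, hHG, one_mul, hAB]
    · rw [mul_assoc, ← mul_assoc B, hBA, one_mul, hGH]
    · change A * H * (G * diagMat ℂ f * H) = reindex e e Y * (A * H)
      rw [h]
      calc A * H * (G * diagMat ℂ f * H) = A * (H * G) * diagMat ℂ f * H := by
            simp only [mul_assoc]
        _ = A * diagMat ℂ f * (B * A) * H := by rw [hHG, hBA, mul_one, mul_one]
        _ = _ := by simp only [mul_assoc]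

theorem mem_solSet {m : ℕ} {κ : RelKind} {c : Fin m → Fin N → ℂ}
    {X : Fin m → Matrix (Fin N) (Fin N) ℂ} :
    X ∈ solSet κ c ↔ κ.rel X = 0 ∧ ∀ k, ∃ G H, G * H = 1 ∧ X k = G * diagMat ℂ (c k) * H := by
  constructor
  · rintro ⟨f, hf⟩
    obtain rfl : X = fun k => f.mapMatrix (univSol κ c k) := funext hf
    exact ⟨rel_mapMatrix_univSol f, fun k => ⟨_, _, mapMatrix_univFrame_mul f k,
      mapMatrix_univSol f k⟩⟩
  · rintro ⟨hrel, h⟩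
    choose G H hGH hX using h
    obtain ⟨f, h1, h2⟩ := exists_frameRing_hom (κ := κ) G H hGH (by rwa [← funext hX])
    exact ⟨f, fun k => by rw [mapMatrix_univSol, h1, h2, hX]⟩

end Similar

/-! ### The spectrum of `T`. -/

section MatT

variable {n : ℕ}

/-- With `J` the all-ones matrix, `T = J - 1` and `J² = n J` leave only the eigenvalues `n - 1` and
`-1`; trace zero forces the first to occur exactly once. -/
theorem exists_diagonalization_matT (hn : n ≠ 0) :
    ∃ (G H : Matrix (Fin n) (Fin n) ℂ) (i₁ : Fin n), G * H = 1 ∧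
      matT n = G * diagonal (fun i => if i = i₁ then (n : ℂ) - 1 else -1) * H := by
  classical
  let J : Matrix (Fin n) (Fin n) ℂ := of fun _ _ => 1
  have hT : matT n = J - 1 := by
    ext i j
    by_cases h : i = j <;> simp [matT, J, h]
  have hJ : J * J = (n : ℂ) • J := by
    ext i j
    simp [J, mul_apply]
  have hne : (n : ℂ) - 1 ≠ -1 := by
    intro h
    have : (n : ℂ) = 0 := by linear_combination h
    exact hn (by exact_mod_cast this)
  obtain ⟨G, H, d, hGH, hd, hX⟩ := exists_diagonalization (matT n) {(n : ℂ) - 1, -1} (by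
    rw [Finset.prod_pair hne, map_mul, map_sub (Polynomial.aeval _), map_sub (Polynomial.aeval _),
      Polynomial.aeval_X, Polynomial.aeval_C,
      Polynomial.aeval_C, Algebra.algebraMap_eq_smul_one, Algebra.algebraMap_eq_smul_one, hT,
      sub_smul, neg_smul, one_smul]
    have h1 : (J - 1 - ((n : ℂ) • (1 : Matrix (Fin n) (Fin n) ℂ) - 1)) * (J - 1 - -1) =
        J * J - (n : ℂ) • J := by
      rw [sub_sub_sub_cancel_right, sub_neg_eq_add, sub_add_cancel, sub_mul, smul_mul_assoc, one_mul]
    rw [h1, hJ, sub_self])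
  have htr : ∑ i, d i = 0 := by
    have h1 := congrArg trace hX
    rw [trace_conj_diagMat hGH] at h1
    have h2 : trace (matT n) = 0 := by simp [trace, matT]
    rw [h2] at h1
    exact h1.symm
  have hd' : ∀ i, d i = (if d i = n - 1 then (n : ℂ) else 0) - 1 := fun i => by
    have := hd i
    rw [Finset.mem_insert, Finset.mem_singleton] at this
    split_ifs with h
    · exact h
    · rw [this.resolve_left h, zero_sub]
  have hcard : (Finset.univ.filter fun i => d i = n - 1).card = 1 := by
    rw [Finset.sum_congr rfl fun i _ => hd' i, Finset.sum_sub_distrib, ← Finset.sum_filter,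
      Finset.sum_const, Finset.sum_const, Finset.card_univ, Fintype.card_fin, nsmul_eq_mul,
      nsmul_eq_mul, mul_one, sub_eq_zero] at htr
    have h1 : (n : ℂ) ≠ 0 := by exact_mod_cast hn
    have h2 := mul_right_cancel₀ h1 (htr.trans (one_mul _).symm)
    exact_mod_cast h2
  obtain ⟨i₁, hi₁⟩ := Finset.card_eq_one.mp hcard
  have hi : ∀ i, d i = n - 1 ↔ i = i₁ := fun i => by
    simpa using Finset.ext_iff.mp hi₁ i
  refine ⟨G, H, i₁, hGH, ?_⟩
  rw [hX]
  congr 2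
  rw [diagMat]
  congr 1
  ext i
  have h3 := hd' i
  change d i = _
  split_ifs with h
  · exact (hi i).mpr h
  · rw [if_neg (mt (hi i).mp h)] at h3
    rw [h3, zero_sub]

/-- The exponential is diagonalized by the same basis. The exponents are written as `-2` times the
eigenvalues of `-T` to match `Labelling.weight`. -/
theorem tPowTwoT_eq {t : ℂ} (ht : t ≠ 0) {G H : Matrix (Fin n) (Fin n) ℂ} {i₁ : Fin n}
    (hGH : G * H = 1)
    (hT : matT n = G * diagonal (fun i => if i = i₁ then (n : ℂ) - 1 else -1) * H) :
    tPowTwoT n t = G * diagonal (fun i => t ^ (-2 * (1 - if i = i₁ then (n : ℤ) else 0))) * H := by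
  have hH : H = G⁻¹ := (inv_eq_right_inv hGH).symm
  have hG : IsUnit G := ⟨⟨G, H, hGH, mul_eq_one_comm.mp hGH⟩, rfl⟩
  have h1 : (2 * Complex.log t) • matT n = G * diagonal (fun i => 2 * Complex.log t *
      if i = i₁ then (n : ℂ) - 1 else -1) * G⁻¹ := by
    rw [hT, hH, ← smul_mul_assoc, ← mul_smul_comm, ← diagonal_smul]
    rfl
  rw [tPowTwoT, h1, exp_conj _ _ hG, exp_diagonal, hH]
  congr 3
  ext i
  have hexp : Complex.exp (Complex.log t) = t := Complex.exp_log ht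
  rw [Pi.coe_exp, ← Complex.exp_eq_exp_ℂ]
  nth_rewrite 2 [← hexp]
  rw [← Complex.exp_int_mul]
  congr 1
  split_ifs <;> push_cast <;> ring

end MatT

/-! ### The varieties of solutions as sets of matrices with given eigenvalues. -/

section Legs

variable {r : ℕ} {a : Fin (r + 1) → ℕ} {n : ℕ}

theorem legMatrix_eq (c : ∀ k, Fin (legLength a k) → ℂ) (k : Fin (r + 1)) :
    legMatrix a n c k = 1 * diagonal (fun x => c k x.1) * 1 := by
  rw [legMatrix, ← diagonal_one, diagonal_kronecker_diagonal, one_mul, mul_one]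
  simp

theorem lastLegMatrix_eq (c : ∀ k, Fin (legLength a k) → ℂ) {B P Q : Matrix (Fin n) (Fin n) ℂ}
    {d : Fin n → ℂ} (hB : B = P * diagonal d * Q) :
    lastLegMatrix a n c B = fromBlocks P 0 0 1 *
      diagonal (Sum.elim d fun x => c (Fin.last r) x.1.castSucc) * fromBlocks Q 0 0 1 := by
  rw [lastLegMatrix, ← fromBlocks_diagonal, fromBlocks_multiply, fromBlocks_multiply, hB,
    ← diagonal_one, diagonal_kronecker_diagonal]
  simp

/-- Labels are read off from enumerations of the index sets of the model matrices; the distinguished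
index is the place of the simple eigenvalue of `T`. -/
theorem exists_labelling (hdvd : ∀ k, legLength a k ∣ ell a) (i₁ : Fin n) :
    ∃ Λ : Labelling a n,
      (∀ k : Fin r, ∃ e : Fin (legLength a k.castSucc) × Fin (n * ell a / legLength a k.castSucc) ≃
        Fin (n * ell a), ∀ x, Λ.lab k.castSucc (e x) = x.1) ∧
      ∃ e : Fin n ⊕ Fin (a (Fin.last r)) × Fin n ≃ Fin (n * ell a),
        (∀ i, Λ.lab (Fin.last r) (e (.inl i)) = Fin.last _) ∧
        (∀ x, Λ.lab (Fin.last r) (e (.inr x)) = x.1.castSucc) ∧ e (.inl i₁) = Λ.pt := by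
  have he : ∀ k, Fintype.card (Fin (legLength a k) × Fin (n * ell a / legLength a k)) =
      n * ell a := fun k => by
    rw [Fintype.card_prod, Fintype.card_fin, Fintype.card_fin,
      Nat.mul_div_cancel' ((hdvd k).mul_left n)]
  have he' : Fintype.card (Fin n ⊕ Fin (a (Fin.last r)) × Fin n) = n * ell a := by
    simp only [Fintype.card_sum, Fintype.card_prod, Fintype.card_fin]
    ring
  let e := fun k => Fintype.equivFinOfCardEq (he k)
  let e' := Fintype.equivFinOfCardEq he'
  let lab : ∀ k, Fin (n * ell a) → Fin (legLength a k) :=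
    Fin.lastCases (motive := fun k => Fin (n * ell a) → Fin (legLength a k))
      (fun i => Sum.elim (fun _ => Fin.last _) (fun x => x.1.castSucc) (e'.symm i))
      (fun k i => ((e k.castSucc).symm i).1)
  have hlab : ∀ k : Fin r, ∀ x, lab k.castSucc (e k.castSucc x) = x.1 := fun k x => by
    simp only [lab, Fin.lastCases_castSucc, Equiv.symm_apply_apply]
  have hlab' : ∀ x, lab (Fin.last r) (e' x) = Sum.elim (fun _ => Fin.last _) (fun x => x.1.castSucc) x :=
    fun x => by simp only [lab, Fin.lastCases_last, Equiv.symm_apply_apply]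
  have hcard : ∀ {ι : Type} [Fintype ι] (e : ι ≃ Fin (n * ell a)) (p : Fin (n * ell a) → Prop)
      [DecidablePred p], (Finset.univ.filter p).card = (Finset.univ.filter fun x => p (e x)).card :=
    fun e p _ => by
      rw [← Fintype.card_subtype, ← Fintype.card_subtype]
      exact (Fintype.card_congr (e.subtypeEquiv fun _ => Iff.rfl)).symm
  refine ⟨⟨lab, e' (.inl i₁), by rw [hlab']; rfl, fun k j => ?_⟩, fun k => ⟨e k.castSucc, hlab k⟩,
    e', fun i => hlab' _, fun x => hlab' _, rfl⟩
  induction k using Fin.lastCases with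
  | last =>
    rw [hcard e', Nat.div_self (Nat.succ_pos _), mul_one, Finset.card_filter, Fintype.sum_sum_type]
    simp only [hlab', Sum.elim_inl, Sum.elim_inr, Fintype.sum_prod_type]
    induction j using Fin.lastCases with
    | last =>
      have h : ∀ x : Fin (a (Fin.last r)), x.castSucc ≠ Fin.last _ :=
        fun x => (Fin.castSucc_lt_last x).ne
      simp [h]
    | cast j =>
      have h : Fin.last (a (Fin.last r)) ≠ j.castSucc := (Fin.castSucc_lt_last j).ne'
      simp [h]
  | cast k =>
    rw [hcard (e k.castSucc)]
    simp only [hlab]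
    have : (Finset.univ.filter fun x : Fin (legLength a k.castSucc) ×
        Fin (n * ell a / legLength a k.castSucc) => x.1 = j) = {j} ×ˢ Finset.univ := by
      ext ⟨x, y⟩
      simp [eq_comm]
    rw [this, Finset.card_product, Finset.card_singleton, one_mul, Finset.card_univ,
      Fintype.card_fin, Nat.mul_div_assoc n (hdvd _)]

/-- One labelling works for all parameters, because `T` is diagonalized once and for all. This is
what makes the genericity conditions a fixed finite list. -/
theorem exists_labelling_solutions (hdvd : ∀ k, legLength a k ∣ ell a) (hn : n ≠ 0) :
    ∃ Λ : Labelling a n, ∀ z : ParamIndex a → ℂ,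
      addSolutions a n (legParam z) (extraParam z) = solSet RelKind.sum (Λ.eigSum z) ∧
      (extraParam z ≠ 0 →
        mulSolutions a n (legParam z) (extraParam z) = solSet RelKind.prod (Λ.eigProd z)) := by
  obtain ⟨G, H, i₁, hGH, hT⟩ := exists_diagonalization_matT hn
  obtain ⟨Λ, he, e', hl, hr, hpt⟩ := exists_labelling hdvd i₁
  have hw : ∀ (k : Fin r) i, Λ.weight k.castSucc i = 0 := fun k i =>
    if_neg (Fin.castSucc_lt_last k).ne
  have hwl : ∀ i, Λ.weight (Fin.last r) (e' (.inl i)) = 1 - if i = i₁ then (n : ℤ) else 0 :=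
    fun i => by
      rw [Labelling.weight, if_pos rfl, hl, if_pos rfl, ← hpt]
      simp only [e'.injective.eq_iff, Sum.inl_injective.eq_iff]
  have hwr : ∀ x, Λ.weight (Fin.last r) (e' (.inr x)) = 0 := fun x => by
    rw [Labelling.weight, if_pos rfl, hr, if_neg (Fin.castSucc_lt_last _).ne, ← hpt,
      if_neg fun h => Sum.inr_ne_inl (e'.injective h), sub_zero]
  have hblock : (fromBlocks G 0 0 1 * fromBlocks H 0 0 1 :
      Matrix (Fin n ⊕ Fin (a (Fin.last r)) × Fin n) (Fin n ⊕ Fin (a (Fin.last r)) × Fin n) ℂ) =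
        1 := by
    rw [fromBlocks_multiply, ← fromBlocks_one]
    simp [hGH]
  refine ⟨Λ, fun z => ⟨?_, fun hz => ?_⟩⟩
  · have hleg : ∀ (k : Fin r) X, Similar X (legMatrix a n (legParam z) k.castSucc) ↔
        ∃ G H, G * H = 1 ∧ X = G * diagMat ℂ (Λ.eigSum z k.castSucc) * H := fun k X => by
      obtain ⟨e, he⟩ := he k
      exact similar_iff X (one_mul 1) (legMatrix_eq _ _) e fun x => by
        rw [Λ.eigSum_eq, hw, he, Int.cast_zero, zero_mul, add_zero]
    have hlast : ∀ X, Similar X (lastLegMatrix a n (legParam z)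
        (legParam z (Fin.last r) (Fin.last _) • (1 : Matrix (Fin n) (Fin n) ℂ) -
          extraParam z • matT n)) ↔
        ∃ G H, G * H = 1 ∧ X = G * diagMat ℂ (Λ.eigSum z (Fin.last r)) * H := fun X => by
      have hB : legParam z (Fin.last r) (Fin.last _) • (1 : Matrix (Fin n) (Fin n) ℂ) -
          extraParam z • matT n = G * diagonal (fun i => legParam z (Fin.last r) (Fin.last _) -
            extraParam z * (if i = i₁ then (n : ℂ) - 1 else -1)) * H := by
        have h1 : diagonal (fun i => legParam z (Fin.last r) (Fin.last _) -
            extraParam z * (if i = i₁ then (n : ℂ) - 1 else -1)) =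
            legParam z (Fin.last r) (Fin.last _) • (1 : Matrix (Fin n) (Fin n) ℂ) -
            extraParam z • diagonal (fun i => if i = i₁ then (n : ℂ) - 1 else -1) := by
          rw [← diagonal_smul, smul_one_eq_diagonal, diagonal_sub]
          rfl
        rw [h1, hT, mul_sub, sub_mul, mul_smul_comm, mul_one, smul_mul_assoc, hGH, mul_smul_comm,
          smul_mul_assoc]
      refine similar_iff X hblock (lastLegMatrix_eq _ hB) e' fun x => ?_
      rw [Λ.eigSum_eq]
      rcases x with i | x
      · rw [hwl, hl, Sum.elim_inl]
        split_ifs <;> push_cast <;> ring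
      · rw [hwr, hr, Int.cast_zero, zero_mul, add_zero, Sum.elim_inr]
    ext X
    rw [mem_solSet, Fin.forall_fin_succ']
    simp only [← hleg, ← hlast]
    rfl
  · have hleg : ∀ (k : Fin r) X, Similar X (legMatrix a n (legParam z) k.castSucc) ↔
        ∃ G H, G * H = 1 ∧ X = G * diagMat ℂ (Λ.eigProd z k.castSucc) * H := fun k X => by
      obtain ⟨e, he⟩ := he k
      exact similar_iff X (one_mul 1) (legMatrix_eq _ _) e fun x => by
        rw [Λ.eigProd_eq, hw, he, mul_zero, zpow_zero, mul_one]
    have hlast : ∀ X, Similar X (lastLegMatrix a n (legParam z)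
        (legParam z (Fin.last r) (Fin.last _) • tPowTwoT n (extraParam z))) ↔
        ∃ G H, G * H = 1 ∧ X = G * diagMat ℂ (Λ.eigProd z (Fin.last r)) * H := fun X => by
      have hB : legParam z (Fin.last r) (Fin.last _) • tPowTwoT n (extraParam z) =
          G * diagonal (fun i => legParam z (Fin.last r) (Fin.last _) *
            extraParam z ^ (-2 * (1 - if i = i₁ then (n : ℤ) else 0))) * H := by
        rw [tPowTwoT_eq hz hGH hT, ← smul_mul_assoc, ← mul_smul_comm, ← diagonal_smul]
        rfl
      refine similar_iff X hblock (lastLegMatrix_eq _ hB) e' fun x => ?_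
      rw [Λ.eigProd_eq]
      rcases x with i | x
      · rw [hwl, hl, Sum.elim_inl]
      · rw [hwr, hr, mul_zero, zpow_zero, mul_one, Sum.elim_inr]
    ext X
    rw [mem_solSet, Fin.forall_fin_succ']
    simp only [← hleg, ← hlast]
    refine ⟨fun h => ⟨sub_eq_zero.mpr h.2.1, h.2.2⟩, fun h => ?_⟩
    have hprod : (List.ofFn X).prod = 1 := sub_eq_zero.mp h.1
    refine ⟨fun k => ?_, hprod, h.2⟩
    -- Invertibility of each factor follows from the product being `1`.
    have h1 := congrArg (detMonoidHom (n := Fin (n * ell a)) (R := ℂ)) hprod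
    rw [map_list_prod, List.map_ofFn, List.prod_ofFn, map_one] at h1
    rw [isUnit_iff_isUnit_det]
    refine isUnit_iff_ne_zero.mpr ?_
    exact Finset.prod_ne_zero_iff.mp (h1 ▸ one_ne_zero) k (Finset.mem_univ k)

end Legs

end DeligneSimpson
end

open scoped Kronecker TensorProduct

noncomputable section

namespace DeligneSimpson

/-! ### Numerical properties of affine stars and the dimension count. -/

section Numerics

variable {r : ℕ} {a : Fin (r + 1) → ℕ} {n : ℕ}

/-- These are the only facts used about the four diagrams. The second is `∑ 1/d_k = m - 2` cleared
of denominators, with `m = r + 1`. -/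
theorem IsAffineStar.dvd_and_sum (ha : IsAffineStar a) :
    (∀ k, legLength a k ∣ ell a) ∧ ∑ k, ell a / legLength a k + 2 * ell a = (r + 1) * ell a := by
  obtain ⟨h, hmax⟩ := ha
  have hmem : ∀ (s : Multiset ℕ), Finset.univ.val.map (legLength a) = s → (∀ k, legLength a k ∈ s) ∧
      (∀ d ∈ s, d ≤ ell a) ∧ r + 1 = s.card ∧ ∀ g : ℕ → ℕ, ∑ k, g (legLength a k) = (s.map g).sum := by
    rintro s rfl
    refine ⟨fun k => Multiset.mem_map_of_mem _ (Finset.mem_univ k), fun d hd => ?_, by simp,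
      fun g => by rw [Multiset.map_map]; rfl⟩
    obtain ⟨k, -, rfl⟩ := Multiset.mem_map.mp hd
    exact hmax k
  have key : ∀ (s : Multiset ℕ) (l : ℕ), Finset.univ.val.map (legLength a) = s → l ∈ s →
      (∀ d ∈ s, d ∣ l ∧ d ≤ l) → (s.map fun d => l / d).sum + 2 * l = s.card * l →
      (∀ k, legLength a k ∣ ell a) ∧ ∑ k, ell a / legLength a k + 2 * ell a = (r + 1) * ell a := by
    intro s l hs hl hd hsum
    obtain ⟨h1, h2, h3, h4⟩ := hmem s hs
    have hell : ell a = l := le_antisymm (hd _ (h1 _)).2 (h2 l hl)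
    rw [hell]
    exact ⟨fun k => (hd _ (h1 k)).1, by rw [h4 fun d => l / d, hsum, ← h3]⟩
  rcases h with h | h | h | h
  · exact key _ 2 h (by decide) (by decide) (by decide)
  · exact key _ 3 h (by decide) (by decide) (by decide)
  · exact key _ 4 h (by decide) (by decide) (by decide)
  · exact key _ 6 h (by decide) (by decide) (by decide)

theorem pairCount_eq_sum {N : ℕ} (c : Fin N → ℂ) :
    pairCount c = ∑ i, (Finset.univ.filter fun j => c i = c j).card := by
  classical
  rw [pairCount, Fintype.card_subtype, Finset.card_filter, Fintype.sum_prod_type]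
  simp only [Finset.card_filter]

namespace Labelling

variable (Λ : Labelling a n)

/-- Each label has multiplicity `nℓ/d_k`, except that on the last leg the last label splits into the
distinguished index alone and the other `n - 1` indices; the correction encodes the sizes `1` and `n
- 1`. -/
theorem card_sameClass (k : Fin (r + 1)) (i : Fin (n * ell a)) [DecidablePred (Λ.SameClass k i)] :
    ((Finset.univ.filter fun j => Λ.SameClass k i j).card : ℤ) =
      n * (ell a / legLength a k : ℕ) - if k = Fin.last r then
        (if Λ.lab k i = Fin.last _ then 1 else 0) + (if i = Λ.pt then (n : ℤ) - 2 else 0) else 0 := by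
  classical
  have hfib := Λ.card_lab k (Λ.lab k i)
  by_cases hk : k = Fin.last r
  · subst hk
    rw [if_pos rfl]
    by_cases hi : i = Λ.pt
    · have h1 : (Finset.univ.filter fun j => Λ.SameClass (Fin.last r) i j) = {Λ.pt} := by
        ext j
        simp only [Finset.mem_filter, Finset.mem_univ, true_and, Finset.mem_singleton, SameClass]
        constructor
        · exact fun h => (h.2 trivial).mp hi
        · rintro rfl
          exact ⟨by rw [hi], fun _ => by simp [hi]⟩
      rw [h1, if_pos hi, hi, Λ.lab_pt, if_pos rfl, Nat.div_self (Nat.succ_pos _)]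
      simp
      ring
    · have h1 : (Finset.univ.filter fun j => Λ.SameClass (Fin.last r) i j) =
          (Finset.univ.filter fun j => Λ.lab (Fin.last r) j = Λ.lab (Fin.last r) i).erase Λ.pt := by
        ext j
        simp only [Finset.mem_filter, Finset.mem_univ, true_and, Finset.mem_erase, SameClass, hi,
          false_iff, forall_const]
        exact ⟨fun h => ⟨h.2, h.1.symm⟩, fun h => ⟨h.2.symm, h.1⟩⟩
      rw [h1, if_neg hi]
      by_cases hl : Λ.lab (Fin.last r) i = Fin.last _
      · have hmem : Λ.pt ∈ Finset.univ.filter fun j =>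
            Λ.lab (Fin.last r) j = Λ.lab (Fin.last r) i := by
          simp [Λ.lab_pt, hl]
        have h2 := Finset.card_erase_add_one hmem
        rw [hfib] at h2
        rw [if_pos hl]
        have h3 : ((((Finset.univ.filter fun j =>
          Λ.lab (Fin.last r) j = Λ.lab (Fin.last r) i).erase Λ.pt).card + 1 : ℕ) : ℤ) = _ :=
          congrArg _ h2
        push_cast at h3 ⊢
        linarith
      · rw [Finset.erase_eq_of_notMem (by simp [Λ.lab_pt, Ne.symm hl]), hfib, if_neg hl]
        push_cast
        ring
  · have h1 : (Finset.univ.filter fun j => Λ.SameClass k i j) =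
        Finset.univ.filter fun j => Λ.lab k j = Λ.lab k i := by
      ext j
      simp only [Finset.mem_filter, Finset.mem_univ, true_and, SameClass, hk, false_imp_iff,
        and_true]
      rw [eq_comm]
    rw [h1, hfib, if_neg hk, sub_zero, Nat.cast_mul]

/-- The correction `2n - 2` on the last leg is `n² - (1 + (n - 1)²)`. -/
theorem pairCount_eq (c : Fin (n * ell a) → ℂ) (k : Fin (r + 1))
    (hc : ∀ i j, c i = c j ↔ Λ.SameClass k i j) :
    (pairCount c : ℤ) = n ^ 2 * ell a * (ell a / legLength a k : ℕ) -
      if k = Fin.last r then 2 * (n : ℤ) - 2 else 0 := by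
  classical
  rw [pairCount_eq_sum]
  simp only [hc]
  push_cast
  simp only [card_sameClass, Finset.sum_sub_distrib, Finset.sum_const, Finset.card_univ,
    Fintype.card_fin, nsmul_eq_mul]
  congr 1
  · push_cast
    ring
  · by_cases hk : k = Fin.last r
    · subst hk
      simp only [if_true, Finset.sum_add_distrib]
      rw [Finset.sum_boole, Λ.card_lab, Nat.div_self (Nat.succ_pos _), Finset.sum_ite_eq' Finset.univ]
      simp
      ring
    · simp [hk]

/-- The affine condition gives `∑ pairCount = (m - 2) N² - (2n - 2)`: the quadratic terms cancel and
only the splitting of the last eigenspace contributes. -/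
theorem dimension_eq (hsum : ∑ k, ell a / legLength a k + 2 * ell a = (r + 1) * ell a)
    (c : Fin (r + 1) → Fin (n * ell a) → ℂ) (hc : ∀ k i j, c k i = c k j ↔ Λ.SameClass k i j) :
    2 * n + 2 * (n * ell a) ^ 2 + ∑ k, pairCount (c k) = (r + 1) * (n * ell a) ^ 2 + 2 := by
  zify
  simp only [fun k => Λ.pairCount_eq (c k) k (hc k), Finset.sum_sub_distrib, ← Finset.mul_sum,
    Finset.sum_ite_eq', Finset.mem_univ, if_true]
  have h1 : (∑ k, ((ell a / legLength a k : ℕ) : ℤ)) + 2 * ell a = (r + 1) * ell a := by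
    exact_mod_cast hsum
  have h2 : (ell a : ℤ) = (a (Fin.last r) : ℤ) + 1 := Nat.cast_succ _
  linear_combination (n : ℤ) ^ 2 * ell a * h1 +
    (n : ℤ) ^ 2 * (r - 1) * ((ell a : ℤ) + a (Fin.last r) + 1) * h2

end Labelling

theorem addParams_eq (hdvd : ∀ k, legLength a k ∣ ell a) :
    addParams a = linearLocus (hbarForm a) := by
  ext z
  have h1 : hbarParam a (legParam z) = ∑ p, hbarForm a p * z p := by
    rw [hbarParam, Fintype.sum_option, Fintype.sum_sigma, Finset.mul_sum]
    simp only [hbarForm, Int.cast_zero, zero_mul, zero_add]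
    refine Finset.sum_congr rfl fun k _ => ?_
    rw [Finset.mul_sum]
    refine Finset.sum_congr rfl fun j _ => ?_
    have h2 : (legLength a k : ℂ) ≠ 0 := Nat.cast_ne_zero.mpr (Nat.succ_ne_zero _)
    rw [Int.cast_natCast, Nat.cast_div (hdvd k) h2, legParam]
    ring
  change hbarParam a (legParam z) = 0 ↔ _
  rw [h1]
  rfl

theorem mulParams_eq : mulParams a = torusLocus (hbarForm a) := by
  ext z
  have h1 : qParam a (legParam z) = (∏ p, z p ^ hbarForm a p)⁻¹ := by
    rw [qParam, Fintype.prod_option, Fintype.prod_sigma]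
    simp only [hbarForm, zpow_zero, one_mul, zpow_neg, Finset.prod_inv_distrib]
    rfl
  change ((∀ i, z i ≠ 0) ∧ qParam a (legParam z) = 1) ↔ _
  rw [h1, inv_eq_one]
  rfl

end Numerics

end DeligneSimpson
end

/-! ### Assembly of the multiplicative and additive cases. -/

theorem mainTheorem7 {r : ℕ} (a : Fin (r + 1) → ℕ) (ha : DeligneSimpson.IsAffineStar a)
    (n : ℕ) (hn : 1 ≤ n) :
    DeligneSimpson.HoldsGenerically (DeligneSimpson.mulParams a) (fun z =>
      AlgebraicGeometry.SmoothOfRelativeDimension (2 * n)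
        (DeligneSimpson.quotientByConjToSpec
          (DeligneSimpson.mulSolutions a n (DeligneSimpson.legParam z)
            (DeligneSimpson.extraParam z)))) ∧
    DeligneSimpson.HoldsGenerically (DeligneSimpson.addParams a) (fun z =>
      AlgebraicGeometry.SmoothOfRelativeDimension (2 * n)
        (DeligneSimpson.quotientByConjToSpec
          (DeligneSimpson.addSolutions a n (DeligneSimpson.legParam z)
            (DeligneSimpson.extraParam z)))) := by
  open DeligneSimpson in
  obtain ⟨hdvd, hsum⟩ := ha.dvd_and_sum
  have hn0 : n ≠ 0 := Nat.one_le_iff_ne_zero.mp hn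
  obtain ⟨Λ, hΛ⟩ := exists_labelling_solutions hdvd hn0
  have hN : 0 < n * ell a := Nat.mul_pos hn (Nat.succ_pos _)
  constructor
  -- The exponent `ℓ/d_m = 1` on the last leg is what makes `q = 1` irreducible.
  · have h₀ : hbarForm a (some ⟨Fin.last r, Fin.last _⟩) = 1 := by
      simp only [hbarForm]
      rw [Nat.div_self (Nat.succ_pos _), Nat.cast_one]
    rw [mulParams_eq]
    -- The scaling `-2` turns the eigenvalues of `-T` into the exponents of `t` in `t ^ (2 T)`.
    refine holdsGenerically_torusLocus h₀ (Λ.condForm (-2))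
      (Λ.exists_condForm_ne_zero (by decide) hn0) fun z hz h => ?_
    obtain ⟨h1, h2⟩ := Λ.generic_eigProd hz.1 h
    rw [(hΛ z).2 (hz.1 none)]
    refine smoothOfRelativeDimension_solSet hN (Λ.compat_eigProd hz)
      (Λ.isSimpleEigenvalue_of _ h1) h2 (Λ.dimension_eq hsum _ fun k i j => ⟨fun h => ?_, fun h => ?_⟩)
    · by_contra hne
      exact h1 k i j hne h
    · rw [Λ.eigProd_eq, Λ.eigProd_eq, h.1, Λ.weight_congr h]
  · rw [addParams_eq hdvd]
    refine holdsGenerically_linearLocus (Λ.condForm 1)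
      (Λ.exists_condForm_ne_zero one_ne_zero hn0) fun z hz h => ?_
    obtain ⟨h1, h2⟩ := Λ.generic_eigSum h
    rw [(hΛ z).1]
    refine smoothOfRelativeDimension_solSet hN (Λ.compat_eigSum hz)
      (Λ.isSimpleEigenvalue_of _ h1) h2 (Λ.dimension_eq hsum _ fun k i j => ⟨fun h => ?_, fun h => ?_⟩)
    · by_contra hne
      exact h1 k i j hne h
    · rw [Λ.eigSum_eq, Λ.eigSum_eq, h.1, Λ.weight_congr h]
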